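/- Let $G$ be a finite undirected graph with vertex set $V\neq\emptyset$, bulk edges $E_b$ (each joining two vertices; parallel edges and loops are allowed) and a nonempty set $E_\partial$ of half-edges, each attached to a vertex (several half-edges at a vertex are allowed). Assume that $G$ is bulk connected: any two vertices are joined by bulk edges. For $D\in\mathbb N$, attach $\mathbb C^D$ to each half-edge and to each end of each bulk edge, let $\mathcal H_x$ be the tensor product of the spaces at the vertex $x$, and let $(g_x)_{x\in V}$ be independent random vectors, $g_x\in\mathcal H_x$, whose coordinates are i.i.d. standard complex Gaussians ($\mathbb E|z|^2=1$). With $\Omega_e=D^{-1/2}\sum_{i=1}^D|i,i\rangle$, put $$\psi_G:=\Big\langle\bigotimes_{e\in E_b}\Omega_e\,\Big|\,\bigotimes_{x\in V}g_x\Big\rangle\in(\mathbb C^D)^{\otimes|E_\partial|}.$$ Let $A\subseteq E_\partial$, $B:=E_\partial\setminus A$ and $\rho_A:=\mathrm{Tr}_B|\psi_G\rangle\langle\psi_G|$. Let $G_{A|B}$ be the network obtained from $G$ by adding a source $\mathrm{id}$ and a sink $\gamma$ and joining each half-edge of $A$ to $\gamma$ and each half-edge of $B$ to $\mathrm{id}$,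 and let $F$ be its maximum flow, that is, the maximal number of pairwise edge-disjoint paths from $\mathrm{id}$ to $\gamma$. Then $\operatorname{rank}\rho_A\le D^F$ for every $D$ and every choice of the vectors $g_x$. Let $\sigma_A$ be $D^{F-|E_\partial|}\rho_A$ restricted to its support, and let $\mu_A^{(D)}:=D^{-F}\sum_{\lambda\in\mathrm{spec}(\sigma_A)}\delta_\lambda$ (eigenvalues counted with multiplicity). For $n\ge1$ let $m_n$ be the number of minimizers $\alpha\in\mathcal S_n^V$ of $$H^{(n)}(\alpha)=\sum_{(x,\cdot)\in A}|\gamma_n^{-1}\alpha_x|+\sum_{(x,\cdot)\in B}|\alpha_x|+\sum_{(x,y)\in E_b}|\alpha_x^{-1}\alpha_y|,$$ where $\gamma_n=(n\cdots 2\,1)$ and $|\sigma|$ is $n$ minus the number of cycles of $\sigma$, fixed points included. There is exactly one probability measure $\mu_{G_{A|B}}$ supported on a compact subset of $[0,\infty)$ with $\int t^n\,\mathrm d\mu_{G_{A|B}}=m_n$ for all $n\ge1$, and for every continuous function $f:\mathbb R\to\mathbb R$ (bounded or not) and every $\epsilon>0$, $$\lim_{D\to\infty}\mathbb P\left(\left|\int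 f\,\mathrm d\mu_A^{(D)}-\int f\,\mathrm d\mu_{G_{A|B}}\right|\le\epsilon\right)=1.$$ -/

import Mathlib

open MeasureTheory ProbabilityTheory Filter Topology
open scoped ENNReal

namespace RTN

/-! ### Graphs with half-edges -/

/-- A finite undirected graph with vertex set `V`, full (bulk) edges `Eb` and half-edges (boundary
edges) `Ed`. The two ends of a bulk edge are labelled by `Bool`; the labelling plays no role.
Parallel edges, loops, and several half-edges at one vertex are allowed. -/
structure OpenGraph (V Eb Ed : Type*) where
  /-- the two end points of a bulk edge -/
  bulkEnd : Eb → Bool → V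
  /-- the vertex at which a half-edge is attached -/
  bdryEnd : Ed → V

variable {V Eb Ed : Type*}

/-- The simple graph on `V` in which two distinct vertices are adjacent if a bulk edge joins them.
-/
def OpenGraph.bulkGraph (G : OpenGraph V Eb Ed) : SimpleGraph V where
  Adj x y := x ≠ y ∧ ∃ e : Eb, s(G.bulkEnd e false, G.bulkEnd e true) = s(x, y)
  symm := ⟨fun _ _ h => ⟨h.1.symm, h.2.imp fun _ he => he.trans Sym2.eq_swap⟩⟩
  loopless := ⟨fun _ h => h.1 rfl⟩

/-- All vertices are connected to each other through bulk edges. -/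
def OpenGraph.BulkConnected (G : OpenGraph V Eb Ed) : Prop := G.bulkGraph.Connected

/-- The vertex at which a tensor leg is attached. The legs are the two ends of every bulk edge and
the half-edges; every leg carries a copy of `ℂ^D`. -/
def OpenGraph.site (G : OpenGraph V Eb Ed) : (Eb × Bool) ⊕ Ed → V :=
  Sum.elim (fun p => G.bulkEnd p.1 p.2) G.bdryEnd

/-- The legs at the vertex `x`. -/
abbrev OpenGraph.Leg (G : OpenGraph V Eb Ed) (x : V) : Type _ :=
  {l : (Eb × Bool) ⊕ Ed // G.site l = x}

/-! ### The random tensors -/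

/-- A choice, for every vertex `x`, of a vector `g x` of `H_x`, the tensor product of a copy of
`ℂ^D` over the legs at `x`, given by its coordinates in the product basis. -/
abbrev OpenGraph.Tensors (G : OpenGraph V Eb Ed) (D : ℕ) : Type _ :=
  (x : V) → (G.Leg x → Fin D) → ℂ

/-- The standard complex Gaussian law: real and imaginary part are independent centred real
Gaussians of variance `1 / 2`, so that the second absolute moment is `1`. -/
noncomputable def stdComplexGaussian : Measure ℂ :=
  ((gaussianReal 0 (1 / 2)).prod (gaussianReal 0 (1 / 2))).map fun p => (⟨p.1, p.2⟩ : ℂ)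

/-- The joint law of independent Gaussian tensors, one at each vertex, all of whose coordinates
are i.i.d. standard complex Gaussians. -/
noncomputable def OpenGraph.tensorLaw [Fintype V] [DecidableEq V] [Fintype Eb] [Fintype Ed]
    [DecidableEq Eb] [DecidableEq Ed] (G : OpenGraph V Eb Ed) (D : ℕ) : Measure (G.Tensors D) :=
  Measure.pi fun x => Measure.pi fun _ : G.Leg x → Fin D => stdComplexGaussian

/-- Coordinates of the maximally entangled state `D^(-1/2) ∑ i, |i, i⟩` of `ℂ^D ⊗ ℂ^D`. -/
noncomputable def maxEntangled (D : ℕ) (i j : Fin D) : ℂ :=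
  if i = j then ((1 / Real.sqrt D : ℝ) : ℂ) else 0

/-- The tensor network state `⟨⨂ₑ Ωₑ | ⨂ₓ gₓ⟩`, a vector of the tensor product of a copy of `ℂ^D`
over the half-edges: the partial inner product over all the bulk legs. -/
noncomputable def OpenGraph.state [Fintype V] [Fintype Eb] [DecidableEq Eb]
    (G : OpenGraph V Eb Ed) (D : ℕ) (g : G.Tensors D) (i : Ed → Fin D) : ℂ :=
  ∑ c : Eb × Bool → Fin D,
    star (∏ e : Eb, maxEntangled D (c (e, false)) (c (e, true))) *
      ∏ x : V, g x fun l => Sum.elim c i l.1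

/-- Combine an index of the region `A` with an index of the complementary region. -/
def glue [DecidableEq Ed] {D : ℕ} (A : Finset Ed) (a : {e // e ∈ A} → Fin D)
    (b : {e // e ∉ A} → Fin D) (e : Ed) : Fin D :=
  if h : e ∈ A then a ⟨e, h⟩ else b ⟨e, h⟩

/-- The reduced state `ρ_A`: the partial trace of `|ψ⟩⟨ψ|` over the complement of `A`. -/
noncomputable def OpenGraph.reducedState [Fintype V] [Fintype Eb] [DecidableEq Eb] [Fintype Ed]
    [DecidableEq Ed] (G : OpenGraph V Eb Ed) (A : Finset Ed) (D : ℕ) (g : G.Tensors D) :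
    Matrix ({e // e ∈ A} → Fin D) ({e // e ∈ A} → Fin D) ℂ :=
  fun a a' => ∑ b : {e // e ∉ A} → Fin D,
    G.state D g (glue A a b) * star (G.state D g (glue A a' b))

/-! ### The network and its maximum flow -/

/-- Vertices of the network: those of the graph, a source `id` and a sink `γ`. -/
inductive NetVertex (V : Type*)
  | source : NetVertex V
  | sink : NetVertex V
  | bulk : V → NetVertex V

/-- The unordered pair of end points of an edge of the network: bulk edges are kept, a half-edge
of `A` is joined to the sink, and a half-edge outside `A` to the source. -/
def OpenGraph.netEnds [DecidableEq Ed] (G : OpenGraph V Eb Ed) (A : Finset Ed) :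
    Eb ⊕ Ed → Sym2 (NetVertex V)
  | Sum.inl e => s(.bulk (G.bulkEnd e false), .bulk (G.bulkEnd e true))
  | Sum.inr e => if e ∈ A then s(.bulk (G.bdryEnd e), .sink) else s(.source, .bulk (G.bdryEnd e))

/-- Walks in the network, recorded by their successive edges. -/
inductive OpenGraph.NetWalk [DecidableEq Ed] (G : OpenGraph V Eb Ed) (A : Finset Ed) :
    NetVertex V → NetVertex V → Type _
  | nil (u : NetVertex V) : OpenGraph.NetWalk G A u u
  | cons {u v w : NetVertex V} (e : Eb ⊕ Ed) (h : G.netEnds A e = s(u, v))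
      (p : OpenGraph.NetWalk G A v w) : OpenGraph.NetWalk G A u w

/-- The edges of a walk. -/
def OpenGraph.NetWalk.edges [DecidableEq Ed] {G : OpenGraph V Eb Ed} {A : Finset Ed} :
    {u v : NetVertex V} → G.NetWalk A u v → List (Eb ⊕ Ed)
  | _, _, .nil _ => []
  | _, _, .cons e _ p => e :: p.edges

/-- The vertices visited by a walk. -/
def OpenGraph.NetWalk.support [DecidableEq Ed] {G : OpenGraph V Eb Ed} {A : Finset Ed} :
    {u v : NetVertex V} → G.NetWalk A u v → List (NetVertex V)
  | u, _, .nil _ => [u]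
  | u, _, .cons _ _ p => u :: p.support

/-- There are `k` pairwise edge-disjoint paths from the source to the sink. -/
def OpenGraph.HasDisjointPaths [DecidableEq Ed] (G : OpenGraph V Eb Ed) (A : Finset Ed)
    (k : ℕ) : Prop :=
  ∃ p : Fin k → G.NetWalk A .source .sink, (∀ i, (p i).support.Nodup) ∧
    Pairwise fun i j => (p i).edges.Disjoint (p j).edges

/-- The maximum flow `F(G_{A|B})`: the largest number of pairwise edge-disjoint paths from the
source to the sink. -/
noncomputable def OpenGraph.maxflow [DecidableEq Ed] (G : OpenGraph V Eb Ed) (A : Finset Ed) : ℕ :=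
  sSup {k | G.HasDisjointPaths A k}

/-- The supremum that defines the maximum flow is an attained maximum. -/
theorem OpenGraph.isGreatest_maxflow [DecidableEq Ed] [Fintype Eb] [Fintype Ed]
    (G : OpenGraph V Eb Ed) (A : Finset Ed) :
    IsGreatest {k | G.HasDisjointPaths A k} (G.maxflow A) := by
  have hne : ({k | G.HasDisjointPaths A k} : Set ℕ).Nonempty :=
    ⟨0, fun i => i.elim0, fun i => i.elim0, fun i => i.elim0⟩
  have hb : BddAbove {k | G.HasDisjointPaths A k} := by
    refine ⟨Fintype.card (Eb ⊕ Ed), ?_⟩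
    rintro k ⟨p, -, hp⟩
    have h1 : ∀ i, ∃ e, e ∈ (p i).edges := by
      intro i
      cases p i with
      | cons e h q => exact ⟨e, by simp [OpenGraph.NetWalk.edges]⟩
    choose f hf using h1
    have hinj : Function.Injective f := by
      intro i j hij
      by_contra hne
      exact hp hne (hf i) (hij ▸ hf j)
    simpa using Fintype.card_le_of_injective f hinj
  exact ⟨Nat.sSup_mem hne hb, fun k hk => le_csSup hb hk⟩

/-! ### The limit measure -/

/-- `|σ| = n - #σ`, where `#σ` is the number of cycles of `σ`, fixed points included. -/
def cayleyLength {n : ℕ} (σ : Equiv.Perm (Fin n)) : ℕ := n - Multiset.card σ.partition.parts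

/-- The full cycle `γ = (n … 2 1)`. -/
def fullCycle (n : ℕ) : Equiv.Perm (Fin n) := (finRotate n)⁻¹

/-- The Hamiltonian of the network, for permutations placed on the vertices. -/
def OpenGraph.hamiltonian [Fintype Eb] [Fintype Ed] [DecidableEq Ed] (G : OpenGraph V Eb Ed)
    (A : Finset Ed) (n : ℕ) (α : V → Equiv.Perm (Fin n)) : ℕ :=
  ∑ e ∈ A, cayleyLength ((fullCycle n)⁻¹ * α (G.bdryEnd e)) +
    ∑ e ∈ Aᶜ, cayleyLength (α (G.bdryEnd e)) +
    ∑ e : Eb, cayleyLength ((α (G.bulkEnd e false))⁻¹ * α (G.bulkEnd e true))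

/-- The number `m_n` of minimizers of the Hamiltonian. -/
noncomputable def OpenGraph.numMinimizers [Fintype Eb] [Fintype Ed] [DecidableEq Ed]
    (G : OpenGraph V Eb Ed) (A : Finset Ed) (n : ℕ) : ℕ :=
  Nat.card {α : V → Equiv.Perm (Fin n) // ∀ β, G.hamiltonian A n α ≤ G.hamiltonian A n β}

/-- `μ` is the measure `μ_{G_{A|B}}`: a probability measure, supported on a compact subset of
`[0, ∞)`, whose `n`-th moment is `m_n` for all `n ≥ 1`. -/
structure OpenGraph.IsNetworkMeasure [Fintype Eb] [Fintype Ed] [DecidableEq Ed]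
    (G : OpenGraph V Eb Ed) (A : Finset Ed) (μ : Measure ℝ) : Prop where
  isProbability : IsProbabilityMeasure μ
  compactSupport : ∃ R : ℝ, μ (Set.Icc 0 R)ᶜ = 0
  moments : ∀ n : ℕ, 1 ≤ n → ∫ t, t ^ n ∂μ = G.numMinimizers A n

/-! ### The empirical eigenvalue measure -/

section

variable [Fintype V] [Fintype Eb] [DecidableEq Eb] [Fintype Ed] [DecidableEq Ed]

/-- The rescaled approximately normalized reduced state `D^F · D^(-|E_∂|) ρ_A`. -/
noncomputable def OpenGraph.rescaledState (G : OpenGraph V Eb Ed) (A : Finset Ed) (D : ℕ)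
    (g : G.Tensors D) : Matrix ({e // e ∈ A} → Fin D) ({e // e ∈ A} → Fin D) ℂ :=
  ((D : ℝ) ^ G.maxflow A * ((D : ℝ) ^ Fintype.card Ed)⁻¹) • G.reducedState A D g

theorem OpenGraph.isHermitian_rescaledState (G : OpenGraph V Eb Ed) (A : Finset Ed) (D : ℕ)
    (g : G.Tensors D) : (G.rescaledState A D g).IsHermitian := by
  ext a a'
  simp [OpenGraph.rescaledState, OpenGraph.reducedState, Matrix.conjTranspose_apply, mul_comm]

/-- The empirical measure `μ_A^{(D)} = D^(-F) ∑ δ_λ`, where `λ` runs through the spectrum, with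
multiplicities, of `σ_A`, the restriction of the rescaled state to its support. As the rescaled
state is Hermitian, these are its nonzero eigenvalues. -/
noncomputable def OpenGraph.empiricalMeasure (G : OpenGraph V Eb Ed) (A : Finset Ed) (D : ℕ)
    (g : G.Tensors D) : Measure ℝ :=
  ((D : ℝ≥0∞) ^ G.maxflow A)⁻¹ •
    ∑ k with (G.isHermitian_rescaledState A D g).eigenvalues k ≠ 0,
      Measure.dirac ((G.isHermitian_rescaledState A D g).eigenvalues k)

end

end RTN

set_option linter.unusedSectionVars false

namespace RTN

/-! ### Cycle counts of permutations -/

/-! The proof is a moment method. By Wick's formula the expected product of traces of `ρ_A` along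
the cycles of a permutation is a sum over one permutation per vertex. The labellings compatible with
such a family have one free label per cycle and edge, so its weight is a power of `D` with exponent
minus the energy (`integral_prod_reducedState`). Edge-disjoint paths and the triangle inequality for
`len` bound the energy below by `F * len γ`, and a domain wall along a minimal cut attains this
value (`exists_minCut`, `exists_energy_eq`). After rescaling only the excess energy remains in the
exponent, so expected moments tend to the number of minimizers.

The second moment of a trace is a first moment over a doubled ground set with sink permutation `γ ⊕
γ`. Every minimizer preserves the cycles of the sink permutation, hence splits into two minimizers
for `γ` (`natCard_excess_sumCongr_le`). The limiting variance is therefore at most zero, and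
Chebyshev gives convergence of each moment in probability (`tendsto_powerSum`).

Unbounded test functions require a bound on the largest eigenvalue, obtained from a moment whose
order `d` grows like a small power of `D`. By `exists_skeleton` the excess controls the deviation of
every vertex permutation from a geodesic or from a neighbouring value, so the partition function is
at most a product of sums over a single symmetric group (`exists_partitionSum_le`). The essential
sum is the `d`-th moment of a `d × d` Gaussian Gram matrix, which a net argument bounds
exponentially in `d` (`sum_pow_cyc_add_cyc_le`). Markov's inequality then rules out large
eigenvalues with probability tending to one (`exists_tendsto_eigenvalue_gt`).

The total mass is controlled by the rank. The state matrix factors through the labellings of a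
minimal cut, which bounds the rank by `D ^ F`; tensors routing labels along disjoint paths show that
some minor of that size is not identically zero, hence is nonzero almost surely
(`ae_rank_reducedState`). So the empirical measures are, with high probability, probability measures
on a fixed interval with moments close to `m_n`. Weak compactness gives the limit measure
(`exists_measure_of_approx_moments`), while polynomial approximation gives uniqueness and
convergence for continuous functions (`exists_moments_close`). -/

/-- The number of cycles of a permutation, fixed points included. -/
noncomputable def cyc {J : Type*} (σ : Equiv.Perm J) : ℕ :=
  Nat.card (Quotient (Equiv.Perm.SameCycle.setoid σ))

/-- The distance of a permutation to the identity: the size of the ground set minus the number of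
cycles. -/
noncomputable def len {J : Type*} (σ : Equiv.Perm J) : ℕ := Nat.card J - cyc σ

section

variable {J : Type*}

theorem apply_eq_of_sameCycle {X : Type*} {σ : Equiv.Perm J} {f : J → X}
    (hf : ∀ j, f (σ j) = f j) {x y : J} (h : σ.SameCycle x y) : f x = f y := by
  obtain ⟨k, rfl⟩ := h
  have key : ∀ k : ℤ, ∀ x, f ((σ ^ k) x) = f x := by
    intro k
    induction k using Int.induction_on with
    | zero => simp
    | succ n ih => intro x; rw [zpow_add_one, Equiv.Perm.mul_apply, ih, hf]
    | pred n ih =>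
      intro x
      rw [zpow_sub_one, Equiv.Perm.mul_apply, ih]
      have := hf (σ⁻¹ x)
      simpa using this.symm
  exact (key k x).symm

/-- Functions invariant under a permutation are the functions on its set of cycles. -/
def invariantEquiv (X : Type*) (σ : Equiv.Perm J) :
    {f : J → X // ∀ j, f (σ j) = f j} ≃ (Quotient (Equiv.Perm.SameCycle.setoid σ) → X) where
  toFun f := Quotient.lift f.1 fun _ _ h => apply_eq_of_sameCycle f.2 h
  invFun h := ⟨fun j => h (Quotient.mk _ j), fun j => by
    refine congrArg h (Quotient.sound (s := Equiv.Perm.SameCycle.setoid σ) ?_)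
    exact (Equiv.Perm.sameCycle_apply_left.2 (Equiv.Perm.SameCycle.refl σ j))⟩
  left_inv f := by ext j; rfl
  right_inv h := by ext q; induction q using Quotient.inductionOn; rfl

/-- An invariant labelling is a free choice of one label per cycle. This is the source of all powers
of `D`; with two labels it also serves to compare cycle counts through bijections of invariant
labellings. -/
theorem natCard_invariant [Finite J] (D : ℕ) (σ : Equiv.Perm J) :
    Nat.card {f : J → Fin D // ∀ j, f (σ j) = f j} = D ^ cyc σ := by
  rw [Nat.card_congr (invariantEquiv (Fin D) σ), Nat.card_fun, Nat.card_fin, cyc]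

theorem cyc_le [Finite J] (σ : Equiv.Perm J) : cyc σ ≤ Nat.card J :=
  Nat.card_le_card_of_surjective _ Quotient.mk_surjective

theorem len_add_cyc [Finite J] (σ : Equiv.Perm J) : len σ + cyc σ = Nat.card J :=
  Nat.sub_add_cancel (cyc_le σ)

/-- The space of real functions invariant under a permutation. -/
def invariantSpace (σ : Equiv.Perm J) : Submodule ℝ (J → ℝ) where
  carrier := {f | ∀ j, f (σ j) = f j}
  add_mem' ha hb j := by simp [ha j, hb j]
  zero_mem' j := rfl
  smul_mem' c f hf j := by simp [hf j]

theorem mem_invariantSpace {σ : Equiv.Perm J} {f : J → ℝ} :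
    f ∈ invariantSpace σ ↔ ∀ j, f (σ j) = f j := Iff.rfl

/-- Makes `len` a codimension, so that the metric geometry of the symmetric group follows from the
dimension formula for subspaces. -/
theorem finrank_invariantSpace [Finite J] (σ : Equiv.Perm J) :
    Module.finrank ℝ (invariantSpace σ) = cyc σ := by
  classical
  have := Fintype.ofFinite J
  have := Fintype.ofFinite (Quotient (Equiv.Perm.SameCycle.setoid σ))
  let e : invariantSpace σ ≃ₗ[ℝ] (Quotient (Equiv.Perm.SameCycle.setoid σ) → ℝ) :=
    { toEquiv := invariantEquiv ℝ σ
      map_add' := fun f g => by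
        ext q; induction q using Quotient.inductionOn; rfl
      map_smul' := fun c g => by
        ext q; induction q using Quotient.inductionOn; rfl }
  rw [e.finrank_eq, Module.finrank_fintype_fun_eq_card, cyc, Nat.card_eq_fintype_card]

theorem invariantSpace_inf_le_mul (σ τ : Equiv.Perm J) :
    invariantSpace σ ⊓ invariantSpace τ ≤ invariantSpace (σ * τ) := by
  rintro f ⟨h1, h2⟩ j
  rw [Equiv.Perm.mul_apply, h1, h2]

theorem invariantSpace_inf_codim [Finite J] (σ τ : Equiv.Perm J) :
    cyc σ + cyc τ ≤ Nat.card J +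
      Module.finrank ℝ (invariantSpace σ ⊓ invariantSpace τ : Submodule ℝ (J → ℝ)) := by
  have := Fintype.ofFinite J
  rw [← finrank_invariantSpace σ, ← finrank_invariantSpace τ,
    ← Submodule.finrank_sup_add_finrank_inf_eq]
  gcongr
  exact (Submodule.finrank_le _).trans (by simp)

/-- Whatever `σ` and `τ` both fix is fixed by `σ * τ`, and the codimension of an intersection is at
most the sum of the codimensions. -/
theorem len_mul_le [Finite J] (σ τ : Equiv.Perm J) : len (σ * τ) ≤ len σ + len τ := by
  have := Fintype.ofFinite J
  have h1 := invariantSpace_inf_codim σ τ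
  have h2 := Submodule.finrank_mono (invariantSpace_inf_le_mul σ τ)
  rw [finrank_invariantSpace] at h2
  have := len_add_cyc σ
  have := len_add_cyc τ
  have := len_add_cyc (σ * τ)
  omega

/-- A permutation on a geodesic from the identity to `π` preserves the cycles of `π`. -/
theorem invariantSpace_le_of_geodesic [Finite J] {σ π : Equiv.Perm J}
    (h : len σ + len (σ⁻¹ * π) ≤ len π) : invariantSpace π ≤ invariantSpace σ := by
  have := Fintype.ofFinite J
  have h1 := invariantSpace_inf_codim σ (σ⁻¹ * π)
  have h2 := invariantSpace_inf_le_mul σ (σ⁻¹ * π)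
  rw [mul_inv_cancel_left] at h2
  have h3 := len_add_cyc σ
  have h4 := len_add_cyc (σ⁻¹ * π)
  have h5 := len_add_cyc π
  -- On a geodesic the dimension count is tight, so the common invariants of `σ` and `σ⁻¹ * π` are
  -- all the invariants of `π`.
  have h6 := Submodule.eq_of_le_of_finrank_le h2 (by rw [finrank_invariantSpace]; omega)
  rw [← h6]
  exact inf_le_left

@[simp] theorem cyc_one [Finite J] : cyc (1 : Equiv.Perm J) = Nat.card J := by
  have := Fintype.ofFinite J
  rw [← finrank_invariantSpace]
  have : invariantSpace (1 : Equiv.Perm J) = ⊤ := by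
    ext f; simp [mem_invariantSpace]
  rw [this]; simp

@[simp] theorem len_one [Finite J] : len (1 : Equiv.Perm J) = 0 := by simp [len]

theorem eq_one_of_len_eq_zero [Finite J] {σ : Equiv.Perm J} (h : len σ = 0) : σ = 1 := by
  classical
  have := Fintype.ofFinite J
  have h1 := len_add_cyc σ
  have h2 : invariantSpace σ = ⊤ := Submodule.eq_top_of_finrank_eq (by
    rw [finrank_invariantSpace]; simp; simpa [h] using h1)
  ext j
  have h3 : (Pi.single j 1 : J → ℝ) ∈ invariantSpace σ := by rw [h2]; trivial
  have h4 := h3 j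
  by_contra hne
  simp at hne
  rw [Pi.single_eq_same, Pi.single_eq_of_ne hne] at h4
  simp at h4

theorem cyc_inv (σ : Equiv.Perm J) : cyc σ⁻¹ = cyc σ := by
  have : Equiv.Perm.SameCycle.setoid σ⁻¹ = Equiv.Perm.SameCycle.setoid σ := by
    ext x y
    exact Equiv.Perm.sameCycle_inv
  rw [cyc, this, cyc]

theorem len_inv (σ : Equiv.Perm J) : len σ⁻¹ = len σ := by rw [len, len, cyc_inv]

theorem len_inv_mul_comm (σ τ : Equiv.Perm J) : len (σ⁻¹ * τ) = len (τ⁻¹ * σ) := by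
  rw [← len_inv (σ⁻¹ * τ), mul_inv_rev, inv_inv]

theorem len_triangle [Finite J] (σ τ υ : Equiv.Perm J) :
    len (σ⁻¹ * υ) ≤ len (σ⁻¹ * τ) + len (τ⁻¹ * υ) := by
  have := len_mul_le (σ⁻¹ * τ) (τ⁻¹ * υ)
  rwa [show σ⁻¹ * τ * (τ⁻¹ * υ) = σ⁻¹ * υ by group] at this

theorem len_sumCongr {K : Type*} [Finite J] [Finite K] (σ : Equiv.Perm J) (τ : Equiv.Perm K) :
    len (Equiv.sumCongr σ τ : Equiv.Perm (J ⊕ K)) = len σ + len τ := by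
  have h : cyc (Equiv.sumCongr σ τ : Equiv.Perm (J ⊕ K)) = cyc σ + cyc τ := by
    have h2 := natCard_invariant 2 (Equiv.sumCongr σ τ : Equiv.Perm (J ⊕ K))
    let e : {f : J ⊕ K → Fin 2 // ∀ j, f (Equiv.sumCongr σ τ j) = f j} ≃
        {f : J → Fin 2 // ∀ j, f (σ j) = f j} × {f : K → Fin 2 // ∀ j, f (τ j) = f j} :=
      { toFun := fun f => (⟨fun j => f.1 (Sum.inl j), fun j => f.2 (Sum.inl j)⟩,
          ⟨fun j => f.1 (Sum.inr j), fun j => f.2 (Sum.inr j)⟩)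
        invFun := fun p => ⟨Sum.elim p.1.1 p.2.1, by
          rintro (j | j)
          · exact p.1.2 j
          · exact p.2.2 j⟩
        left_inv := fun f => by ext (j | j) <;> rfl
        right_inv := fun p => rfl }
    rw [Nat.card_congr e, Nat.card_prod, natCard_invariant, natCard_invariant, ← pow_add] at h2
    exact (Nat.pow_right_injective le_rfl h2).symm
  have h1 := len_add_cyc σ
  have h2 := len_add_cyc τ
  have h3 := len_add_cyc (Equiv.sumCongr σ τ : Equiv.Perm (J ⊕ K))
  rw [Nat.card_sum] at h3
  omega

theorem card_partition_parts [Fintype J] [DecidableEq J] (σ : Equiv.Perm J) :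
    Multiset.card σ.partition.parts = cyc σ := by
  classical
  rw [Equiv.Perm.parts_partition, Multiset.card_add, Multiset.card_replicate,
    Equiv.Perm.cycleType_def, Multiset.card_map, cyc]
  -- The fibres of `f` are the orbits, and its range is the nontrivial cycles together with the
  -- fixed points, which is how the partition is assembled.
  let f : J → Equiv.Perm J ⊕ J := fun x =>
    if σ x = x then Sum.inr x else Sum.inl (σ.cycleOf x)
  have hf : ∀ x y, f x = f y ↔ σ.SameCycle x y := by
    intro x y
    constructor
    · intro h
      by_cases hx : σ x = x <;> by_cases hy : σ y = y <;> simp [f, hx, hy] at h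
      · rw [h]
      · have h1 : y ∈ (σ.cycleOf x).support := by
          rw [h, Equiv.Perm.mem_support, Equiv.Perm.cycleOf_apply_self]; exact hy
        exact (Equiv.Perm.mem_support_cycleOf_iff.1 h1).1
    · intro h
      by_cases hx : σ x = x
      · have : x = y := h.eq_of_left hx
        rw [this]
      · have hy : σ y ≠ y := fun hy => hx (by
          have := h.symm.eq_of_left hy
          rwa [this] at hy)
        simp [f, hx, hy, h.cycleOf_eq]
  have e : Quotient (Equiv.Perm.SameCycle.setoid σ) ≃ Set.range f := by
    have : Equiv.Perm.SameCycle.setoid σ = Setoid.ker f := by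
      ext x y
      rw [Setoid.ker_def]
      exact (hf x y).symm
    rw [this]
    exact Setoid.quotientKerEquivRange f
  have hr : Set.range f = ((σ.cycleFactorsFinset.disjSum σ.supportᶜ : Finset _) : Set _) := by
    ext (c | x)
    · simp only [Set.mem_range, Finset.mem_coe, Finset.inl_mem_disjSum]
      constructor
      · rintro ⟨y, hy⟩
        by_cases h : σ y = y
        · simp [f, h] at hy
        · simp [f, h] at hy
          rw [← hy, Equiv.Perm.cycleOf_mem_cycleFactorsFinset_iff]
          exact Equiv.Perm.mem_support.2 h
      · intro hc
        have hcc := hc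
        rw [Equiv.Perm.mem_cycleFactorsFinset_iff] at hc
        obtain ⟨y, hy⟩ := hc.1.nonempty_support
        have := hc.2 y hy
        refine ⟨y, ?_⟩
        have h : σ y ≠ y := by rw [← this]; exact Equiv.Perm.mem_support.1 hy
        simp only [f, h, if_false]
        rw [← Equiv.Perm.cycle_is_cycleOf hy hcc]
    · simp only [Set.mem_range, Finset.mem_coe, Finset.inr_mem_disjSum]
      constructor
      · rintro ⟨y, hy⟩
        by_cases h : σ y = y
        · simp [f, h] at hy
          simpa [← hy] using h
        · simp [f, h] at hy
      · intro h
        refine ⟨x, ?_⟩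
        simp at h
        simp [f, h]
  rw [Nat.card_congr e, hr, Nat.card_coe_set_eq, Set.ncard_coe_finset, Finset.card_disjSum,
    Finset.card_compl]
  rfl

theorem cayleyLength_eq_len {n : ℕ} (σ : Equiv.Perm (Fin n)) : cayleyLength σ = len σ := by
  rw [cayleyLength, card_partition_parts, len, Nat.card_fin]

theorem len_fullCycle (n : ℕ) : len (fullCycle n) = n - 1 := by
  rw [fullCycle, len_inv]
  rcases n with _ | _ | n
  · rw [len]; simp
  · rw [show finRotate (0 + 1) = 1 by decide]; simp
  · rw [← cayleyLength_eq_len, cayleyLength, Equiv.Perm.parts_partition, cycleType_finRotate,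
      support_finRotate]
    simp

end

/-! ### Maximum flow and minimum cut -/

section

variable {V Eb Ed : Type*} [DecidableEq Ed]

/-- The two ends of an edge of the network. -/
def OpenGraph.ends (G : OpenGraph V Eb Ed) (A : Finset Ed) : Eb ⊕ Ed → Bool → NetVertex V
  | Sum.inl e, b => .bulk (G.bulkEnd e b)
  | Sum.inr e, b =>
    if e ∈ A then (if b then .sink else .bulk (G.bdryEnd e))
    else (if b then .bulk (G.bdryEnd e) else .source)

theorem OpenGraph.netEnds_eq (G : OpenGraph V Eb Ed) (A : Finset Ed) (e : Eb ⊕ Ed) :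
    G.netEnds A e = s(G.ends A e false, G.ends A e true) := by
  rcases e with e | e
  · rfl
  · by_cases h : e ∈ A <;> simp [OpenGraph.netEnds, OpenGraph.ends, h]

theorem OpenGraph.netEnds_arc (G : OpenGraph V Eb Ed) (A : Finset Ed) (e : Eb ⊕ Ed) (b : Bool) :
    G.netEnds A e = s(G.ends A e (!b), G.ends A e b) := by
  rw [G.netEnds_eq]
  cases b
  · exact Sym2.eq_swap
  · rfl

/-- The vertices of the network are those of the graph and two more. -/
def netVertexEquiv (V : Type*) : NetVertex V ≃ Option (Option V) where
  toFun
    | .source => none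
    | .sink => some none
    | .bulk v => some (some v)
  invFun
    | none => .source
    | some none => .sink
    | some (some v) => .bulk v
  left_inv x := by cases x <;> rfl
  right_inv x := by rcases x with _ | _ | _ <;> rfl

instance [Finite V] : Finite (NetVertex V) := Finite.of_equiv _ (netVertexEquiv V).symm

variable {G : OpenGraph V Eb Ed} {A : Finset Ed}

theorem OpenGraph.NetWalk.start_mem_support {u v : NetVertex V} (p : G.NetWalk A u v) :
    u ∈ p.support := by
  cases p <;> simp [OpenGraph.NetWalk.support]

theorem OpenGraph.NetWalk.end_mem_support {u v : NetVertex V} (p : G.NetWalk A u v) :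
    v ∈ p.support := by
  induction p with
  | nil => simp [OpenGraph.NetWalk.support]
  | cons e h p ih => simp [OpenGraph.NetWalk.support, ih]

theorem OpenGraph.NetWalk.mem_support_of_mem_edges {u v : NetVertex V} (p : G.NetWalk A u v)
    {e : Eb ⊕ Ed} (he : e ∈ p.edges) {w : NetVertex V} (hw : w ∈ G.netEnds A e) :
    w ∈ p.support := by
  induction p with
  | nil => simp [OpenGraph.NetWalk.edges] at he
  | cons e' h p ih =>
    simp only [OpenGraph.NetWalk.edges, List.mem_cons] at he
    simp only [OpenGraph.NetWalk.support, List.mem_cons]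
    rcases he with rfl | he
    · rw [h, Sym2.mem_iff] at hw
      rcases hw with rfl | rfl
      · exact Or.inl rfl
      · exact Or.inr p.start_mem_support
    · exact Or.inr (ih he)

theorem OpenGraph.NetWalk.edges_nodup {u v : NetVertex V} (p : G.NetWalk A u v)
    (hp : p.support.Nodup) : p.edges.Nodup := by
  induction p with
  | nil => simp [OpenGraph.NetWalk.edges]
  | cons e h p ih =>
    simp only [OpenGraph.NetWalk.support, List.nodup_cons] at hp
    simp only [OpenGraph.NetWalk.edges, List.nodup_cons]
    exact ⟨fun he => hp.1 (p.mem_support_of_mem_edges he (by rw [h]; exact Sym2.mem_mk_left _ _)),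
      ih hp.2⟩

/-- A walk that leaves a set of vertices has an edge that leaves it. -/
theorem OpenGraph.NetWalk.exists_crossing {u v : NetVertex V} (p : G.NetWalk A u v)
    (S : NetVertex V → Bool) (hu : S u = true) (hv : S v = false) :
    ∃ e ∈ p.edges, S (G.ends A e false) ≠ S (G.ends A e true) := by
  induction p with
  | nil => simp [hu] at hv
  | @cons u w v e h p ih =>
    simp only [OpenGraph.NetWalk.edges, List.mem_cons]
    by_cases hw : S w = true
    · obtain ⟨e', he', h'⟩ := ih hw hv
      exact ⟨e', Or.inr he', h'⟩
    · refine ⟨e, Or.inl rfl, ?_⟩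
      rw [G.netEnds_eq, Sym2.eq_iff] at h
      rcases h with ⟨h1, h2⟩ | ⟨h1, h2⟩ <;> simp_all

/-- The sign of an orientation. -/
def arcSign (b : Bool) : ℤ := if b then 1 else -1

variable [DecidableEq Eb]

/-- The walk `p` runs along allowed oriented edges, and `χ` is its signed edge count. -/
inductive IsDirected (allow : Eb ⊕ Ed → Bool → Prop) :
    {u v : NetVertex V} → G.NetWalk A u v → (Eb ⊕ Ed → ℤ) → Prop
  | nil (u : NetVertex V) : IsDirected allow (.nil u) 0
  | cons {u v w : NetVertex V} {e : Eb ⊕ Ed} {b : Bool} {h : G.netEnds A e = s(u, v)}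
      {p : G.NetWalk A v w} {χ : Eb ⊕ Ed → ℤ} (hp : IsDirected allow p χ) (ha : allow e b)
      (hu : G.ends A e (!b) = u) (hv : G.ends A e b = v) :
      IsDirected allow (.cons e h p) (Pi.single e (arcSign b) + χ)

variable {allow : Eb ⊕ Ed → Bool → Prop}

theorem IsDirected.exists_suffix {u v : NetVertex V} {p : G.NetWalk A u v} {χ : Eb ⊕ Ed → ℤ}
    (hp : IsDirected allow p χ) {w : NetVertex V} (hw : w ∈ p.support) :
    ∃ (q : G.NetWalk A w v) (χ' : Eb ⊕ Ed → ℤ), IsDirected allow q χ' ∧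
      q.support <:+ p.support := by
  induction hp with
  | nil u =>
    simp only [OpenGraph.NetWalk.support, List.mem_singleton] at hw
    subst hw
    exact ⟨.nil w, 0, .nil w, List.suffix_rfl⟩
  | @cons u v' v e b h p χ hp ha hu hv ih =>
    simp only [OpenGraph.NetWalk.support, List.mem_cons] at hw
    rcases hw with rfl | hw
    · exact ⟨_, _, .cons (h := h) hp ha hu hv, List.suffix_rfl⟩
    · obtain ⟨q, χ', hq, hs⟩ := ih hw
      exact ⟨q, χ', hq, hs.trans (List.suffix_cons _ _)⟩

/-- Loop erasure: an arc is prepended to a path, and if its starting vertex is already visited, the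
suffix from that vertex is kept instead. -/
theorem exists_directed {u t : NetVertex V}
    (h : Relation.ReflTransGen
      (fun x y => ∃ e b, allow e b ∧ G.ends A e (!b) = x ∧ G.ends A e b = y) u t) :
    ∃ (p : G.NetWalk A u t) (χ : Eb ⊕ Ed → ℤ), IsDirected allow p χ ∧ p.support.Nodup := by
  induction h using Relation.ReflTransGen.head_induction_on with
  | refl => exact ⟨.nil t, 0, .nil t, by simp [OpenGraph.NetWalk.support]⟩
  | @head x y hxy _ ih =>
    obtain ⟨e, b, ha, hx, hy⟩ := hxy
    obtain ⟨p, χ, hp, hn⟩ := ih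
    by_cases hm : x ∈ p.support
    · obtain ⟨q, χ', hq, hs⟩ := hp.exists_suffix hm
      exact ⟨q, χ', hq, hn.sublist hs.sublist⟩
    · refine ⟨.cons e (by rw [G.netEnds_arc A e b, hx, hy]) p, _, .cons hp ha hx hy, ?_⟩
      simp [OpenGraph.NetWalk.support, hm, hn]

/-- With distinct vertices no edge is traversed twice, so the signed count is the sign of a single
allowed traversal and nothing cancels. -/
theorem IsDirected.spec {u v : NetVertex V} {p : G.NetWalk A u v} {χ : Eb ⊕ Ed → ℤ}
    (hp : IsDirected allow p χ) (hn : p.support.Nodup) (e : Eb ⊕ Ed) :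
    (e ∉ p.edges ∧ χ e = 0) ∨ (e ∈ p.edges ∧ ∃ b, χ e = arcSign b ∧ allow e b) := by
  induction hp with
  | nil u => exact Or.inl ⟨by simp [OpenGraph.NetWalk.edges], rfl⟩
  | @cons u v' v e' b h p χ hp ha hu hv ih =>
    simp only [OpenGraph.NetWalk.support, List.nodup_cons] at hn
    simp only [OpenGraph.NetWalk.edges, List.mem_cons, Pi.add_apply]
    by_cases he : e = e'
    · subst he
      have h1 : e ∉ p.edges := fun hm => hn.1
        (p.mem_support_of_mem_edges hm (by rw [h]; exact Sym2.mem_mk_left _ _))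
      rcases ih hn.2 with ⟨_, h0⟩ | ⟨h2, _⟩
      · exact Or.inr ⟨Or.inl rfl, b, by simp [h0], ha⟩
      · exact absurd h2 h1
    · simpa [he, Pi.single_apply] using ih hn.2

variable [Fintype Eb] [Fintype Ed]

open Classical in
/-- The net inflow into a set of vertices. -/
noncomputable def OpenGraph.inflow (G : OpenGraph V Eb Ed) (A : Finset Ed) (φ : Eb ⊕ Ed → ℤ)
    (S : Set (NetVertex V)) : ℤ :=
  ∑ e, φ e * ((if G.ends A e true ∈ S then 1 else 0) - (if G.ends A e false ∈ S then 1 else 0))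

theorem inflow_add (φ χ : Eb ⊕ Ed → ℤ) (S : Set (NetVertex V)) :
    G.inflow A (φ + χ) S = G.inflow A φ S + G.inflow A χ S := by
  simp [OpenGraph.inflow, add_mul, Finset.sum_add_distrib]

theorem inflow_sub (φ χ : Eb ⊕ Ed → ℤ) (S : Set (NetVertex V)) :
    G.inflow A (φ - χ) S = G.inflow A φ S - G.inflow A χ S := by
  simp [OpenGraph.inflow, sub_mul, Finset.sum_sub_distrib]

open Classical in
theorem IsDirected.inflow {u v : NetVertex V} {p : G.NetWalk A u v} {χ : Eb ⊕ Ed → ℤ}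
    (hp : IsDirected allow p χ) (S : Set (NetVertex V)) :
    G.inflow A χ S = (if v ∈ S then 1 else 0) - (if u ∈ S then 1 else 0) := by
  induction hp with
  | nil u => simp [OpenGraph.inflow]
  | @cons u v' v e b h p χ hp ha hu hv ih =>
    rw [inflow_add, ih]
    have : G.inflow A (Pi.single e (arcSign b)) S =
        (if v' ∈ S then 1 else 0) - (if u ∈ S then 1 else 0) := by
      rw [OpenGraph.inflow, Finset.sum_eq_single e]
      · subst hu hv
        cases b <;> simp [arcSign]
      · intro e' _ he'
        simp [he']
      · simp
    rw [this]; ring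

/-- Flows with values in `{-1, 0, 1}` that are conserved at the vertices of the graph. -/
structure OpenGraph.IsFlow (G : OpenGraph V Eb Ed) (A : Finset Ed) (φ : Eb ⊕ Ed → ℤ) (k : ℕ) :
    Prop where
  le_one : ∀ e, φ e ≤ 1
  neg_one_le : ∀ e, -1 ≤ φ e
  conserved : ∀ v, G.inflow A φ {.bulk v} = 0
  value : G.inflow A φ {.source} = -k

-- Inflow is additive over the vertices of `S`, and conservation leaves only the contribution of the
-- source.
open Classical in
theorem OpenGraph.IsFlow.inflow_set [Finite V] {φ : Eb ⊕ Ed → ℤ} {k : ℕ} (hφ : G.IsFlow A φ k)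
    (S : Set (NetVertex V)) (h1 : .source ∈ S) (h2 : .sink ∉ S) : G.inflow A φ S = -k := by
  have := Fintype.ofFinite (NetVertex V)
  have key : G.inflow A φ S = ∑ n ∈ S.toFinset, G.inflow A φ {n} := by
    simp only [OpenGraph.inflow]
    rw [Finset.sum_comm]
    refine Finset.sum_congr rfl fun e _ => ?_
    rw [← Finset.mul_sum, Finset.sum_sub_distrib]
    simp
  rw [key, Finset.sum_eq_single NetVertex.source]
  · exact hφ.value
  · rintro (_ | _ | v) hb hne
    · exact absurd rfl hne
    · exact absurd (by simpa using hb) h2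
    · exact hφ.conserved v
  · intro h; exact absurd (by simpa using h1) h

/-- A flow that cannot be augmented yields a cut. -/
theorem OpenGraph.exists_flow_cut [Finite V] (G : OpenGraph V Eb Ed) (A : Finset Ed) :
    ∃ (φ : Eb ⊕ Ed → ℤ) (k : ℕ) (S : NetVertex V → Bool), G.IsFlow A φ k ∧
      S .source = true ∧ S .sink = false ∧
      (Finset.univ.filter fun e => S (G.ends A e false) ≠ S (G.ends A e true)).card = k := by
  classical
  have hb : ∀ φ k, G.IsFlow A φ k → k ≤ Fintype.card (Eb ⊕ Ed) := by
    intro φ k h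
    have h1 := h.value
    have h2 : -(Fintype.card (Eb ⊕ Ed) : ℤ) ≤ G.inflow A φ {.source} := by
      rw [OpenGraph.inflow]
      have : ∑ e : Eb ⊕ Ed, (-1 : ℤ) = -(Fintype.card (Eb ⊕ Ed) : ℤ) := by simp
      rw [← this]
      refine Finset.sum_le_sum fun e _ => ?_
      have := h.le_one e
      have := h.neg_one_le e
      split_ifs <;> simp <;> omega
    omega
  have hne : ({k | ∃ φ, G.IsFlow A φ k} : Set ℕ).Nonempty :=
    ⟨0, 0, by simp, by simp, by simp [OpenGraph.inflow], by simp [OpenGraph.inflow]⟩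
  have hbd : BddAbove {k | ∃ φ, G.IsFlow A φ k} := ⟨_, fun k ⟨φ, h⟩ => hb φ k h⟩
  obtain ⟨φ, hφ⟩ := Nat.sSup_mem hne hbd
  set k := sSup {k | ∃ φ, G.IsFlow A φ k} with hk
  -- Arcs of the residual network: one more unit along them respects the capacity. A residual path
  -- to the sink would augment the maximal flow, so the set reachable from the source is a cut.
  let allow : Eb ⊕ Ed → Bool → Prop := fun e b => φ e + arcSign b ≤ 1 ∧ -1 ≤ φ e + arcSign b
  let R : NetVertex V → NetVertex V → Prop :=
    fun x y => ∃ e b, allow e b ∧ G.ends A e (!b) = x ∧ G.ends A e b = y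
  let S : Set (NetVertex V) := {n | Relation.ReflTransGen R .source n}
  have hsink : NetVertex.sink ∉ S := by
    intro hs
    obtain ⟨p, χ, hp, hn⟩ := exists_directed hs
    have hspec := hp.spec hn
    have hflow : G.IsFlow A (φ + χ) (k + 1) := by
      refine ⟨fun e => ?_, fun e => ?_, fun v => ?_, ?_⟩
      · rcases hspec e with ⟨_, h0⟩ | ⟨_, b, h1, h2⟩
        · simpa [h0] using hφ.le_one e
        · simpa [h1] using h2.1
      · rcases hspec e with ⟨_, h0⟩ | ⟨_, b, h1, h2⟩
        · simpa [h0] using hφ.neg_one_le e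
        · simpa [h1] using h2.2
      · rw [inflow_add, hφ.conserved, hp.inflow]; simp
      · rw [inflow_add, hφ.value, hp.inflow]; simp; ring
    have := le_csSup hbd (show k + 1 ∈ {k | ∃ φ, G.IsFlow A φ k} from ⟨_, hflow⟩)
    omega
  have hsrc : NetVertex.source ∈ S := Relation.ReflTransGen.refl
  have hclosed : ∀ e b, allow e b → G.ends A e (!b) ∈ S → G.ends A e b ∈ S :=
    fun e b ha hs => Relation.ReflTransGen.tail hs ⟨e, b, ha, rfl, rfl⟩
  refine ⟨φ, k, fun n => decide (n ∈ S), hφ, by simpa using hsrc, by simpa using hsink, ?_⟩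
  have h1 := hφ.inflow_set S hsrc hsink
  rw [OpenGraph.inflow] at h1
  -- An edge leaving `S` has no residual capacity outward, so it carries a full unit out of `S`; all
  -- other edges contribute nothing.
  have h2 : ∀ e, φ e * ((if G.ends A e true ∈ S then 1 else 0) -
      (if G.ends A e false ∈ S then 1 else 0)) =
      -(if decide (G.ends A e false ∈ S) ≠ decide (G.ends A e true ∈ S) then 1 else 0) := by
    intro e
    have ht := hclosed e true
    have hf := hclosed e false
    have := hφ.le_one e
    have := hφ.neg_one_le e
    simp only [allow, arcSign, Bool.not_true, Bool.not_false] at ht hf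
    by_cases a1 : G.ends A e true ∈ S <;> by_cases a2 : G.ends A e false ∈ S <;>
      simp [a1, a2] at ht hf ⊢ <;> omega
  rw [Finset.sum_congr rfl fun e _ => h2 e, Finset.sum_neg_distrib, neg_inj,
    Finset.sum_boole] at h1
  exact_mod_cast h1

/-- An integral flow decomposes into edge-disjoint paths. -/
theorem OpenGraph.IsFlow.exists_paths [Finite V] (k : ℕ) : ∀ {φ : Eb ⊕ Ed → ℤ},
    G.IsFlow A φ k → ∃ p : Fin k → G.NetWalk A .source .sink, (∀ i, (p i).support.Nodup) ∧
      (∀ i, ∀ e ∈ (p i).edges, φ e ≠ 0) ∧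
      Pairwise fun i j => (p i).edges.Disjoint (p j).edges := by
  classical
  induction k with
  | zero => exact fun _ => ⟨fun i => i.elim0, fun i => i.elim0, fun i => i.elim0, fun i => i.elim0⟩
  | succ k ih =>
    intro φ hφ
    let allow : Eb ⊕ Ed → Bool → Prop := fun e b => φ e = arcSign b
    let R : NetVertex V → NetVertex V → Prop :=
      fun x y => ∃ e b, allow e b ∧ G.ends A e (!b) = x ∧ G.ends A e b = y
    let S : Set (NetVertex V) := {n | Relation.ReflTransGen R .source n}
    have hsrc : NetVertex.source ∈ S := Relation.ReflTransGen.refl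
    have hclosed : ∀ e b, allow e b → G.ends A e (!b) ∈ S → G.ends A e b ∈ S :=
      fun e b ha hs => Relation.ReflTransGen.tail hs ⟨e, b, ha, rfl, rfl⟩
    -- Otherwise no flow would leave the reachable set `S`, although its inflow is `-(k + 1)`.
    have hsink : NetVertex.sink ∈ S := by
      by_contra hsink
      have h1 := hφ.inflow_set S hsrc hsink
      have h2 : 0 ≤ G.inflow A φ S := by
        refine Finset.sum_nonneg fun e _ => ?_
        have ht := hclosed e true
        have hf := hclosed e false
        have := hφ.le_one e
        have := hφ.neg_one_le e
        simp only [allow, arcSign, Bool.not_true, Bool.not_false] at ht hf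
        by_cases a1 : G.ends A e true ∈ S <;> by_cases a2 : G.ends A e false ∈ S <;>
          simp [a1, a2] at ht hf ⊢ <;> omega
      push_cast at h1
      omega
    obtain ⟨q, χ, hq, hn⟩ := exists_directed hsink
    have hspec := hq.spec hn
    have hflow : G.IsFlow A (φ - χ) k := by
      refine ⟨fun e => ?_, fun e => ?_, fun v => ?_, ?_⟩
      · rcases hspec e with ⟨_, h0⟩ | ⟨_, b, h1, h2⟩
        · simpa [h0] using hφ.le_one e
        · simp [h1, show φ e = arcSign b from h2]
      · rcases hspec e with ⟨_, h0⟩ | ⟨_, b, h1, h2⟩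
        · simpa [h0] using hφ.neg_one_le e
        · simp [h1, show φ e = arcSign b from h2]
      · rw [inflow_sub, hφ.conserved, hq.inflow]; simp
      · rw [inflow_sub, hφ.value, hq.inflow]; simp
    obtain ⟨p, hp1, hp2, hp3⟩ := ih hflow
    have hdisj : ∀ i, ∀ e ∈ (p i).edges, e ∉ q.edges ∧ φ e ≠ 0 := by
      intro i e he
      have := hp2 i e he
      rcases hspec e with ⟨h1, h0⟩ | ⟨_, b, h1, h2⟩
      · exact ⟨h1, by simpa [h0] using this⟩
      · exact absurd (by simp [h1, show φ e = arcSign b from h2]) this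
    refine ⟨Fin.cons q p, fun i => ?_, fun i => ?_, fun i j => ?_⟩
    · refine Fin.cases ?_ (fun i => ?_) i
      · exact hn
      · exact hp1 i
    · refine Fin.cases ?_ (fun i => ?_) i
      · intro e he
        rcases hspec e with ⟨h1, h0⟩ | ⟨_, b, h1, h2⟩
        · exact absurd he h1
        · rw [show φ e = arcSign b from h2]
          cases b <;> simp [arcSign]
      · exact fun e he => (hdisj i e he).2
    · refine Fin.cases ?_ (fun i => ?_) i <;> refine Fin.cases ?_ (fun j => ?_) j
      · exact fun h => absurd rfl h
      · exact fun _ e h1 h2 => (hdisj j e h2).1 h1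
      · exact fun _ e h1 h2 => (hdisj i e h1).1 h2
      · exact fun h => hp3 (fun hh => h (congrArg Fin.succ hh))

/-- **Max-flow min-cut**: a cut with as many edges as there are edge-disjoint paths. -/
theorem OpenGraph.exists_minCut [Finite V] (G : OpenGraph V Eb Ed) (A : Finset Ed) :
    ∃ S : NetVertex V → Bool, S .source = true ∧ S .sink = false ∧
      (Finset.univ.filter fun e => S (G.ends A e false) ≠ S (G.ends A e true)).card =
        G.maxflow A := by
  obtain ⟨φ, k, S, hφ, h1, h2, h3⟩ := G.exists_flow_cut A
  refine ⟨S, h1, h2, le_antisymm ?_ ?_⟩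
  · obtain ⟨p, hp1, _, hp2⟩ := hφ.exists_paths
    rw [h3]
    exact (G.isGreatest_maxflow A).2 ⟨p, hp1, hp2⟩
  · obtain ⟨p, -, hp⟩ := (G.isGreatest_maxflow A).1
    choose f hf hc using fun i => (p i).exists_crossing S h1 h2
    have hinj : Function.Injective f := by
      intro i j hij
      by_contra hne
      exact hp hne (hf i) (hij ▸ hf j)
    have := Finset.card_le_card_of_injOn (s := Finset.univ) f
      (t := Finset.univ.filter fun e => S (G.ends A e false) ≠ S (G.ends A e true))
      (fun i _ => by simpa using hc i) hinj.injOn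
    simpa using this

end

/-! ### The Hamiltonian -/

section

variable {V Eb Ed : Type*} [DecidableEq Ed] {J : Type*}

/-- The permutations on the vertices of the network: `1` at the source, `γ` at the sink. -/
def extPerm (γ : Equiv.Perm J) (α : V → Equiv.Perm J) : NetVertex V → Equiv.Perm J
  | .source => 1
  | .sink => γ
  | .bulk x => α x

/-- The energy of an edge of the network. -/
noncomputable def OpenGraph.edgeLen (G : OpenGraph V Eb Ed) (A : Finset Ed) (γ : Equiv.Perm J)
    (α : V → Equiv.Perm J) (e : Eb ⊕ Ed) : ℕ :=
  len ((extPerm γ α (G.ends A e false))⁻¹ * extPerm γ α (G.ends A e true))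

/-- The Hamiltonian for permutations of any ground set, with any permutation at the sink. -/
noncomputable def OpenGraph.energy [Fintype Eb] [Fintype Ed] (G : OpenGraph V Eb Ed)
    (A : Finset Ed) (γ : Equiv.Perm J) (α : V → Equiv.Perm J) : ℕ :=
  ∑ e, G.edgeLen A γ α e

variable {G : OpenGraph V Eb Ed} {A : Finset Ed}

theorem edgeLen_inr_mem (γ : Equiv.Perm J) (α : V → Equiv.Perm J) {e : Ed} (he : e ∈ A) :
    G.edgeLen A γ α (Sum.inr e) = len (γ⁻¹ * α (G.bdryEnd e)) := by
  simp [OpenGraph.edgeLen, OpenGraph.ends, he, extPerm, len_inv_mul_comm γ]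

theorem edgeLen_inr_notMem (γ : Equiv.Perm J) (α : V → Equiv.Perm J) {e : Ed} (he : e ∉ A) :
    G.edgeLen A γ α (Sum.inr e) = len (α (G.bdryEnd e)) := by
  simp [OpenGraph.edgeLen, OpenGraph.ends, he, extPerm]

theorem energy_eq_hamiltonian [Fintype Eb] [Fintype Ed] {n : ℕ} (α : V → Equiv.Perm (Fin n)) :
    G.energy A (fullCycle n) α = G.hamiltonian A n α := by
  rw [OpenGraph.energy, OpenGraph.hamiltonian, Fintype.sum_sum_type, add_comm,
    ← Finset.sum_add_sum_compl A]
  simp only [cayleyLength_eq_len]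
  congr 1
  congr 1
  · exact Finset.sum_congr rfl fun e he => edgeLen_inr_mem _ _ he
  · exact Finset.sum_congr rfl fun e he => edgeLen_inr_notMem _ _ (Finset.mem_compl.1 he)

theorem len_ends_le [Finite J] (γ : Equiv.Perm J) (α : V → Equiv.Perm J) {e : Eb ⊕ Ed}
    {u v : NetVertex V} (h : G.netEnds A e = s(u, v)) :
    len ((extPerm γ α u)⁻¹ * extPerm γ α v) = G.edgeLen A γ α e := by
  rw [G.netEnds_eq, Sym2.eq_iff] at h
  rcases h with ⟨h1, h2⟩ | ⟨h1, h2⟩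
  · rw [OpenGraph.edgeLen, h1, h2]
  · rw [OpenGraph.edgeLen, h1, h2, len_inv_mul_comm]

theorem OpenGraph.NetWalk.len_le [Finite J] (γ : Equiv.Perm J) (α : V → Equiv.Perm J)
    {u v : NetVertex V} (p : G.NetWalk A u v) :
    len ((extPerm γ α u)⁻¹ * extPerm γ α v) ≤ (p.edges.map (G.edgeLen A γ α)).sum := by
  induction p with
  | nil => simp
  | @cons u w v e h p ih =>
    simp only [OpenGraph.NetWalk.edges, List.map_cons, List.sum_cons, ← len_ends_le γ α h]
    exact (len_triangle _ (extPerm γ α w) _).trans (by gcongr)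

/-- Energy on a path pays for a detour through any vertex it visits. Applied from source to sink,
this places the permutation at that vertex near a geodesic from `1` to `γ`. -/
theorem OpenGraph.NetWalk.len_add_len_le [Finite J] (γ : Equiv.Perm J) (α : V → Equiv.Perm J)
    {u v : NetVertex V} (p : G.NetWalk A u v) {x : NetVertex V} (hx : x ∈ p.support) :
    len ((extPerm γ α u)⁻¹ * extPerm γ α x) + len ((extPerm γ α x)⁻¹ * extPerm γ α v) ≤
      (p.edges.map (G.edgeLen A γ α)).sum := by
  induction p with
  | nil u =>
    simp only [OpenGraph.NetWalk.support, List.mem_singleton] at hx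
    simp [hx]
  | @cons u w v e h p ih =>
    simp only [OpenGraph.NetWalk.support, List.mem_cons] at hx
    rcases hx with rfl | hx
    · have := (OpenGraph.NetWalk.cons e h p).len_le γ α
      simpa using this
    · simp only [OpenGraph.NetWalk.edges, List.map_cons, List.sum_cons, ← len_ends_le γ α h]
      have h1 := ih hx
      have h2 := len_triangle (extPerm γ α u) (extPerm γ α w) (extPerm γ α x)
      omega

variable [DecidableEq Eb] [Fintype Eb] [Fintype Ed]

/-- The minimal energy is attained by a domain wall along a minimal cut. -/
theorem OpenGraph.exists_energy_eq [Finite V] [Finite J] (G : OpenGraph V Eb Ed) (A : Finset Ed)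
    (γ : Equiv.Perm J) : ∃ α, G.energy A γ α = G.maxflow A * len γ := by
  obtain ⟨S, h1, h2, h3⟩ := G.exists_minCut A
  -- The domain wall: `1` on the source side of a minimal cut and `γ` on the sink side, so only cut
  -- edges cost energy.
  refine ⟨fun x => if S (.bulk x) then 1 else γ, ?_⟩
  have hext : ∀ u, extPerm γ (fun x => if S (.bulk x) then 1 else γ) u = if S u then 1 else γ := by
    rintro (_ | _ | x)
    · simp [extPerm, h1]
    · simp [extPerm, h2]
    · rfl
  rw [← h3, Finset.card_filter, Finset.sum_mul, OpenGraph.energy]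
  refine Finset.sum_congr rfl fun e _ => ?_
  rw [OpenGraph.edgeLen, hext, hext]
  cases S (G.ends A e false) <;> cases S (G.ends A e true) <;> simp [len_inv]

/-- How the excess energy controls the permutation at every vertex: vertices in `P` lie on
edge-disjoint paths from the source to the sink, and every other vertex `x` is tied to `r x`. -/
theorem OpenGraph.exists_skeleton [Nonempty Ed] [Fintype V] (G : OpenGraph V Eb Ed)
    (hG : G.BulkConnected) (A : Finset Ed) :
    ∃ (P : Set V) (r : V → NetVertex V) (K : ℕ),
      (∀ x, r x = .source ∨ r x = .sink ∨ ∃ y ∈ P, r x = .bulk y) ∧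
      ∀ (J : Type) [Finite J] (γ : Equiv.Perm J) (α : V → Equiv.Perm J),
        G.maxflow A * len γ ≤ G.energy A γ α ∧
        (∀ x ∈ P, len (α x) + len ((α x)⁻¹ * γ) ≤
          len γ + (G.energy A γ α - G.maxflow A * len γ)) ∧
        (∀ x, len ((α x)⁻¹ * extPerm γ α (r x)) ≤
          K * (G.energy A γ α - G.maxflow A * len γ)) := by
  classical
  obtain ⟨p, hp1, hp2⟩ := (G.isGreatest_maxflow A).1
  set P : Set V := {x | ∃ i, NetVertex.bulk x ∈ (p i).support} with hP
  set U : Finset (Eb ⊕ Ed) := Finset.univ.biUnion fun i => (p i).edges.toFinset with hU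
  have hUP : ∀ e ∈ U, ∀ x, NetVertex.bulk x ∈ G.netEnds A e → x ∈ P := by
    intro e he x hx
    simp only [hU, Finset.mem_biUnion, Finset.mem_univ, true_and, List.mem_toFinset] at he
    obtain ⟨i, hi⟩ := he
    exact ⟨i, (p i).mem_support_of_mem_edges hi hx⟩
  have hsum : ∀ (J : Type) [Finite J] (γ : Equiv.Perm J) (α : V → Equiv.Perm J),
      G.energy A γ α = ∑ i, ((p i).edges.map (G.edgeLen A γ α)).sum +
        ∑ e ∈ Uᶜ, G.edgeLen A γ α e := by
    intro J _ γ α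
    rw [OpenGraph.energy, ← Finset.sum_add_sum_compl U, hU, Finset.sum_biUnion]
    · congr 1
      refine Finset.sum_congr rfl fun i _ => ?_
      rw [List.sum_toFinset _ ((p i).edges_nodup (hp1 i))]
    · intro i _ j _ hij
      exact List.disjoint_toFinset_iff_disjoint.2 (hp2 hij)
  have hpath : ∀ (J : Type) [Finite J] (γ : Equiv.Perm J) (α : V → Equiv.Perm J) i,
      len γ ≤ ((p i).edges.map (G.edgeLen A γ α)).sum := by
    intro J _ γ α i
    simpa [extPerm] using (p i).len_le γ α
  -- Each path costs at least `len γ`, so the energy of the edges off the paths is entirely excess.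
  have hmin : ∀ (J : Type) [Finite J] (γ : Equiv.Perm J) (α : V → Equiv.Perm J),
      G.maxflow A * len γ + ∑ e ∈ Uᶜ, G.edgeLen A γ α e ≤ G.energy A γ α := by
    intro J _ γ α
    rw [hsum]
    gcongr
    have := Finset.sum_le_sum fun i (_ : i ∈ Finset.univ) => hpath J γ α i
    simpa using this
  have hun : ∀ e ∉ U, ∀ (J : Type) [Finite J] (γ : Equiv.Perm J) (α : V → Equiv.Perm J),
      G.edgeLen A γ α e ≤ G.energy A γ α - G.maxflow A * len γ := by
    intro e he J _ γ α
    have h1 := hmin J γ α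
    have h2 := Finset.single_le_sum (f := G.edgeLen A γ α) (fun _ _ => Nat.zero_le _)
      (Finset.mem_compl.2 he)
    omega
  obtain ⟨e₀⟩ := ‹Nonempty Ed›
  -- Walk from `x` towards a fixed half-edge and stop at the first vertex of `P`, or else at the
  -- source or sink behind the half-edge. Every edge used touches a vertex outside `P`, hence lies
  -- on no path and costs at most the excess.
  have hroot : ∀ x, ∃ (y : NetVertex V) (K : ℕ),
      (y = .source ∨ y = .sink ∨ ∃ z ∈ P, y = .bulk z) ∧
      ∀ (J : Type) [Finite J] (γ : Equiv.Perm J) (α : V → Equiv.Perm J),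
        len ((α x)⁻¹ * extPerm γ α y) ≤ K * (G.energy A γ α - G.maxflow A * len γ) := by
    intro x
    obtain ⟨w⟩ := hG.preconnected x (G.bdryEnd e₀)
    generalize hz : G.bdryEnd e₀ = z at w
    induction w with
    | @nil x =>
      by_cases hx : x ∈ P
      · exact ⟨.bulk x, 0, Or.inr (Or.inr ⟨x, hx, rfl⟩), fun J _ γ α => by simp [extPerm]⟩
      · have he : Sum.inr e₀ ∉ U := fun he => hx (hUP _ he x (by
          by_cases h : e₀ ∈ A <;> simp [OpenGraph.netEnds, h, hz]))
        by_cases h : e₀ ∈ A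
        · refine ⟨.sink, 1, by simp, fun J _ γ α => ?_⟩
          have := hun _ he J γ α
          rw [edgeLen_inr_mem _ _ h, len_inv_mul_comm, hz] at this
          simpa [extPerm] using this
        · refine ⟨.source, 1, by simp, fun J _ γ α => ?_⟩
          have := hun _ he J γ α
          rw [edgeLen_inr_notMem _ _ h, hz] at this
          simpa [extPerm, len_inv] using this
    | @cons x x' z hadj w ih =>
      by_cases hx : x ∈ P
      · exact ⟨.bulk x, 0, Or.inr (Or.inr ⟨x, hx, rfl⟩), fun J _ γ α => by simp [extPerm]⟩
      · obtain ⟨y, K, hy, hK⟩ := ih hz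
        refine ⟨y, K + 1, hy, fun J _ γ α => ?_⟩
        obtain ⟨-, e, he⟩ := hadj
        have hends : G.netEnds A (Sum.inl e) = s(.bulk x, .bulk x') := by
          exact congrArg (Sym2.map NetVertex.bulk) he
        have heU : Sum.inl e ∉ U := fun h => hx (hUP _ h x (by simp [hends]))
        have h1 := hun _ heU J γ α
        rw [← len_ends_le γ α hends] at h1
        have h2 := len_triangle (α x) (α x') (extPerm γ α y)
        have h3 := hK J γ α
        rw [add_mul, one_mul]
        simp only [extPerm] at h1
        omega
  choose r K hr hK using hroot
  refine ⟨P, r, ∑ x, K x, hr, fun J _ γ α => ⟨?_, ?_, ?_⟩⟩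
  · exact le_trans (Nat.le_add_right _ _) (hmin J γ α)
  · rintro x ⟨i, hi⟩
    have h1 := (p i).len_add_len_le γ α hi
    simp only [extPerm, inv_one, one_mul] at h1
    -- All paths but the `i`-th already cost `len γ` each, so the `i`-th can exceed `len γ` by at
    -- most the excess.
    have h2 : (G.maxflow A - 1) * len γ + ((p i).edges.map (G.edgeLen A γ α)).sum ≤
        G.energy A γ α := by
      rw [hsum, ← Finset.add_sum_erase _ _ (Finset.mem_univ i)]
      have := Finset.sum_le_sum fun j (_ : j ∈ Finset.univ.erase i) => hpath J γ α j
      simp only [Finset.sum_const, smul_eq_mul, Finset.card_erase_of_mem (Finset.mem_univ i),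
        Finset.card_univ, Fintype.card_fin] at this
      omega
    have h3 : (G.maxflow A - 1) * len γ + len γ = G.maxflow A * len γ := by
      have : G.maxflow A - 1 + 1 = G.maxflow A := Nat.sub_add_cancel (Nat.one_le_of_lt i.2)
      conv_rhs => rw [← this]
      ring
    omega
  · intro x
    refine (hK x J γ α).trans ?_
    gcongr
    exact Finset.single_le_sum (f := K) (fun _ _ => Nat.zero_le _) (Finset.mem_univ x)

end

/-! ### Moments of complex Gaussians -/

/-- The radial density makes rotation invariance available and reduces absolute moments to Gamma
integrals. -/
theorem stdComplexGaussian_eq : stdComplexGaussian =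
    (volume : Measure ℂ).withDensity
      fun z => ENNReal.ofReal (Real.pi⁻¹ * Real.exp (-‖z‖ ^ (2 : ℝ))) := by
  have h1 : gaussianReal 0 (1 / 2) =
      (volume : Measure ℝ).withDensity (gaussianPDF 0 (1 / 2)) :=
    gaussianReal_of_var_ne_zero 0 (by norm_num)
  have h2 : (fun p : ℝ × ℝ => (⟨p.1, p.2⟩ : ℂ)) = Complex.measurableEquivRealProd.symm := rfl
  rw [stdComplexGaussian, h1, prod_withDensity (by fun_prop) (by fun_prop), h2]
  have h3 : (volume : Measure ℂ) = ((volume : Measure ℝ).prod volume).map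
      Complex.measurableEquivRealProd.symm :=
    (Complex.volume_preserving_equiv_real_prod.symm _).map_eq.symm
  rw [h3]
  ext s hs
  rw [Measure.map_apply (by fun_prop) hs, withDensity_apply _ (by
      exact Complex.measurableEquivRealProd.symm.measurable hs),
    withDensity_apply _ hs, setLIntegral_map hs (by fun_prop) (by fun_prop)]
  refine lintegral_congr fun p => ?_
  rw [gaussianPDF, gaussianPDF, ← ENNReal.ofReal_mul (gaussianPDFReal_nonneg _ _ _)]
  congr 1
  simp only [gaussianPDFReal]
  have h4 : ‖Complex.measurableEquivRealProd.symm p‖ ^ (2 : ℝ) = p.1 ^ 2 + p.2 ^ 2 := by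
    rw [Real.rpow_two, ← Complex.normSq_eq_norm_sq, Complex.normSq_apply]
    simp; ring
  rw [h4]
  have h5 : Real.sqrt (2 * Real.pi * ((1 / 2 : NNReal) : ℝ)) ≠ 0 := by positivity
  have h6 : Real.sqrt (2 * Real.pi * ((1 / 2 : NNReal) : ℝ)) ^ 2 = Real.pi := by
    rw [Real.sq_sqrt (by positivity)]; push_cast; ring
  rw [mul_mul_mul_comm, ← Real.exp_add, ← sq, inv_pow, h6]
  congr 2
  push_cast; ring

instance : IsProbabilityMeasure stdComplexGaussian := by
  rw [stdComplexGaussian]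
  exact Measure.isProbabilityMeasure_map (by
    exact (Complex.measurableEquivRealProd.symm.measurable).aemeasurable)

instance : NullSingletonClass stdComplexGaussian := by
  rw [stdComplexGaussian_eq]
  infer_instance

theorem integral_stdComplexGaussian (f : ℂ → ℂ) : ∫ z, f z ∂stdComplexGaussian =
    ∫ z, ((Real.pi⁻¹ * Real.exp (-‖z‖ ^ (2 : ℝ)) : ℝ) : ℂ) * f z := by
  rw [stdComplexGaussian_eq, integral_withDensity_eq_integral_toReal_smul (by fun_prop) (by simp)]
  refine integral_congr_ae (Filter.Eventually.of_forall fun z => ?_)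
  simp only
  rw [ENNReal.toReal_ofReal (by positivity), Complex.real_smul]

theorem integral_mul_self_pow (p : ℕ) :
    ∫ z, z ^ p * star z ^ p ∂stdComplexGaussian = (p.factorial : ℂ) := by
  rw [integral_stdComplexGaussian]
  have h : ∀ z : ℂ, ((Real.pi⁻¹ * Real.exp (-‖z‖ ^ (2 : ℝ)) : ℝ) : ℂ) * (z ^ p * star z ^ p) =
      ((Real.pi⁻¹ * (‖z‖ ^ (2 * p : ℝ) * Real.exp (-‖z‖ ^ (2 : ℝ))) : ℝ) : ℂ) := by
    intro z
    have : z ^ p * star z ^ p = ((‖z‖ ^ (2 * p : ℝ) : ℝ) : ℂ) := by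
      rw [← mul_pow, show z * star z = (Complex.normSq z : ℂ) from Complex.mul_conj z,
        Complex.normSq_eq_norm_sq, Real.rpow_mul (norm_nonneg z), Real.rpow_two,
        Real.rpow_natCast]
      push_cast; ring
    rw [this]; push_cast; ring
  simp_rw [h]
  rw [integral_complex_ofReal, integral_const_mul,
    Complex.integral_rpow_mul_exp_neg_rpow (by norm_num)
      (by have : (0 : ℝ) ≤ p := p.cast_nonneg
          linarith)]
  have h2 : ((2 * p : ℝ) + 2) / 2 = p + 1 := by ring
  rw [h2, Real.Gamma_nat_eq_factorial]
  have := Real.pi_ne_zero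
  field_simp
  simp

theorem integral_pow_mul_star_pow_of_ne {p q : ℕ} (h : p ≠ q) :
    ∫ z, z ^ p * star z ^ q ∂stdComplexGaussian = 0 := by
  rw [integral_stdComplexGaussian]
  set F : ℂ → ℂ := fun z =>
    ((Real.pi⁻¹ * Real.exp (-‖z‖ ^ (2 : ℝ)) : ℝ) : ℂ) * (z ^ p * star z ^ q) with hF
  have hpq : (p : ℝ) - q ≠ 0 := sub_ne_zero.2 (by exact_mod_cast h)
  -- The angle is chosen so that `ω ^ (p - q) = -1`: the rotation preserves the integral and also
  -- flips its sign.
  let ω : Circle := Circle.exp (Real.pi / (p - q))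
  have hω : (ω : ℂ) ^ p * star (ω : ℂ) ^ q = -1 := by
    have : star (ω : ℂ) = ((ω⁻¹ : Circle) : ℂ) := (Circle.coe_inv_eq_conj ω).symm
    rw [this, ← Circle.exp_neg, Circle.coe_exp, Circle.coe_exp, ← Complex.exp_nat_mul,
      ← Complex.exp_nat_mul, ← Complex.exp_add, ← Complex.exp_pi_mul_I]
    congr 1
    have hpq' : (p : ℂ) - q ≠ 0 := by exact_mod_cast hpq
    push_cast
    field_simp
    ring
  have h1 : ∫ z, F (rotation ω z) = ∫ z, F z :=
    (rotation ω).measurePreserving.integral_comp (rotation ω).toHomeomorph.measurableEmbedding F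
  have h2 : ∀ z, F (rotation ω z) = -F z := by
    intro z
    simp only [hF, rotation_apply]
    rw [norm_mul, Circle.norm_coe, one_mul, star_mul', mul_pow, mul_pow]
    linear_combination (((Real.pi⁻¹ * Real.exp (-‖z‖ ^ (2 : ℝ)) : ℝ) : ℂ) * (z ^ p * star z ^ q)) * hω
  simp_rw [h2, integral_neg] at h1
  exact self_eq_neg.1 h1.symm

theorem integrable_pow_mul_star_pow (p q : ℕ) :
    Integrable (fun z : ℂ => z ^ p * star z ^ q) stdComplexGaussian := by
  have h1 : ∀ r : ℕ, Integrable (fun z : ℂ => z ^ r * star z ^ r) stdComplexGaussian := by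
    intro r
    -- A non-integrable function has Bochner integral zero by convention, but this integral is the
    -- nonzero number `r!`.
    by_contra h
    have := integral_undef h
    rw [integral_mul_self_pow] at this
    exact r.factorial_ne_zero (by exact_mod_cast this)
  refine ((integrable_const (1 : ℝ)).add (h1 (p + q)).norm).mono' (by fun_prop)
    (Filter.Eventually.of_forall fun z => ?_)
  simp only [norm_mul, norm_pow, norm_star, Pi.add_apply]
  rw [← pow_add, ← pow_add]
  rcases le_total ‖z‖ 1 with h | h
  · have := pow_le_one₀ (n := p + q) (norm_nonneg z) h
    have := pow_nonneg (norm_nonneg z) (p + q + (p + q))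
    linarith
  · have := pow_le_pow_right₀ h (show p + q ≤ p + q + (p + q) by omega)
    linarith

/-! ### Wick's formula -/

section Wick

variable {J I : Type*} [Fintype J] [Fintype I]

open Classical in
/-- The permutations that transport one labelling to another are counted by factorials. -/
theorem natCard_transport (a b : J → I) :
    Nat.card {σ : Equiv.Perm J // ∀ j, a j = b (σ j)} =
      ∏ i, if Fintype.card {j // a j = i} = Fintype.card {j // b j = i} then
        (Fintype.card {j // a j = i}).factorial else 0 := by
  by_cases h : ∀ i, Fintype.card {j // a j = i} = Fintype.card {j // b j = i}
  -- One transport `σ₀` is built fibre by fibre; all others differ from it by an element of the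
  -- stabilizer of `a`, whose order is a product of factorials.
  · let σ₀ : Equiv.Perm J := (Equiv.sigmaFiberEquiv a).symm.trans
      ((Equiv.sigmaCongrRight fun i => Fintype.equivOfCardEq (h i)).trans
        (Equiv.sigmaFiberEquiv b))
    have hσ₀ : ∀ j, b (σ₀ j) = a j := by
      intro j
      exact (Fintype.equivOfCardEq (h (a j)) ⟨j, rfl⟩).2
    let e : {σ : Equiv.Perm J // ∀ j, a j = b (σ j)} ≃ {g : Equiv.Perm J // a ∘ g = a} :=
      { toFun := fun σ => ⟨σ₀⁻¹ * σ.1, by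
          ext j
          have := hσ₀ (σ₀⁻¹ (σ.1 j))
          simp only [Function.comp_apply, Equiv.Perm.mul_apply]
          rw [← this, σ.2 j]; simp⟩
        invFun := fun g => ⟨σ₀ * g.1, fun j => by
          have := congrFun g.2 j
          simp only [Function.comp_apply] at this
          rw [Equiv.Perm.mul_apply, hσ₀, this]⟩
        left_inv := fun σ => by ext; simp
        right_inv := fun g => by ext; simp }
    rw [Nat.card_congr e, Nat.card_eq_fintype_card, DomMulAct.stabilizer_card]
    exact Finset.prod_congr rfl fun i _ => by rw [if_pos (h i)]
  · have h' := h
    push Not at h'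
    obtain ⟨i, hi⟩ := h'
    rw [Finset.prod_eq_zero (Finset.mem_univ i) (if_neg hi), Nat.card_eq_zero]
    refine Or.inl ⟨fun σ => hi ?_⟩
    exact Fintype.card_congr (σ.1.subtypeEquiv fun j => by rw [σ.2 j])

open Classical in
theorem prod_apply_eq_prod_pow {M : Type*} [CommMonoid M] (g : I → M) (a : J → I) :
    ∏ j, g (a j) = ∏ i, g i ^ Fintype.card {j // a j = i} := by
  rw [← Finset.prod_fiberwise Finset.univ a]
  refine Finset.prod_congr rfl fun i _ => ?_
  rw [Finset.prod_congr rfl fun j hj => by rw [(Finset.mem_filter.1 hj).2], Finset.prod_const,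
    Fintype.card_subtype]

theorem wick_integrable (a b : J → I) :
    Integrable (fun g : I → ℂ => ∏ j, (g (a j) * star (g (b j))))
      (Measure.pi fun _ => stdComplexGaussian) := by
  classical
  simp_rw [Finset.prod_mul_distrib, prod_apply_eq_prod_pow _ a,
    prod_apply_eq_prod_pow (fun i => star (_ : ℂ)) b, ← Finset.prod_mul_distrib]
  exact Integrable.fintype_prod fun i => integrable_pow_mul_star_pow _ _

/-- **Wick's formula** for independent standard complex Gaussians. -/
theorem wick (a b : J → I) :
    ∫ g : I → ℂ, ∏ j, (g (a j) * star (g (b j))) ∂(Measure.pi fun _ => stdComplexGaussian) =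
      Nat.card {σ : Equiv.Perm J // ∀ j, a j = b (σ j)} := by
  classical
  have h : ∀ g : I → ℂ, ∏ j, (g (a j) * star (g (b j))) =
      ∏ i, g i ^ Fintype.card {j // a j = i} * star (g i) ^ Fintype.card {j // b j = i} := by
    intro g
    rw [Finset.prod_mul_distrib, prod_apply_eq_prod_pow g a,
      prod_apply_eq_prod_pow (fun i => star (g i)) b, Finset.prod_mul_distrib]
  simp_rw [h]
  rw [integral_fintype_prod_eq_prod
    (fun i z => z ^ Fintype.card {j // a j = i} * star z ^ Fintype.card {j // b j = i}),
    natCard_transport]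
  push_cast
  refine Finset.prod_congr rfl fun i _ => ?_
  split_ifs with hi
  · rw [← hi, integral_mul_self_pow]
  · exact integral_pow_mul_star_pow_of_ne hi

end Wick

/-! ### Expected traces -/

section

variable {V Eb Ed : Type*} [Fintype V] [DecidableEq V] [Fintype Eb] [DecidableEq Eb]
  [Fintype Ed] [DecidableEq Ed]

instance (G : OpenGraph V Eb Ed) (D : ℕ) : IsProbabilityMeasure (G.tensorLaw D) := by
  rw [OpenGraph.tensorLaw]; infer_instance

/-- The labels of the legs at `x` when each edge carries one label. -/
def OpenGraph.legLabel (G : OpenGraph V Eb Ed) {D : ℕ} (k : Eb → Fin D) (i : Ed → Fin D) (x : V) :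
    G.Leg x → Fin D :=
  fun l => Sum.elim (fun p => k p.1) i l.1

/-- The entangled pair vanishes unless both ends of a bulk edge carry the same label, so one label
per edge suffices. -/
theorem state_eq (G : OpenGraph V Eb Ed) (D : ℕ) (g : G.Tensors D) (i : Ed → Fin D) :
    G.state D g i = ((1 / Real.sqrt D : ℝ) : ℂ) ^ Fintype.card Eb *
      ∑ k : Eb → Fin D, ∏ x, g x (G.legLabel k i x) := by
  rw [OpenGraph.state, Finset.mul_sum]
  symm
  refine Fintype.sum_of_injective (fun (k : Eb → Fin D) (p : Eb × Bool) => k p.1)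
    (fun k k' h => funext fun e => congrFun h (e, true)) _ _ (fun c hc => ?_) (fun k => ?_)
  · have : ∃ e, c (e, false) ≠ c (e, true) := by
      by_contra h
      push Not at h
      refine hc ⟨fun e => c (e, true), ?_⟩
      ext ⟨e, b⟩
      cases b <;> simp [h]
    obtain ⟨e, he⟩ := this
    rw [Finset.prod_eq_zero (Finset.mem_univ e) (by simp [maxEntangled, he])]
    simp
  · congr 1
    simp [maxEntangled]

variable {J : Type} [Fintype J] [DecidableEq J]

/-- The index of the expansion of an entry of the reduced state. -/
abbrev OpenGraph.ExpIndex (_G : OpenGraph V Eb Ed) (A : Finset Ed) (D : ℕ) : Type _ :=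
  ({e // e ∉ A} → Fin D) × (Eb → Fin D) × (Eb → Fin D)

/-- Ket and bra have independent bulk labels but share the label of the traced-out region. Their
factors `D^(-1/2)` combine to one `D⁻¹` per bulk edge and copy. -/
theorem prod_reducedState_eq (G : OpenGraph V Eb Ed) (A : Finset Ed) (D : ℕ) (π : Equiv.Perm J)
    (g : G.Tensors D) (a : J → {e // e ∈ A} → Fin D) :
    ∏ j, G.reducedState A D g (a j) (a (π j)) =
      ∑ t : J → G.ExpIndex A D, ((D : ℂ)⁻¹ ^ Fintype.card Eb) ^ Fintype.card J *
        ∏ x, ∏ j, (g x (G.legLabel (t j).2.1 (glue A (a j) (t j).1) x) *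
          star (g x (G.legLabel (t j).2.2 (glue A (a (π j)) (t j).1) x))) := by
  have hC : ((1 / Real.sqrt D : ℝ) : ℂ) * star ((1 / Real.sqrt D : ℝ) : ℂ) = (D : ℂ)⁻¹ := by
    rw [show star ((1 / Real.sqrt D : ℝ) : ℂ) = ((1 / Real.sqrt D : ℝ) : ℂ) from
      Complex.conj_ofReal _, ← Complex.ofReal_mul, div_mul_div_comm, one_mul,
      Real.mul_self_sqrt (Nat.cast_nonneg D)]
    simp
  have h1 : ∀ j, G.reducedState A D g (a j) (a (π j)) =
      ∑ t : G.ExpIndex A D, (D : ℂ)⁻¹ ^ Fintype.card Eb *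
        ∏ x, (g x (G.legLabel t.2.1 (glue A (a j) t.1) x) *
          star (g x (G.legLabel t.2.2 (glue A (a (π j)) t.1) x))) := by
    intro j
    rw [OpenGraph.reducedState, Fintype.sum_prod_type]
    refine Finset.sum_congr rfl fun b _ => ?_
    rw [state_eq, state_eq, star_mul', star_sum, mul_mul_mul_comm, star_pow, ← mul_pow, hC,
      Finset.sum_mul_sum, Fintype.sum_prod_type, Finset.mul_sum]
    refine Finset.sum_congr rfl fun k _ => ?_
    rw [Finset.mul_sum]
    refine Finset.sum_congr rfl fun k' _ => ?_
    rw [star_prod, Finset.prod_mul_distrib]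
  rw [Finset.prod_congr rfl fun j _ => h1 j, Finset.prod_univ_sum, Fintype.piFinset_univ]
  refine Finset.sum_congr rfl fun t _ => ?_
  rw [Finset.prod_mul_distrib, Finset.prod_const, Finset.card_univ, Finset.prod_comm]

/-- The labellings that are compatible with permutations on the vertices. -/
def OpenGraph.Compatible (G : OpenGraph V Eb Ed) (A : Finset Ed) (D : ℕ) (π : Equiv.Perm J)
    (α : V → Equiv.Perm J) (s : (J → {e // e ∈ A} → Fin D) × (J → G.ExpIndex A D)) : Prop :=
  ∀ x j, G.legLabel (s.2 j).2.1 (glue A (s.1 j) (s.2 j).1) x =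
    G.legLabel (s.2 (α x j)).2.2 (glue A (s.1 (π (α x j))) (s.2 (α x j)).1) x

/-- The condition decouples edge by edge: `π * α` acts on labels of `A`, `α` on labels outside `A`,
and at a bulk edge each end matches ket labels with bra labels. Eliminating the bra leaves
invariance under the relative permutation of the two ends. -/
theorem compatible_iff (G : OpenGraph V Eb Ed) (A : Finset Ed) (D : ℕ) (π : Equiv.Perm J)
    (α : V → Equiv.Perm J) (s : (J → {e // e ∈ A} → Fin D) × (J → G.ExpIndex A D)) :
    G.Compatible A D π α s ↔
      (∀ (e : {e // e ∈ A}) j, s.1 ((π * α (G.bdryEnd e.1)) j) e = s.1 j e) ∧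
      (∀ (e : {e // e ∉ A}) j, (s.2 (α (G.bdryEnd e.1) j)).1 e = (s.2 j).1 e) ∧
      (∀ e c j, (s.2 j).2.1 e = (s.2 (α (G.bulkEnd e c) j)).2.2 e) := by
  constructor
  · intro h
    refine ⟨fun e j => ?_, fun e j => ?_, fun e c j => ?_⟩
    · have := congrFun (h (G.bdryEnd e.1) j) ⟨Sum.inr e.1, rfl⟩
      simpa [OpenGraph.legLabel, glue, e.2] using this.symm
    · have := congrFun (h (G.bdryEnd e.1) j) ⟨Sum.inr e.1, rfl⟩
      simpa [OpenGraph.legLabel, glue, e.2] using this.symm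
    · exact congrFun (h (G.bulkEnd e c) j) ⟨Sum.inl (e, c), rfl⟩
  · rintro ⟨h1, h2, h3⟩ x j
    ext ⟨l, hl⟩
    rcases l with ⟨e, c⟩ | e
    · subst hl
      exact congrArg Fin.val (h3 e c j)
    · subst hl
      by_cases he : e ∈ A
      · simpa [OpenGraph.legLabel, glue, he, OpenGraph.site] using
          congrArg Fin.val (h1 ⟨e, he⟩ j).symm
      · simpa [OpenGraph.legLabel, glue, he, OpenGraph.site] using
          congrArg Fin.val (h2 ⟨e, he⟩ j).symm

/-- Compatible labellings can be chosen independently for each edge. -/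
def compatibleEquiv (G : OpenGraph V Eb Ed) (A : Finset Ed) (D : ℕ) (π : Equiv.Perm J)
    (α : V → Equiv.Perm J) :
    {s // G.Compatible A D π α s} ≃
      ((e : {e // e ∈ A}) → {f : J → Fin D // ∀ j, f ((π * α (G.bdryEnd e.1)) j) = f j}) ×
      ((e : {e // e ∉ A}) → {f : J → Fin D // ∀ j, f (α (G.bdryEnd e.1) j) = f j}) ×
      ((e : Eb) → {f : J → Fin D //
        ∀ j, f (((α (G.bulkEnd e false))⁻¹ * α (G.bulkEnd e true)) j) = f j}) where
  toFun s :=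
    have h := (compatible_iff G A D π α s.1).1 s.2
    (fun e => ⟨fun j => s.1.1 j e, h.1 e⟩, fun e => ⟨fun j => (s.1.2 j).1 e, h.2.1 e⟩,
      fun e => ⟨fun j => (s.1.2 j).2.1 e, fun j => by
        have h1 := h.2.2 e false (((α (G.bulkEnd e false))⁻¹ * α (G.bulkEnd e true)) j)
        have h2 := h.2.2 e true j
        simp only [Equiv.Perm.mul_apply] at h1 ⊢
        rw [h1, h2]
        simp⟩)
  invFun p := ⟨(fun j e => (p.1 e).1 j, fun j => (fun e => (p.2.1 e).1 j, fun e => (p.2.2 e).1 j,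
      fun e => (p.2.2 e).1 ((α (G.bulkEnd e false))⁻¹ j))), by
    rw [compatible_iff]
    refine ⟨fun e j => (p.1 e).2 j, fun e j => (p.2.1 e).2 j, fun e c j => ?_⟩
    cases c
    · simp
    · exact ((p.2.2 e).2 j).symm⟩
  left_inv s := by
    have h := (compatible_iff G A D π α s.1).1 s.2
    refine Subtype.ext (Prod.ext rfl ?_)
    funext j
    refine Prod.ext rfl (Prod.ext rfl ?_)
    funext e
    simp [h.2.2 e false]
  right_inv p := rfl

/-- Every edge contributes `D` to the number of cycles of its relative permutation, which is `|J|`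
minus its `len`; these deficits add up to the energy. The product form avoids subtraction in the
exponent. -/
theorem natCard_compatible (G : OpenGraph V Eb Ed) (A : Finset Ed) (D : ℕ) (γ : Equiv.Perm J)
    (α : V → Equiv.Perm J) :
    Nat.card {s // G.Compatible A D γ⁻¹ α s} * D ^ G.energy A γ α =
      D ^ ((Fintype.card Ed + Fintype.card Eb) * Fintype.card J) := by
  rw [Nat.card_congr (compatibleEquiv G A D γ⁻¹ α), Nat.card_prod, Nat.card_prod, Nat.card_pi,
    Nat.card_pi, Nat.card_pi]
  simp_rw [natCard_invariant]
  have h0 : G.energy A γ α = (∑ e : {e // e ∈ A}, len (γ⁻¹ * α (G.bdryEnd e.1)) +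
      ∑ e : {e // e ∉ A}, len (α (G.bdryEnd e.1))) +
      ∑ e : Eb, len ((α (G.bulkEnd e false))⁻¹ * α (G.bulkEnd e true)) := by
    rw [OpenGraph.energy, Fintype.sum_sum_type, add_comm,
      ← Fintype.sum_subtype_add_sum_subtype (fun e => e ∈ A)]
    congr 1
    congr 1
    · exact Finset.sum_congr (by ext; simp) fun e _ => edgeLen_inr_mem _ _ e.2
    · exact Finset.sum_congr (by ext; simp) fun e _ => edgeLen_inr_notMem _ _ e.2
  have hJ : ∀ σ : Equiv.Perm J, len σ + cyc σ = Fintype.card J := fun σ => by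
    rw [len_add_cyc, Nat.card_eq_fintype_card]
  rw [h0, Finset.prod_pow_eq_pow_sum, Finset.prod_pow_eq_pow_sum, Finset.prod_pow_eq_pow_sum,
    ← pow_add, ← pow_add, ← pow_add]
  congr 1
  have h1 : ∑ e : {e // e ∈ A}, (len (γ⁻¹ * α (G.bdryEnd e.1)) + cyc (γ⁻¹ * α (G.bdryEnd e.1))) =
      Fintype.card {e // e ∈ A} * Fintype.card J := by simp [hJ]
  have h2 : ∑ e : {e // e ∉ A}, (len (α (G.bdryEnd e.1)) + cyc (α (G.bdryEnd e.1))) =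
      Fintype.card {e // e ∉ A} * Fintype.card J := by simp only [hJ]; simp
  have h3 : ∑ e : Eb, (len ((α (G.bulkEnd e false))⁻¹ * α (G.bulkEnd e true)) +
      cyc ((α (G.bulkEnd e false))⁻¹ * α (G.bulkEnd e true))) =
      Fintype.card Eb * Fintype.card J := by simp [hJ]
  have h4 : Fintype.card {e // e ∈ A} + Fintype.card {e // e ∉ A} = Fintype.card Ed := by
    rw [← Fintype.card_congr (Equiv.sumCompl fun e => e ∈ A), Fintype.card_sum]
  rw [Finset.sum_add_distrib] at h1 h2 h3
  rw [← h4, add_mul, add_mul]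
  omega

theorem integrable_vertexProd (G : OpenGraph V Eb Ed) (D : ℕ) (w w' : (x : V) → J → G.Leg x → Fin D) :
    Integrable (fun g : G.Tensors D => ∏ x, ∏ j, (g x (w x j) * star (g x (w' x j))))
      (G.tensorLaw D) :=
  Integrable.fintype_prod_dep
    (f := fun x (h : (G.Leg x → Fin D) → ℂ) => ∏ j, (h (w x j) * star (h (w' x j))))
    fun x => wick_integrable (w x) (w' x)

/-- Independence across vertices factors the expectation, and Wick's formula supplies one
permutation per vertex. -/
theorem integral_vertexProd (G : OpenGraph V Eb Ed) (D : ℕ)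
    (w w' : (x : V) → J → G.Leg x → Fin D) :
    ∫ g : G.Tensors D, ∏ x, ∏ j, (g x (w x j) * star (g x (w' x j))) ∂(G.tensorLaw D) =
      Nat.card {α : V → Equiv.Perm J // ∀ x j, w x j = w' x (α x j)} := by
  rw [OpenGraph.tensorLaw, integral_fintype_prod_eq_prod
    (fun x (h : (G.Leg x → Fin D) → ℂ) => ∏ j, (h (w x j) * star (h (w' x j))))]
  simp_rw [wick]
  rw [← Nat.cast_prod, ← Nat.card_pi]
  congr 1
  exact Nat.card_congr
    { toFun := fun α => ⟨fun x => (α x).1, fun x => (α x).2⟩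
      invFun := fun α x => ⟨α.1 x, α.2 x⟩
      left_inv := fun α => rfl
      right_inv := fun α => rfl }

theorem integrable_prod_reducedState (G : OpenGraph V Eb Ed) (A : Finset Ed) (D : ℕ)
    (π : Equiv.Perm J) :
    Integrable (fun g => ∑ a : J → {e // e ∈ A} → Fin D,
      ∏ j, G.reducedState A D g (a j) (a (π j))) (G.tensorLaw D) := by
  simp_rw [prod_reducedState_eq]
  refine integrable_finsetSum _ fun a _ => integrable_finsetSum _ fun t _ => ?_
  exact (integrable_vertexProd G D _ _).const_mul _

theorem integral_prod_reducedState (G : OpenGraph V Eb Ed) (A : Finset Ed) {D : ℕ} (hD : D ≠ 0)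
    (γ : Equiv.Perm J) :
    ∫ g, ∑ a : J → {e // e ∈ A} → Fin D, ∏ j, G.reducedState A D g (a j) (a (γ⁻¹ j))
      ∂(G.tensorLaw D) =
      ∑ α : V → Equiv.Perm J, (D : ℂ) ^ (Fintype.card Ed * Fintype.card J) *
        ((D : ℂ) ^ G.energy A γ α)⁻¹ := by
  classical
  simp_rw [prod_reducedState_eq]
  rw [integral_finsetSum _ fun a _ => integrable_finsetSum _ fun t _ =>
    (integrable_vertexProd G D _ _).const_mul _]
  simp_rw [integral_finsetSum Finset.univ fun (t : J → G.ExpIndex A D) _ =>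
    (integrable_vertexProd G D (fun x j => G.legLabel (t j).2.1 (glue A (_ : _) (t j).1) x)
      (fun x j => G.legLabel (t j).2.2 (glue A (_ : _) (t j).1) x)).const_mul _]
  simp_rw [integral_const_mul, integral_vertexProd]
  rw [← Fintype.sum_prod_type', ← Finset.mul_sum, ← Nat.cast_sum]
  -- Double counting of compatible pairs: first fix the labelling, then fix the permutations.
  have hswap : ∑ s : (J → {e // e ∈ A} → Fin D) × (J → G.ExpIndex A D),
      Nat.card {α : V → Equiv.Perm J // G.Compatible A D γ⁻¹ α s} =
      ∑ α : V → Equiv.Perm J, Nat.card {s // G.Compatible A D γ⁻¹ α s} := by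
    simp_rw [Nat.card_eq_fintype_card, Fintype.card_subtype, Finset.card_filter]
    exact Finset.sum_comm
  have hs : (∑ s : (J → {e // e ∈ A} → Fin D) × (J → G.ExpIndex A D),
      Nat.card {α : V → Equiv.Perm J // ∀ x j,
        G.legLabel (s.2 j).2.1 (glue A (s.1 j) (s.2 j).1) x =
        G.legLabel (s.2 (α x j)).2.2 (glue A (s.1 (γ⁻¹ (α x j))) (s.2 (α x j)).1) x}) =
      ∑ α : V → Equiv.Perm J, Nat.card {s // G.Compatible A D γ⁻¹ α s} := hswap
  rw [hs, Nat.cast_sum, Finset.mul_sum]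
  refine Finset.sum_congr rfl fun α _ => ?_
  have hD' : (D : ℂ) ≠ 0 := by exact_mod_cast hD
  have h := congrArg (Nat.cast (R := ℂ)) (natCard_compatible G A D γ α)
  push_cast at h
  rw [eq_mul_inv_iff_mul_eq₀ (pow_ne_zero _ hD'), mul_assoc, h, ← pow_mul, inv_pow,
    inv_mul_eq_iff_eq_mul₀ (pow_ne_zero _ hD'), ← pow_add]
  congr 1
  ring

end

/-! ### Moments of the empirical measure -/

theorem trace_pow_eq {I : Type*} [Fintype I] [DecidableEq I] {M : Matrix I I ℂ} (hM : M.IsHermitian) (n : ℕ) :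
   (M ^ n).trace = ((∑ k, hM.eigenvalues k ^ n : ℝ) : ℂ) := by
  conv_lhs => rw [hM.spectral_theorem]
  rw [← map_pow, Unitary.conjStarAlgAut_apply, Matrix.trace_mul_comm, ← mul_assoc]
  simp [Matrix.diagonal_pow, Matrix.trace_diagonal]

/-- The spare factor `N` keeps the chain of indices open, so the induction can absorb one factor of
`M` at a time; closing it with `N = M` gives the cyclic product. -/
theorem trace_pow_mul {I R : Type*} [Fintype I] [DecidableEq I] [CommRing R] (M : Matrix I I R) (n : ℕ) :
    ∀ N : Matrix I I R, (M ^ n * N).trace = ∑ a : Fin (n + 1) → I,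
      (∏ j : Fin n, M (a j.castSucc) (a j.succ)) * N (a (Fin.last n)) (a 0) := by
  induction n with
  | zero => 
    intro N
    rw [pow_zero, one_mul, Matrix.trace]
    exact Fintype.sum_equiv (Equiv.funUnique (Fin 1) I).symm _ _ fun i => by simp
  | succ n ih =>
    intro N
    rw [pow_succ, mul_assoc, ih, ← (Fin.snocEquiv fun _ : Fin (n + 2) => I).sum_comp, Fintype.sum_prod_type,
      Finset.sum_comm]
    refine Finset.sum_congr rfl fun a _ => ?_
    rw [Matrix.mul_apply, Finset.mul_sum]
    refine Finset.sum_congr rfl fun b _ => ?_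
    rw [Fin.prod_univ_castSucc]
    have h0 : (Fin.snoc a b : Fin (n + 2) → I) 0 = a 0 := by
      rw [← Fin.castSucc_zero, Fin.snoc_castSucc (α := fun _ => I)]
    simp only [Fin.snocEquiv_apply, Fin.snoc_castSucc (α := fun _ => I), Fin.succ_last, Fin.snoc_last (α := fun _ => I),
      Fin.succ_castSucc, h0]
    ring

theorem trace_pow_succ {I R : Type*} [Fintype I] [DecidableEq I] [CommRing R] (M : Matrix I I R) (n : ℕ) :
    (M ^ (n + 1)).trace = ∑ a : Fin (n + 1) → I,
      ∏ j, M (a j) (a (finRotate (n + 1) j)) := by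
  rw [pow_succ, trace_pow_mul]
  refine Finset.sum_congr rfl fun a _ => ?_
  rw [Fin.prod_univ_castSucc]
  simp

/-! ### Normalized traces and the partition function -/

section

variable {V Eb Ed : Type*} [Fintype V] [DecidableEq V] [Fintype Eb] [DecidableEq Eb]
  [Fintype Ed] [DecidableEq Ed]

/-- The excess of the energy over its minimum. -/
noncomputable def OpenGraph.excess {J : Type} (G : OpenGraph V Eb Ed) (A : Finset Ed)
    (γ : Equiv.Perm J) (α : V → Equiv.Perm J) : ℕ :=
  G.energy A γ α - G.maxflow A * len γ

/-- The partition function of the network. -/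
noncomputable def OpenGraph.partitionSum {J : Type} [Fintype J] [DecidableEq J]
    (G : OpenGraph V Eb Ed) (A : Finset Ed) (γ : Equiv.Perm J) (D : ℝ) : ℝ :=
  ∑ α : V → Equiv.Perm J, (D ^ G.excess A γ α)⁻¹

/-- The normalized product of traces of the rescaled state along the cycles of `γ⁻¹`. -/
noncomputable def OpenGraph.permTrace {J : Type} [Fintype J] [DecidableEq J]
    (G : OpenGraph V Eb Ed) (A : Finset Ed) (γ : Equiv.Perm J) (D : ℕ) (g : G.Tensors D) : ℂ :=
  (((D : ℂ) ^ G.maxflow A) ^ cyc γ)⁻¹ * ∑ a : J → {e // e ∈ A} → Fin D,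
    ∏ j, G.rescaledState A D g (a j) (a (γ⁻¹ j))

/-- The normalized power sum of the eigenvalues of the rescaled state. -/
noncomputable def OpenGraph.powerSum (G : OpenGraph V Eb Ed) (A : Finset Ed) (D n : ℕ)
    (g : G.Tensors D) : ℝ :=
  ((D : ℝ) ^ G.maxflow A)⁻¹ * ∑ k, (G.isHermitian_rescaledState A D g).eigenvalues k ^ n

theorem permTrace_eq {J : Type} [Fintype J] [DecidableEq J] (G : OpenGraph V Eb Ed)
    (A : Finset Ed) (γ : Equiv.Perm J) (D : ℕ) (g : G.Tensors D) :
    G.permTrace A γ D g = (((D : ℂ) ^ G.maxflow A) ^ cyc γ)⁻¹ *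
      ((D : ℂ) ^ G.maxflow A * ((D : ℂ) ^ Fintype.card Ed)⁻¹) ^ Fintype.card J *
      ∑ a : J → {e // e ∈ A} → Fin D, ∏ j, G.reducedState A D g (a j) (a (γ⁻¹ j)) := by
  rw [OpenGraph.permTrace, mul_assoc]
  congr 1
  rw [Finset.mul_sum]
  refine Finset.sum_congr rfl fun a _ => ?_
  rw [← Finset.card_univ (α := J), ← Finset.prod_const, ← Finset.prod_mul_distrib]
  refine Finset.prod_congr rfl fun j _ => ?_
  simp [OpenGraph.rescaledState]

theorem integrable_permTrace {J : Type} [Fintype J] [DecidableEq J] (G : OpenGraph V Eb Ed)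
    (A : Finset Ed) (γ : Equiv.Perm J) (D : ℕ) :
    Integrable (G.permTrace A γ D) (G.tensorLaw D) := by
  simp_rw [funext fun g => permTrace_eq G A γ D g]
  exact (integrable_prod_reducedState G A D γ⁻¹).const_mul _

/-- The scaling gives `D ^ F` per element of `J` and removes one per cycle of `γ`. What is left, `D
^ (F * len γ)`, cancels the minimal energy exactly. -/
theorem integral_permTrace [Nonempty Ed] {J : Type} [Fintype J] [DecidableEq J]
    (G : OpenGraph V Eb Ed) (hG : G.BulkConnected) (A : Finset Ed) (γ : Equiv.Perm J) {D : ℕ}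
    (hD : D ≠ 0) :
    ∫ g, G.permTrace A γ D g ∂(G.tensorLaw D) = (G.partitionSum A γ D : ℝ) := by
  obtain ⟨_, _, _, _, hsk⟩ := G.exists_skeleton hG A
  simp_rw [permTrace_eq]
  rw [integral_const_mul, integral_prod_reducedState G A hD, OpenGraph.partitionSum,
    Finset.mul_sum]
  push_cast
  refine Finset.sum_congr rfl fun α _ => ?_
  have hD' : (D : ℂ) ≠ 0 := by exact_mod_cast hD
  have h1 : G.excess A γ α + G.maxflow A * len γ = G.energy A γ α :=
    Nat.sub_add_cancel (hsk J γ α).1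
  have h2 : len γ + cyc γ = Fintype.card J := by
    rw [len_add_cyc, Nat.card_eq_fintype_card]
  rw [← h1, ← h2]
  simp only [mul_add, pow_add, pow_mul, mul_pow, inv_pow]
  field_simp


theorem powerSum_eq_permTrace (G : OpenGraph V Eb Ed) (A : Finset Ed) (D : ℕ) {n : ℕ} (hn : n ≠ 0)
    (g : G.Tensors D) : (G.powerSum A D n g : ℂ) = G.permTrace A (fullCycle n) D g := by
  obtain ⟨m, rfl⟩ := Nat.exists_eq_succ_of_ne_zero hn
  have hc : cyc (fullCycle (m + 1)) = 1 := by
    have h1 := len_add_cyc (fullCycle (m + 1))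
    rw [len_fullCycle, Nat.card_fin] at h1
    omega
  rw [OpenGraph.powerSum, OpenGraph.permTrace, hc, pow_one, Complex.ofReal_mul,
    ← trace_pow_eq (G.isHermitian_rescaledState A D g), trace_pow_succ, fullCycle, inv_inv]
  push_cast
  rfl

/-- Turns a second moment into a first moment for another sink permutation, so no separate
covariance computation is needed. -/
theorem permTrace_sumCongr (G : OpenGraph V Eb Ed) (A : Finset Ed) (D : ℕ) {J : Type} [Fintype J]
    [DecidableEq J] (γ : Equiv.Perm J) (g : G.Tensors D) :
    G.permTrace A (Equiv.sumCongr γ γ : Equiv.Perm (J ⊕ J)) D g = G.permTrace A γ D g ^ 2 := by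
  have hc : cyc (Equiv.sumCongr γ γ : Equiv.Perm (J ⊕ J)) = cyc γ + cyc γ := by
    have h1 := len_add_cyc (Equiv.sumCongr γ γ : Equiv.Perm (J ⊕ J))
    have h2 := len_add_cyc γ
    rw [len_sumCongr, Nat.card_sum] at h1
    omega
  rw [OpenGraph.permTrace, OpenGraph.permTrace, hc, mul_pow, sq, sq, pow_add, mul_inv,
    ← (Equiv.sumArrowEquivProdArrow J J _).symm.sum_comp, Fintype.sum_prod_type,
    Finset.sum_mul_sum]
  congr 1
  refine Finset.sum_congr rfl fun a _ => Finset.sum_congr rfl fun b _ => ?_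
  rw [Fintype.prod_sum_type]
  rfl

section

variable [Nonempty Ed] (G : OpenGraph V Eb Ed) (A : Finset Ed)

theorem integrable_powerSum (D : ℕ) {n : ℕ} (hn : n ≠ 0) :
    Integrable (G.powerSum A D n) (G.tensorLaw D) := by
  have h := (integrable_permTrace G A (fullCycle n) D).re
  refine h.congr (Filter.Eventually.of_forall fun g => ?_)
  simp [← powerSum_eq_permTrace G A D hn]

theorem integrable_powerSum_sq (D : ℕ) {n : ℕ} (hn : n ≠ 0) :
    Integrable (fun g => G.powerSum A D n g ^ 2) (G.tensorLaw D) := by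
  have h := (integrable_permTrace G A
    (Equiv.sumCongr (fullCycle n) (fullCycle n) : Equiv.Perm (Fin n ⊕ Fin n)) D).re
  refine h.congr (Filter.Eventually.of_forall fun g => ?_)
  simp only [permTrace_sumCongr, ← powerSum_eq_permTrace G A D hn]
  rw [← Complex.ofReal_pow]
  exact Complex.ofReal_re _

theorem integral_powerSum (hG : G.BulkConnected) {D n : ℕ} (hD : D ≠ 0) (hn : n ≠ 0) :
    ∫ g, G.powerSum A D n g ∂(G.tensorLaw D) = G.partitionSum A (fullCycle n) D := by
  rw [← Complex.ofReal_inj, ← integral_complex_ofReal, ← integral_permTrace G hG A _ hD]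
  simp_rw [powerSum_eq_permTrace G A D hn]

theorem integral_powerSum_sq (hG : G.BulkConnected) {D n : ℕ} (hD : D ≠ 0) (hn : n ≠ 0) :
    ∫ g, G.powerSum A D n g ^ 2 ∂(G.tensorLaw D) = G.partitionSum A
      (Equiv.sumCongr (fullCycle n) (fullCycle n) : Equiv.Perm (Fin n ⊕ Fin n)) D := by
  rw [← Complex.ofReal_inj, ← integral_complex_ofReal, ← integral_permTrace G hG A _ hD]
  simp_rw [permTrace_sumCongr, ← powerSum_eq_permTrace G A D hn, Complex.ofReal_pow]

end

theorem tendsto_partitionSum {J : Type} [Fintype J] [DecidableEq J] (G : OpenGraph V Eb Ed)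
    (A : Finset Ed) (γ : Equiv.Perm J) :
    Tendsto (fun D : ℕ => G.partitionSum A γ D) atTop
      (𝓝 (Nat.card {α : V → Equiv.Perm J // G.excess A γ α = 0} : ℝ)) := by
  classical
  rw [Nat.card_eq_fintype_card, Fintype.card_subtype, Finset.card_filter]
  push_cast
  refine tendsto_finsetSum _ fun α _ => ?_
  split_ifs with h
  · simp [h]
  · exact tendsto_inv_atTop_zero.comp ((tendsto_pow_atTop h).comp tendsto_natCast_atTop_atTop)

end

/-! ### Concentration of the moments -/

section

variable {V Eb Ed : Type*} [Fintype V] [DecidableEq V] [Fintype Eb] [DecidableEq Eb]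
  [Fintype Ed] [DecidableEq Ed] [Nonempty Ed]

/-- The flow bound on the energy is attained by a domain wall, so minimizing means having zero
excess. -/
theorem numMinimizers_eq (G : OpenGraph V Eb Ed) (hG : G.BulkConnected) (A : Finset Ed) (n : ℕ) :
    G.numMinimizers A n = Nat.card {α // G.excess A (fullCycle n) α = 0} := by
  obtain ⟨_, _, _, _, hsk⟩ := G.exists_skeleton hG A
  obtain ⟨α₀, h₀⟩ := G.exists_energy_eq A (fullCycle n)
  refine Nat.card_congr (Equiv.subtypeEquivRight fun α => ?_)
  simp_rw [← energy_eq_hamiltonian]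
  constructor
  · intro h
    rw [OpenGraph.excess, Nat.sub_eq_zero_iff_le, ← h₀]
    exact h α₀
  · intro h β
    rw [OpenGraph.excess, Nat.sub_eq_zero_iff_le] at h
    exact h.trans (hsk _ _ β).1

theorem extPerm_sumCongr {J : Type} (γ : Equiv.Perm J) (σ τ : V → Equiv.Perm J) (u : NetVertex V) :
    extPerm (Equiv.sumCongr γ γ : Equiv.Perm (J ⊕ J)) (fun x => Equiv.sumCongr (σ x) (τ x)) u =
      Equiv.sumCongr (extPerm γ σ u) (extPerm γ τ u) := by
  cases u
  · exact (Equiv.sumCongr_refl).symm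
  · rfl
  · rfl

theorem energy_sumCongr {J : Type} [Finite J] (G : OpenGraph V Eb Ed) (A : Finset Ed)
    (γ : Equiv.Perm J) (σ τ : V → Equiv.Perm J) :
    G.energy A (Equiv.sumCongr γ γ : Equiv.Perm (J ⊕ J)) (fun x => Equiv.sumCongr (σ x) (τ x)) =
      G.energy A γ σ + G.energy A γ τ := by
  rw [OpenGraph.energy, OpenGraph.energy, OpenGraph.energy, ← Finset.sum_add_distrib]
  refine Finset.sum_congr rfl fun e _ => ?_
  rw [OpenGraph.edgeLen, extPerm_sumCongr, extPerm_sumCongr, Equiv.Perm.sumCongr_inv,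
    Equiv.Perm.sumCongr_mul, len_sumCongr]
  rfl

/-- At zero excess a vertex on a path sits on a geodesic from `1` to `γ`, and any other vertex has
the same permutation as its root. -/
theorem invariantSpace_le_of_excess_eq_zero {J : Type} [Finite J] (G : OpenGraph V Eb Ed)
    (hG : G.BulkConnected) (A : Finset Ed) {γ : Equiv.Perm J} {α : V → Equiv.Perm J}
    (h : G.excess A γ α = 0) (x : V) : invariantSpace γ ≤ invariantSpace (α x) := by
  obtain ⟨P, r, K, hr, hsk⟩ := G.exists_skeleton hG A
  obtain ⟨-, hP, hK⟩ := hsk J γ α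
  rw [OpenGraph.excess] at h
  rw [h] at hP hK
  have hP' : ∀ y ∈ P, invariantSpace γ ≤ invariantSpace (α y) := fun y hy =>
    invariantSpace_le_of_geodesic (hP y hy)
  have hx : α x = extPerm γ α (r x) := by
    have := eq_one_of_len_eq_zero (Nat.le_zero.1 (hK x))
    exact inv_mul_eq_one.1 this
  rw [hx]
  rcases hr x with h1 | h1 | ⟨y, hy, h1⟩
  · rw [h1]; intro f _ j; rfl
  · rw [h1]; exact le_rfl
  · rw [h1]; exact hP' y hy

/-- A minimizer cannot mix the two copies of `J`, so it is a pair of configurations. Their energies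
add and each is bounded below, so both have zero excess. -/
theorem natCard_excess_sumCongr_le (G : OpenGraph V Eb Ed) (hG : G.BulkConnected) (A : Finset Ed)
    {J : Type} [Finite J] (γ : Equiv.Perm J) :
    Nat.card {α : V → Equiv.Perm (J ⊕ J) // G.excess A (Equiv.sumCongr γ γ) α = 0} ≤
      Nat.card {α : V → Equiv.Perm J // G.excess A γ α = 0} ^ 2 := by
  have key : ∀ α : {α : V → Equiv.Perm (J ⊕ J) // G.excess A (Equiv.sumCongr γ γ) α = 0},
      ∃ σ τ : V → Equiv.Perm J, (∀ x, α.1 x = Equiv.sumCongr (σ x) (τ x)) ∧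
        G.excess A γ σ = 0 ∧ G.excess A γ τ = 0 := by
    rintro ⟨α, hα⟩
    have h1 : ∀ x, ∃ p : Equiv.Perm J × Equiv.Perm J, α x = Equiv.sumCongr p.1 p.2 := by
      intro x
      have h2 := invariantSpace_le_of_excess_eq_zero G hG A hα x
      -- The indicator of the first copy is invariant under `γ ⊕ γ`, hence under `α x`, which
      -- therefore preserves that copy.
      have h3 : (Sum.elim (fun _ => 1) (fun _ => 0) : J ⊕ J → ℝ) ∈
          invariantSpace (Equiv.sumCongr γ γ) := by
        rintro (j | j) <;> rfl
      have h4 : α x ∈ (Equiv.Perm.sumCongrHom J J).range := by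
        refine Equiv.Perm.mem_sumCongrHom_range_of_perm_mapsTo_inl ?_
        rintro _ ⟨j, rfl⟩
        have h5 := h2 h3 (Sum.inl j)
        rcases h6 : α x (Sum.inl j) with k | k
        · exact ⟨k, rfl⟩
        · rw [h6] at h5
          simp at h5
      obtain ⟨p, hp⟩ := h4
      exact ⟨p, hp.symm⟩
    choose p hp using h1
    refine ⟨fun x => (p x).1, fun x => (p x).2, hp, ?_⟩
    obtain ⟨_, _, _, _, hsk⟩ := G.exists_skeleton hG A
    have h7 := (hsk J γ fun x => (p x).1).1
    have h8 := (hsk J γ fun x => (p x).2).1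
    rw [OpenGraph.excess, funext hp, energy_sumCongr, len_sumCongr, mul_add] at hα
    rw [OpenGraph.excess, OpenGraph.excess]
    omega
  choose σ τ hα hσ hτ using key
  rw [sq, ← Nat.card_prod]
  refine Nat.card_le_card_of_injective (fun α => (⟨σ α, hσ α⟩, ⟨τ α, hτ α⟩)) ?_
  intro α β h
  simp only [Prod.mk.injEq, Subtype.mk.injEq] at h
  ext1
  funext x
  rw [hα α, hα β, h.1, h.2]

/-- The moments of the empirical measure converge in probability. -/
theorem tendsto_powerSum (G : OpenGraph V Eb Ed) (hG : G.BulkConnected) (A : Finset Ed) {n : ℕ}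
    (hn : n ≠ 0) {η : ℝ} (hη : 0 < η) :
    Tendsto (fun D : ℕ => (G.tensorLaw D).real
      {g | η ≤ |G.powerSum A D n g - G.numMinimizers A n|}) atTop (𝓝 0) := by
  set m : ℝ := (G.numMinimizers A n : ℝ) with hm
  set π : Equiv.Perm (Fin n ⊕ Fin n) := Equiv.sumCongr (fullCycle n) (fullCycle n) with hπ
  have h1 := tendsto_partitionSum G A (fullCycle n)
  rw [← numMinimizers_eq G hG A n, ← hm] at h1
  have h2 := tendsto_partitionSum G A π
  have h3 : (Nat.card {α : V → Equiv.Perm (Fin n ⊕ Fin n) // G.excess A π α = 0} : ℝ) ≤ m ^ 2 := by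
    rw [hm, numMinimizers_eq G hG A n]
    exact_mod_cast natCard_excess_sumCongr_le G hG A (fullCycle n)
  set v : ℝ := (Nat.card {α : V → Equiv.Perm (Fin n ⊕ Fin n) // G.excess A π α = 0} : ℝ)
  have hvar : ∀ D : ℕ, D ≠ 0 →
      η ^ 2 * (G.tensorLaw D).real {g | η ≤ |G.powerSum A D n g - m|} ≤
      G.partitionSum A π D - 2 * m * G.partitionSum A (fullCycle n) D + m ^ 2 := by
    intro D hD
    have i1 := integrable_powerSum G A D hn
    have i2 := integrable_powerSum_sq G A D hn
    have e1 : ∀ g, (G.powerSum A D n g - m) ^ 2 =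
        G.powerSum A D n g ^ 2 - 2 * m * G.powerSum A D n g + m ^ 2 := fun g => by ring
    have i3 : Integrable (fun g => (G.powerSum A D n g - m) ^ 2) (G.tensorLaw D) := by
      simp_rw [e1]
      exact (i2.sub (i1.const_mul _)).add (integrable_const _)
    have h4 := mul_meas_ge_le_integral_of_nonneg
      (Filter.Eventually.of_forall fun g => sq_nonneg (G.powerSum A D n g - m)) i3 (η ^ 2)
    have e2 : {g | η ^ 2 ≤ (G.powerSum A D n g - m) ^ 2} =
        {g | η ≤ |G.powerSum A D n g - m|} := by
      ext g
      simp only [Set.mem_ofPred_eq]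
      rw [sq_le_sq, abs_of_pos hη]
    rw [e2] at h4
    refine h4.trans_eq ?_
    simp_rw [e1]
    have i4 : Integrable (fun g => G.powerSum A D n g ^ 2 - 2 * m * G.powerSum A D n g)
      (G.tensorLaw D) := i2.sub (i1.const_mul _)
    rw [integral_add i4 (integrable_const _), integral_sub i2 (i1.const_mul _), integral_const_mul, integral_powerSum G A hG hD hn,
      integral_powerSum_sq G A hG hD hn]
    simp
    rfl
  have hlim : Tendsto (fun D : ℕ => (η ^ 2)⁻¹ * (G.partitionSum A π D -
      2 * m * G.partitionSum A (fullCycle n) D + m ^ 2)) atTop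
      (𝓝 ((η ^ 2)⁻¹ * (v - 2 * m * m + m ^ 2))) :=
    ((h2.sub (h1.const_mul _)).add_const _).const_mul _
  have hη2 : 0 < η ^ 2 := by positivity
  have hub : ∀ᶠ D : ℕ in atTop, (G.tensorLaw D).real {g | η ≤ |G.powerSum A D n g - m|} ≤
      (η ^ 2)⁻¹ * (G.partitionSum A π D -
        2 * m * G.partitionSum A (fullCycle n) D + m ^ 2) := by
    filter_upwards [eventually_ne_atTop 0] with D hD
    rw [inv_mul_eq_div, le_div_iff₀' hη2]
    exact hvar D hD
  -- The one-sided count `v ≤ m ^ 2` is enough: the reverse inequality follows because the limit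
  -- bounds probabilities from above.
  have hle : (η ^ 2)⁻¹ * (v - 2 * m * m + m ^ 2) ≤ 0 :=
    mul_nonpos_of_nonneg_of_nonpos (by positivity) (by nlinarith)
  have hge : 0 ≤ (η ^ 2)⁻¹ * (v - 2 * m * m + m ^ 2) :=
    ge_of_tendsto hlim (hub.mono fun D hD => measureReal_nonneg.trans hD)
  rw [le_antisymm hle hge] at hlim
  exact tendsto_of_tendsto_of_tendsto_of_le_of_le' tendsto_const_nhds hlim
    (Filter.Eventually.of_forall fun D => measureReal_nonneg) hub

end

/-! ### Moment bounds for Gaussian matrices -/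

section CycleSum

theorem cyc_permCongr {J K : Type*} (e : J ≃ K) (σ : Equiv.Perm J) :
    cyc (e.permCongr σ) = cyc σ := by
  symm
  refine Nat.card_congr (Quotient.congr e fun x y => ?_)
  change σ.SameCycle x y ↔ (e.permCongr σ).SameCycle (e x) (e y)
  have h : ∀ k : ℤ, ((e.permCongr σ) ^ k) (e x) = e ((σ ^ k) x) := by
    intro k
    have : e.permCongr σ ^ k = e.permCongr (σ ^ k) :=
      (map_zpow (Equiv.permCongrHom e) σ k).symm
    rw [this]; simp
  simp only [Equiv.Perm.SameCycle, h, e.apply_eq_iff_eq]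

theorem cyc_optionCongr {J : Type*} [Finite J] (σ : Equiv.Perm J) :
    cyc (Equiv.optionCongr σ : Equiv.Perm (Option J)) = cyc σ + 1 := by
  have h := natCard_invariant 2 (Equiv.optionCongr σ : Equiv.Perm (Option J))
  let e : {f : Option J → Fin 2 // ∀ j, f (Equiv.optionCongr σ j) = f j} ≃
      {f : J → Fin 2 // ∀ j, f (σ j) = f j} × Fin 2 :=
    { toFun := fun f => (⟨fun j => f.1 (some j), fun j => f.2 (some j)⟩, f.1 none)
      invFun := fun p => ⟨fun o => o.elim p.2 p.1.1, by
        rintro (_ | j)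
        · rfl
        · exact p.1.2 j⟩
      left_inv := fun f => by ext (_ | j) <;> rfl
      right_inv := fun p => rfl }
  rw [Nat.card_congr e, Nat.card_prod, natCard_invariant, Nat.card_fin, ← pow_succ] at h
  exact (Nat.pow_right_injective le_rfl h).symm

/-- The new point is inserted immediately before `i` in the cycle of `i`, so no cycle is created. -/
theorem cyc_swap_mul_optionCongr {J : Type*} [Finite J] [DecidableEq J] (i : J)
    (σ : Equiv.Perm J) :
    cyc (Equiv.swap none (some i) * Equiv.optionCongr σ : Equiv.Perm (Option J)) = cyc σ := by
  set τ : Equiv.Perm (Option J) := Equiv.swap none (some i) * Equiv.optionCongr σ with hτ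
  have h := natCard_invariant 2 τ
  have h0 : τ none = some i := by simp [hτ]
  have h1 : ∀ j, σ j = i → τ (some j) = none := by intro j hj; simp [hτ, hj]
  have h2 : ∀ j, σ j ≠ i → τ (some j) = some (σ j) := by
    intro j hj
    simp only [hτ, Equiv.Perm.mul_apply, Equiv.optionCongr_apply, Option.map_some]
    exact Equiv.swap_apply_of_ne_of_ne (by simp) (by simpa using hj)
  let e : {f : Option J → Fin 2 // ∀ j, f (τ j) = f j} ≃ {f : J → Fin 2 // ∀ j, f (σ j) = f j} :=
    { toFun := fun f => ⟨fun j => f.1 (some j), fun j => by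
        by_cases hj : σ j = i
        · have a1 := f.2 none
          have a2 := f.2 (some j)
          rw [h0] at a1
          rw [h1 j hj] at a2
          rw [hj]
          exact a1.trans a2
        · have a2 := f.2 (some j)
          rwa [h2 j hj] at a2⟩
      invFun := fun f => ⟨fun o => o.elim (f.1 i) f.1, by
        rintro (_ | j)
        · rw [h0]; rfl
        · by_cases hj : σ j = i
          · rw [h1 j hj, ← hj]
            exact f.2 j
          · rw [h2 j hj]
            exact f.2 j⟩
      left_inv := fun f => by
        ext (_ | j)
        · have a1 := f.2 none
          rw [h0] at a1
          simp [a1]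
        · rfl
      right_inv := fun f => rfl }
  rw [Nat.card_congr e, natCard_invariant] at h
  exact (Nat.pow_right_injective le_rfl h).symm

/-- Adding a point multiplies the sum by `d` (new fixed point) plus `|J|` (insertion into a cycle).
The sum is thus a rising factorial, bounded factor by factor. -/
theorem sum_pow_cyc_le (d : ℕ) (J : Type) [Fintype J] :
    ∀ [DecidableEq J], ∑ σ : Equiv.Perm J, d ^ cyc σ ≤ (d + Fintype.card J) ^ Fintype.card J := by
  refine Fintype.induction_empty_option (P := fun J _ => ∀ [DecidableEq J],
    ∑ σ : Equiv.Perm J, d ^ cyc σ ≤ (d + Fintype.card J) ^ Fintype.card J) ?_ ?_ ?_ J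
  · intro J K _ e ih _
    classical
    have := Fintype.ofEquiv K e.symm
    rw [← e.permCongr.sum_comp]
    simp_rw [cyc_permCongr, ← Fintype.card_congr e]
    convert ih
  · intro _
    simp [cyc]
  · intro J _ ih inst
    have : DecidableEq J := Classical.decEq J
    obtain rfl : inst = Option.instDecidableEq := Subsingleton.elim _ _
    have h : ∑ σ : Equiv.Perm (Option J), d ^ cyc σ =
        (d + Fintype.card J) * ∑ σ : Equiv.Perm J, d ^ cyc σ := by
      rw [← Equiv.Perm.decomposeOption.symm.sum_comp, Fintype.sum_prod_type,
        Fintype.sum_option, add_mul, Finset.mul_sum]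
      congr 1
      · refine Finset.sum_congr rfl fun σ _ => ?_
        rw [Equiv.Perm.decomposeOption_symm_apply, Equiv.swap_self,
          show (Equiv.refl (Option J)) * Equiv.optionCongr σ = Equiv.optionCongr σ from rfl,
          cyc_optionCongr, pow_succ, mul_comm]
      · rw [Finset.sum_congr rfl fun i _ => Finset.sum_congr rfl fun σ _ => by
          rw [Equiv.Perm.decomposeOption_symm_apply, cyc_swap_mul_optionCongr]]
        simp
    rw [h, Fintype.card_option, pow_succ, mul_comm]
    gcongr
    · exact ih.trans (by gcongr; omega)
    · omega

end CycleSum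

/-! ### Nets controlling operator norms -/

section Net

open Module

/-- A finite subset of the ball of radius two that controls operator norms. -/
theorem exists_norming_finset (E : Type*) [NormedAddCommGroup E] [NormedSpace ℂ E]
    [FiniteDimensional ℂ E] :
    ∃ N : Finset E, N.card ≤ 25 ^ finrank ℂ E ∧ (∀ u ∈ N, ‖u‖ ≤ 2) ∧
      ∀ {F : Type} [NormedAddCommGroup F] [NormedSpace ℂ F] (T : E →L[ℂ] F),
        ∃ u ∈ N, ‖T‖ ≤ ‖T u‖ := by
  classical
  let : NormedSpace ℝ E := NormedSpace.restrictScalars ℝ ℂ E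
  have : FiniteDimensional ℝ E := FiniteDimensional.complexToReal E
  -- Sets that are `1`-separated in the ball of radius `2`. In real dimension `2n` they have at most
  -- `5 ^ (2n) = 25 ^ n` points, and one of maximal size is a `1`-net of the ball.
  let Good : Finset E → Prop := fun s =>
    (∀ c ∈ s, ‖c‖ ≤ 2) ∧ ∀ c ∈ s, ∀ d ∈ s, c ≠ d → 1 ≤ ‖c - d‖
  have hcard : ∀ s, Good s → s.card ≤ 25 ^ finrank ℂ E := by
    intro s hs
    have := Besicovitch.card_le_of_separated s hs.1 hs.2
    rw [finrank_real_of_complex, pow_mul] at this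
    exact this
  have hne : {k | ∃ s, Good s ∧ s.card = k}.Nonempty := ⟨0, ∅, by simp [Good], rfl⟩
  have hbd : BddAbove {k | ∃ s, Good s ∧ s.card = k} :=
    ⟨25 ^ finrank ℂ E, by rintro k ⟨s, hs, rfl⟩; exact hcard s hs⟩
  obtain ⟨N, hN, hk⟩ := Nat.sSup_mem hne hbd
  have hcov : ∀ v : E, ‖v‖ ≤ 2 → ∃ u ∈ N, ‖u - v‖ ≤ 1 := by
    intro v hv
    by_contra! h
    have hvN : v ∉ N := fun hm => by
      have := h v hm
      simp at this
      linarith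
    have hgood : Good (insert v N) := by
      refine ⟨fun c hc => ?_, fun c hc d hd hcd => ?_⟩
      · rcases Finset.mem_insert.1 hc with rfl | hc
        · exact hv
        · exact hN.1 c hc
      · rcases Finset.mem_insert.1 hc with rfl | hc' <;>
          rcases Finset.mem_insert.1 hd with rfl | hd'
        · exact absurd rfl hcd
        · rw [norm_sub_rev]; exact (h d hd').le
        · exact (h c hc').le
        · exact hN.2 c hc' d hd' hcd
    have := le_csSup hbd ⟨_, hgood, rfl⟩
    rw [Finset.card_insert_of_notMem hvN, ← hk] at this
    omega
  refine ⟨N, hcard N hN, hN.1, fun {F} _ _ T => ?_⟩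
  obtain ⟨u₀, hu₀, -⟩ := hcov 0 (by simp)
  obtain ⟨u, hu, hmax⟩ := N.exists_max_image (fun u => ‖T u‖) ⟨u₀, hu₀⟩
  refine ⟨u, hu, ?_⟩
  -- A vector rescaled to norm `2` is within `1` of the net. Hence `2‖T‖ ≤ ‖T u‖ + ‖T‖`, with no
  -- loss in the final constant.
  have hT : ‖T‖ ≤ (‖T u‖ + ‖T‖) / 2 := by
    refine T.opNorm_le_bound (by positivity) fun w => ?_
    rcases eq_or_ne w 0 with rfl | hw
    · simp
    have hw' : 0 < ‖w‖ := norm_pos_iff.2 hw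
    set c : ℂ := ((2 / ‖w‖ : ℝ) : ℂ) with hc
    have hcn : ‖c‖ = 2 / ‖w‖ := by
      rw [hc, Complex.norm_real, Real.norm_of_nonneg (by positivity)]
    obtain ⟨y, hy, hyw⟩ := hcov (c • w) (by
      rw [norm_smul, hcn, div_mul_cancel₀ _ hw'.ne'])
    have h1 : ‖T (c • w)‖ ≤ ‖T u‖ + ‖T‖ := by
      have h2 : T (c • w) = T y - T (y - c • w) := by rw [map_sub]; abel
      rw [h2]
      refine (norm_sub_le _ _).trans (add_le_add (hmax y hy) ?_)
      exact (T.le_opNorm _).trans (mul_le_of_le_one_right (norm_nonneg _) hyw)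
    rw [map_smul, norm_smul, hcn, div_mul_eq_mul_div, div_le_iff₀ hw'] at h1
    linarith
  linarith

end Net

/-! ### Wick expansions for a Gaussian square matrix -/

section Ginibre

variable {d : ℕ}

/-- The law of a square matrix with i.i.d. standard complex Gaussian entries. -/
noncomputable def ginibre (d : ℕ) : Measure (Fin d × Fin d → ℂ) :=
  Measure.pi fun _ => stdComplexGaussian

/-- The matrix with given entries, times its adjoint. -/
def gram (g : Fin d × Fin d → ℂ) : Matrix (Fin d) (Fin d) ℂ :=
  fun a a' => ∑ b, g (a, b) * star (g (a', b))

/-- The squared norm of the adjoint matrix applied to a vector. -/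
def adjointSq (u : Fin d → ℂ) (g : Fin d × Fin d → ℂ) : ℂ :=
  ∑ b, (∑ a, u a * star (g (a, b))) * (∑ a, star (u a) * g (a, b))

theorem integral_ginibre_prod {n : ℕ} (a b : Fin n → Fin d × Fin d) :
    ∫ g, ∏ j, (g (a j) * star (g (b j))) ∂(ginibre d) =
      ∑ σ : Equiv.Perm (Fin n), if ∀ j, a j = b (σ j) then 1 else 0 := by
  rw [ginibre, wick, Nat.card_eq_fintype_card, Fintype.card_subtype, Finset.card_filter]
  push_cast
  rfl

theorem natCard_invariant_eq_sum {n : ℕ} (σ : Equiv.Perm (Fin n)) :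
    ((d : ℂ) ^ cyc σ) = ∑ f : Fin n → Fin d, if ∀ j, f (σ j) = f j then 1 else 0 := by
  rw [Finset.sum_boole, ← Fintype.card_subtype, ← Nat.card_eq_fintype_card, natCard_invariant]
  push_cast
  rfl

/-- In Wick's formula the column labels must be invariant under `σ` and the row labels under `γ⁻¹ *
σ`; each contributes `d` per cycle. -/
theorem integral_trace_gram {n : ℕ} (hn : n ≠ 0) :
    Integrable (fun g => (gram g ^ n).trace) (ginibre d) ∧
    ∫ g, (gram g ^ n).trace ∂(ginibre d) =
      ∑ σ : Equiv.Perm (Fin n), (d : ℂ) ^ (cyc σ + cyc ((fullCycle n)⁻¹ * σ)) := by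
  obtain ⟨m, rfl⟩ := Nat.exists_eq_succ_of_ne_zero hn
  have h : ∀ g : Fin d × Fin d → ℂ, (gram g ^ (m + 1)).trace =
      ∑ a : Fin (m + 1) → Fin d, ∑ b : Fin (m + 1) → Fin d,
        ∏ j, (g (a j, b j) * star (g (a (finRotate (m + 1) j), b j))) := by
    intro g
    rw [trace_pow_succ]
    refine Finset.sum_congr rfl fun a _ => ?_
    simp only [gram]
    rw [Finset.prod_univ_sum, Fintype.piFinset_univ]
  have hi : ∀ a b : Fin (m + 1) → Fin d, Integrable (fun g : Fin d × Fin d → ℂ =>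
      ∏ j, (g (a j, b j) * star (g (a (finRotate (m + 1) j), b j)))) (ginibre d) :=
    fun a b => wick_integrable (fun j => (a j, b j)) fun j => (a (finRotate (m + 1) j), b j)
  simp_rw [h]
  refine ⟨integrable_finsetSum _ fun a _ => integrable_finsetSum _ fun b _ => hi a b, ?_⟩
  rw [integral_finsetSum _ fun a _ => integrable_finsetSum _ fun b _ => hi a b]
  simp_rw [integral_finsetSum Finset.univ fun b (_ : b ∈ Finset.univ) => hi _ b]
  have h2 : ∀ a b : Fin (m + 1) → Fin d, ∫ g : Fin d × Fin d → ℂ,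
      ∏ j, (g (a j, b j) * star (g (a (finRotate (m + 1) j), b j))) ∂(ginibre d) =
      ∑ σ : Equiv.Perm (Fin (m + 1)), (if ∀ j, b (σ j) = b j then 1 else 0) *
        (if ∀ j, a (((fullCycle (m + 1))⁻¹ * σ) j) = a j then 1 else 0) := by
    intro a b
    rw [integral_ginibre_prod (fun j => (a j, b j)) fun j => (a (finRotate (m + 1) j), b j)]
    refine Finset.sum_congr rfl fun σ _ => ?_
    rw [ite_zero_mul_ite_zero, one_mul]
    refine if_congr ?_ rfl rfl
    rw [fullCycle, inv_inv, ← forall_and]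
    refine forall_congr' fun j => ?_
    rw [Prod.mk.injEq, Equiv.Perm.mul_apply, and_comm, eq_comm, @eq_comm _ (a j)]
  simp_rw [h2]
  rw [Finset.sum_congr rfl fun a _ => Finset.sum_comm, Finset.sum_comm]
  refine Finset.sum_congr rfl fun σ _ => ?_
  rw [pow_add, natCard_invariant_eq_sum, natCard_invariant_eq_sum, Finset.sum_mul_sum,
    Finset.sum_comm]

/-- A Wick permutation forces `a' = a ∘ σ`, and reindexing the product removes `σ` from the factors
in `u`. Only the norm of `u` enters, as rotation invariance suggests. -/
theorem integral_adjointSq_pow (u : Fin d → ℂ) (n : ℕ) :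
    Integrable (fun g => adjointSq u g ^ n) (ginibre d) ∧
    ∫ g, adjointSq u g ^ n ∂(ginibre d) =
      (∑ a, u a * star (u a)) ^ n * ∑ σ : Equiv.Perm (Fin n), (d : ℂ) ^ cyc σ := by
  have h : ∀ g : Fin d × Fin d → ℂ, adjointSq u g ^ n =
      ∑ b : Fin n → Fin d, ∑ a : Fin n → Fin d, ∑ a' : Fin n → Fin d,
        (∏ j, u (a j) * star (u (a' j))) * ∏ j, (g (a' j, b j) * star (g (a j, b j))) := by
    intro g
    rw [← Fin.prod_const, adjointSq, Finset.prod_univ_sum, Fintype.piFinset_univ]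
    refine Finset.sum_congr rfl fun b _ => ?_
    rw [Finset.prod_mul_distrib, Finset.prod_univ_sum, Finset.prod_univ_sum,
      Fintype.piFinset_univ, Finset.sum_mul_sum]
    refine Finset.sum_congr rfl fun a _ => Finset.sum_congr rfl fun a' _ => ?_
    simp only [Finset.prod_mul_distrib]
    ring
  have hi : ∀ b a a' : Fin n → Fin d, Integrable (fun g : Fin d × Fin d → ℂ =>
      (∏ j, u (a j) * star (u (a' j))) * ∏ j, (g (a' j, b j) * star (g (a j, b j))))
      (ginibre d) :=
    fun b a a' => (wick_integrable (fun j => (a' j, b j)) fun j => (a j, b j)).const_mul _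
  simp_rw [h]
  refine ⟨integrable_finsetSum _ fun b _ => integrable_finsetSum _ fun a _ =>
    integrable_finsetSum _ fun a' _ => hi b a a', ?_⟩
  rw [integral_finsetSum _ fun b _ => integrable_finsetSum _ fun a _ =>
    integrable_finsetSum _ fun a' _ => hi b a a']
  simp_rw [integral_finsetSum Finset.univ fun a (_ : a ∈ Finset.univ) =>
    integrable_finsetSum Finset.univ fun a' _ => hi _ a a',
    integral_finsetSum Finset.univ fun a' (_ : a' ∈ Finset.univ) => hi _ _ a']
  have h2 : ∀ b a a' : Fin n → Fin d, ∫ g : Fin d × Fin d → ℂ,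
      (∏ j, u (a j) * star (u (a' j))) * ∏ j, (g (a' j, b j) * star (g (a j, b j)))
        ∂(ginibre d) =
      ∑ σ : Equiv.Perm (Fin n), (if ∀ j, b (σ j) = b j then 1 else 0) *
        ((∏ j, u (a j) * star (u (a' j))) * if a' = a ∘ σ then 1 else 0) := by
    intro b a a'
    rw [integral_const_mul, integral_ginibre_prod (fun j => (a' j, b j)) fun j => (a j, b j),
      Finset.mul_sum]
    refine Finset.sum_congr rfl fun σ _ => ?_
    rw [mul_left_comm, ite_zero_mul_ite_zero, one_mul]
    congr 1
    refine if_congr ?_ rfl rfl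
    rw [funext_iff, ← forall_and]
    refine forall_congr' fun j => ?_
    rw [Prod.mk.injEq, and_comm, eq_comm, Function.comp_apply]
  simp_rw [h2]
  have h3 : ∀ σ : Equiv.Perm (Fin n), ∑ b : Fin n → Fin d, ∑ a : Fin n → Fin d,
      ∑ a' : Fin n → Fin d, (if ∀ j, b (σ j) = b j then (1 : ℂ) else 0) *
        ((∏ j, u (a j) * star (u (a' j))) * if a' = a ∘ σ then 1 else 0) =
      (∑ a, u a * star (u a)) ^ n * (d : ℂ) ^ cyc σ := by
    intro σ
    simp_rw [← Finset.mul_sum]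
    rw [← Finset.sum_mul, ← natCard_invariant_eq_sum, mul_comm]
    congr 1
    rw [← Fin.prod_const, Finset.prod_univ_sum, Fintype.piFinset_univ]
    refine Finset.sum_congr rfl fun a _ => ?_
    simp only [mul_ite, mul_one, mul_zero, Finset.sum_ite_eq', Finset.mem_univ, if_true,
      Finset.prod_mul_distrib, Function.comp_apply]
    congr 1
    exact Equiv.prod_comp σ fun j => star (u (a j))
  rw [Finset.mul_sum, ← Finset.sum_congr rfl fun σ _ => h3 σ]
  symm
  rw [Finset.sum_comm]
  refine Finset.sum_congr rfl fun b _ => ?_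
  rw [Finset.sum_comm]
  refine Finset.sum_congr rfl fun a _ => ?_
  rw [Finset.sum_comm]

end Ginibre

/-! ### The trace of a Gram power bounded through a net -/

section
variable {d : ℕ}

/-- The operator of the adjoint of the matrix with given entries. -/
noncomputable def adjointOp (g : Fin d × Fin d → ℂ) :
    EuclideanSpace ℂ (Fin d) →L[ℂ] EuclideanSpace ℂ (Fin d) :=
  Matrix.toEuclideanCLM (𝕜 := ℂ) (n := Fin d) (Matrix.of fun a b => g (a, b)).conjTranspose

theorem adjointSq_eq (u : EuclideanSpace ℂ (Fin d)) (g : Fin d × Fin d → ℂ) :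
    adjointSq u g = ((‖adjointOp g u‖ ^ 2 : ℝ) : ℂ) := by
  rw [EuclideanSpace.norm_sq_eq, adjointSq, Complex.ofReal_sum]
  refine Finset.sum_congr rfl fun b _ => ?_
  have h1 : (adjointOp g u) b = ∑ a, u a * star (g (a, b)) := by
    rw [adjointOp, show u = WithLp.toLp 2 u.ofLp from rfl, Matrix.toEuclideanCLM_toLp]
    simp [Matrix.mulVec, dotProduct, mul_comm]
  have h2 : ∑ a, star (u a) * g (a, b) = star (∑ a, u a * star (g (a, b))) := by
    simp [star_sum]
  rw [h1, h2]
  rw [← Complex.normSq_eq_norm_sq]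
  exact Complex.mul_conj _

theorem isHermitian_gram (g : Fin d × Fin d → ℂ) : (gram g).IsHermitian := by
  ext a a'
  simp [gram, Matrix.conjTranspose_apply, mul_comm]

theorem eigenvalues_gram (g : Fin d × Fin d → ℂ) (k : Fin d) :
    (isHermitian_gram g).eigenvalues k =
      ‖adjointOp g ((isHermitian_gram g).eigenvectorBasis k)‖ ^ 2 := by
  rw [(isHermitian_gram g).eigenvalues_eq]
  set v := (isHermitian_gram g).eigenvectorBasis k
  have h : star v.ofLp ⬝ᵥ (gram g).mulVec v.ofLp = adjointSq v g := by
    have h1 : star v.ofLp ⬝ᵥ (gram g).mulVec v.ofLp =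
        ∑ a, ∑ a', ∑ b, (v a' * star (g (a', b))) * (star (v a) * g (a, b)) := by
      simp only [dotProduct, Matrix.mulVec, gram, Finset.mul_sum, Finset.sum_mul, Pi.star_apply]
      refine Finset.sum_congr rfl fun a _ => Finset.sum_congr rfl fun a' _ =>
        Finset.sum_congr rfl fun b _ => ?_
      ring
    rw [h1, adjointSq, Finset.sum_comm]
    simp_rw [Finset.sum_mul_sum]
    rw [Finset.sum_congr rfl fun a _ => Finset.sum_comm, Finset.sum_comm]
  rw [h, adjointSq_eq]
  exact Complex.ofReal_re _

/-- Each of the `d` eigenvalues is at most the squared operator norm, which some net vector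
dominates. Summing over the net makes the bound linear under expectation. -/
theorem re_trace_gram_le {n : ℕ} {N : Finset (EuclideanSpace ℂ (Fin d))}
    (hN : ∀ T : EuclideanSpace ℂ (Fin d) →L[ℂ] EuclideanSpace ℂ (Fin d), ∃ u ∈ N, ‖T‖ ≤ ‖T u‖)
    (g : Fin d × Fin d → ℂ) :
    ((gram g ^ n).trace).re ≤ d * ∑ u ∈ N, (adjointSq u g ^ n).re := by
  have h1 : ∀ u : EuclideanSpace ℂ (Fin d), (adjointSq u g ^ n).re = (‖adjointOp g u‖ ^ 2) ^ n := by
    intro u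
    rw [adjointSq_eq, ← Complex.ofReal_pow]
    exact Complex.ofReal_re _
  obtain ⟨u, hu, hle⟩ := hN (adjointOp g)
  rw [trace_pow_eq (isHermitian_gram g), Complex.ofReal_re]
  have h2 : ∀ k ∈ Finset.univ, (isHermitian_gram g).eigenvalues k ^ n ≤
      ∑ u ∈ N, (adjointSq u g ^ n).re := by
    intro k _
    refine le_trans ?_ (Finset.single_le_sum (f := fun u : EuclideanSpace ℂ (Fin d) =>
      (adjointSq u g ^ n).re) (fun v _ => by simp only [h1]; positivity) hu)
    simp only [h1]
    rw [eigenvalues_gram]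
    gcongr
    refine le_trans ((adjointOp g).le_opNorm _) ?_
    rw [(isHermitian_gram g).eigenvectorBasis.norm_eq_one, mul_one]
    exact hle
  refine (Finset.sum_le_sum h2).trans_eq ?_
  simp

/-- The left side is the expected trace of the `d`-th power of a `d × d` Gram matrix, so no
enumeration by genus is needed. The constant is `200 = 25 * 4 * 2`: size of the net, squared norm of
its vectors, and the bound `(2 * d) ^ d` on the cycle sum. -/
theorem sum_pow_cyc_add_cyc_le (hd : d ≠ 0) :
    (∑ σ : Equiv.Perm (Fin d), (d : ℝ) ^ (cyc σ + cyc ((fullCycle d)⁻¹ * σ))) ≤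
      200 ^ d * (d : ℝ) ^ (d + 1) := by
  obtain ⟨N, hcard, hnorm, hN⟩ := exists_norming_finset (EuclideanSpace ℂ (Fin d))
  obtain ⟨i1, e1⟩ := integral_trace_gram (d := d) hd
  have i2 := fun u : Fin d → ℂ => (integral_adjointSq_pow u d).1
  have e2 := fun u : Fin d → ℂ => (integral_adjointSq_pow u d).2
  have h1 : (∑ σ : Equiv.Perm (Fin d), (d : ℝ) ^ (cyc σ + cyc ((fullCycle d)⁻¹ * σ))) =
      ∫ g, ((gram g ^ d).trace).re ∂(ginibre d) := by
    have := integral_re i1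
    simp only [RCLike.re_eq_complex_re] at this
    rw [this, e1]
    norm_cast
  have i3 : ∀ u ∈ N, Integrable (fun g => (adjointSq u g ^ d).re) (ginibre d) :=
    fun u _ => (i2 u).re
  have h2 : ∀ u ∈ N, ∫ g, (adjointSq u g ^ d).re ∂(ginibre d) ≤ 4 ^ d * (2 * d) ^ d := by
    intro u hu
    have := integral_re (i2 u)
    simp only [RCLike.re_eq_complex_re] at this
    rw [this, e2]
    have h3 : ∑ a, u a * star (u a) = ((‖u‖ ^ 2 : ℝ) : ℂ) := by
      rw [EuclideanSpace.norm_sq_eq, Complex.ofReal_sum]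
      refine Finset.sum_congr rfl fun a _ => ?_
      rw [← Complex.normSq_eq_norm_sq]
      exact Complex.mul_conj _
    have h4 : (∑ σ : Equiv.Perm (Fin d), (d : ℂ) ^ cyc σ) =
        ((∑ σ : Equiv.Perm (Fin d), d ^ cyc σ : ℕ) : ℂ) := by push_cast; rfl
    rw [h3, h4, ← Complex.ofReal_pow, ← Complex.ofReal_natCast, ← Complex.ofReal_mul,
      Complex.ofReal_re]
    have h5 := sum_pow_cyc_le d (Fin d)
    rw [Fintype.card_fin, ← two_mul] at h5
    have h6 : ((∑ σ : Equiv.Perm (Fin d), d ^ cyc σ : ℕ) : ℝ) ≤ (2 * d) ^ d := by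
      exact_mod_cast h5
    have h7 : ‖u‖ ^ 2 ≤ 4 := by
      have := hnorm u hu
      nlinarith [norm_nonneg u]
    gcongr
  rw [h1]
  calc ∫ g, ((gram g ^ d).trace).re ∂(ginibre d)
      ≤ ∫ g, d * ∑ u ∈ N, (adjointSq u g ^ d).re ∂(ginibre d) := by
        refine integral_mono i1.re ?_ fun g => re_trace_gram_le hN g
        exact (integrable_finsetSum _ i3).const_mul _
    _ = d * ∑ u ∈ N, ∫ g, (adjointSq u g ^ d).re ∂(ginibre d) := by
        rw [integral_const_mul, integral_finsetSum _ i3]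
    _ ≤ d * ∑ _u ∈ N, (4 ^ d * (2 * d) ^ d : ℝ) := by
        exact mul_le_mul_of_nonneg_left (Finset.sum_le_sum h2) (Nat.cast_nonneg d)
    _ ≤ (d : ℝ) * (25 ^ d * (4 ^ d * (2 * d) ^ d)) := by
        rw [Finset.sum_const, nsmul_eq_mul]
        refine mul_le_mul_of_nonneg_left (mul_le_mul_of_nonneg_right ?_ (by positivity))
          (Nat.cast_nonneg d)
        · rw [finrank_euclideanSpace_fin] at hcard
          exact_mod_cast hcard
    _ = 200 ^ d * (d : ℝ) ^ (d + 1) := by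
        rw [show (200 : ℝ) = 25 * (4 * 2) by norm_num, mul_pow, mul_pow, mul_pow, pow_succ]
        ring

end

/-! ### Exponential bound on the partition function -/

section PartitionSum

variable {V Eb Ed : Type*} [Fintype V] [DecidableEq V] [Fintype Eb] [DecidableEq Eb]
  [Fintype Ed] [DecidableEq Ed] [Nonempty Ed]

/-- The deviation of `σ` from a geodesic and its two cycle counts add up to `d + 1`, which reduces
this to the Gram moment. It is the weight of a vertex on a path. -/
theorem sum_inv_pow_geodesic_le {d : ℕ} (hd : d ≠ 0) :
    ∑ σ : Equiv.Perm (Fin d), ((d : ℝ) ^ (len σ + len (σ⁻¹ * fullCycle d) - (d - 1)))⁻¹ ≤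
      200 ^ d := by
  have hd' : (0 : ℝ) < d := by exact_mod_cast Nat.pos_of_ne_zero hd
  have h1 : ∀ σ : Equiv.Perm (Fin d),
      ((d : ℝ) ^ (len σ + len (σ⁻¹ * fullCycle d) - (d - 1)))⁻¹ =
      (d : ℝ) ^ (cyc σ + cyc ((fullCycle d)⁻¹ * σ)) * ((d : ℝ) ^ (d + 1))⁻¹ := by
    intro σ
    have a1 := len_add_cyc σ
    have a2 := len_add_cyc ((fullCycle d)⁻¹ * σ)
    rw [← len_inv_mul_comm] at a2
    have a3 := len_mul_le σ (σ⁻¹ * fullCycle d)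
    rw [mul_inv_cancel_left, len_fullCycle] at a3
    rw [Nat.card_fin] at a1 a2
    have a4 : cyc σ + cyc ((fullCycle d)⁻¹ * σ) +
        (len σ + len (σ⁻¹ * fullCycle d) - (d - 1)) = d + 1 := by omega
    rw [← a4, pow_add (d : ℝ) (cyc σ + _), mul_inv, ← mul_assoc, mul_inv_cancel₀ (by positivity),
      one_mul]
  rw [Finset.sum_congr rfl fun σ _ => h1 σ, ← Finset.sum_mul, ← div_eq_mul_inv,
    div_le_iff₀ (by positivity)]
  exact sum_pow_cyc_add_cyc_le hd

/-- The weight of a vertex off the paths. The bound `2 ^ d` would do; `200 ^ d` is kept so that all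
vertices share one constant. -/
theorem sum_inv_pow_len_le {d : ℕ} (hd : d ≠ 0) :
    ∑ σ : Equiv.Perm (Fin d), ((d : ℝ) ^ len σ)⁻¹ ≤ 200 ^ d := by
  have hd' : (0 : ℝ) < d := by exact_mod_cast Nat.pos_of_ne_zero hd
  have h1 : ∀ σ : Equiv.Perm (Fin d), ((d : ℝ) ^ len σ)⁻¹ = (d : ℝ) ^ cyc σ * ((d : ℝ) ^ d)⁻¹ := by
    intro σ
    have a1 := len_add_cyc σ
    rw [Nat.card_fin] at a1
    have a2 : (d : ℝ) ^ d = (d : ℝ) ^ len σ * (d : ℝ) ^ cyc σ := by rw [← pow_add, a1]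
    rw [a2, mul_inv_rev, ← mul_assoc, mul_inv_cancel₀ (by positivity), one_mul]
  rw [Finset.sum_congr rfl fun σ _ => h1 σ, ← Finset.sum_mul, ← div_eq_mul_inv,
    div_le_iff₀ (by positivity), ← mul_pow]
  have h2 := sum_pow_cyc_le d (Fin d)
  rw [Fintype.card_fin, ← two_mul] at h2
  calc _ ≤ ((2 * d : ℝ)) ^ d := by exact_mod_cast h2
    _ ≤ _ := by gcongr; norm_num

/-- The partition function grows at most exponentially in the size of the permutations, as long
as that size is at most a small power of the bond dimension. -/
theorem exists_partitionSum_le (G : OpenGraph V Eb Ed) (hG : G.BulkConnected) (A : Finset Ed) :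
    ∃ K : ℕ, ∀ d D : ℕ, d ≠ 0 → d ^ K ≤ D →
      G.partitionSum A (fullCycle d) D ≤ (200 ^ Fintype.card V) ^ d := by
  classical
  obtain ⟨P, r, K, hr, hsk⟩ := G.exists_skeleton hG A
  -- Each vertex has a defect of at most `K + 1` times the excess; summed over `V` this gives the
  -- power of `d` that `D` has to dominate.
  refine ⟨Fintype.card V * (K + 1), fun d D hd hD => ?_⟩
  have hd1 : (1 : ℝ) ≤ d := by exact_mod_cast Nat.one_le_iff_ne_zero.2 hd
  let w : V → Equiv.Perm (Fin d) → ℝ := fun x σ =>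
    if x ∈ P then ((d : ℝ) ^ (len σ + len (σ⁻¹ * fullCycle d) - (d - 1)))⁻¹
    else ((d : ℝ) ^ len σ)⁻¹
  -- Vertices off the paths are recorded relative to their roots. Roots are the source, the sink or
  -- vertices in `P`, where nothing changes, so the substitution is injective and decouples the sum
  -- over vertices.
  let β : (V → Equiv.Perm (Fin d)) → V → Equiv.Perm (Fin d) := fun α x =>
    if x ∈ P then α x else (α x)⁻¹ * extPerm (fullCycle d) α (r x)
  have hβ : Function.Injective β := by
    intro α α' h
    have hP : ∀ x ∈ P, α x = α' x := fun x hx => by simpa [β, hx] using congrFun h x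
    have hext : ∀ x, extPerm (fullCycle d) α (r x) = extPerm (fullCycle d) α' (r x) := by
      intro x
      rcases hr x with h1 | h1 | ⟨y, hy, h1⟩
      · rw [h1]; rfl
      · rw [h1]; rfl
      · rw [h1]; exact hP y hy
    funext x
    by_cases hx : x ∈ P
    · exact hP x hx
    · have := congrFun h x
      simpa [β, hx, hext x] using this
  have hw : ∀ x σ, 0 ≤ w x σ := fun x σ => by
    simp only [w]
    split_ifs <;> positivity
  have hterm : ∀ α : V → Equiv.Perm (Fin d),
      ((D : ℝ) ^ G.excess A (fullCycle d) α)⁻¹ ≤ ∏ x, w x (β α x) := by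
    intro α
    obtain ⟨-, hP, hK⟩ := hsk (Fin d) (fullCycle d) α
    let δ : V → ℕ := fun x =>
      if x ∈ P then len (β α x) + len ((β α x)⁻¹ * fullCycle d) - (d - 1) else len (β α x)
    have hδ : ∀ x ∈ Finset.univ, δ x ≤ (K + 1) * G.excess A (fullCycle d) α := by
      intro x _
      by_cases hx : x ∈ P
      · have := hP x hx
        rw [len_fullCycle] at this
        simp only [δ, β, hx, if_true]
        rw [add_mul, one_mul, OpenGraph.excess, len_fullCycle]
        omega
      · simp only [δ, β, hx, if_false]
        rw [add_mul, one_mul]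
        exact (hK x).trans (Nat.le_add_right _ _)
    have hsum := Finset.sum_le_sum hδ
    rw [Finset.sum_const, Finset.card_univ, smul_eq_mul, ← mul_assoc] at hsum
    have hprod : ∏ x, w x (β α x) = ((d : ℝ) ^ ∑ x, δ x)⁻¹ := by
      rw [← Finset.prod_pow_eq_pow_sum, ← Finset.prod_inv_distrib]
      refine Finset.prod_congr rfl fun x _ => ?_
      by_cases hx : x ∈ P <;> simp [w, δ, hx]
    rw [hprod]
    refine inv_anti₀ (by positivity) ?_
    calc (d : ℝ) ^ ∑ x, δ x
        ≤ (d : ℝ) ^ (Fintype.card V * (K + 1) * G.excess A (fullCycle d) α) :=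
          pow_le_pow_right₀ hd1 hsum
      _ = ((d : ℝ) ^ (Fintype.card V * (K + 1))) ^ G.excess A (fullCycle d) α := pow_mul _ _ _
      _ ≤ _ := by
          gcongr
          exact_mod_cast hD
  calc G.partitionSum A (fullCycle d) D
      ≤ ∑ α : V → Equiv.Perm (Fin d), ∏ x, w x (β α x) := Finset.sum_le_sum fun α _ => hterm α
    _ ≤ ∑ α : V → Equiv.Perm (Fin d), ∏ x, w x (α x) := by
        rw [← Finset.sum_image (s := Finset.univ) (g := β)
          (f := fun α => ∏ x, w x (α x)) fun a _ b _ h => hβ h]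
        exact Finset.sum_le_sum_of_subset_of_nonneg (Finset.subset_univ _)
          fun α _ _ => Finset.prod_nonneg fun x _ => hw x _
    _ = ∏ x, ∑ σ, w x σ := by
        rw [Finset.prod_univ_sum, Fintype.piFinset_univ]
    _ ≤ ∏ _x : V, (200 : ℝ) ^ d := by
        refine Finset.prod_le_prod (fun x _ => Finset.sum_nonneg fun σ _ => hw x σ) fun x _ => ?_
        by_cases hx : x ∈ P
        · simp only [w, hx, if_true]
          exact sum_inv_pow_geodesic_le hd
        · simp only [w, hx, if_false]
          exact sum_inv_pow_len_le hd
    _ = (200 ^ Fintype.card V) ^ d := by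
        rw [Finset.prod_const, Finset.card_univ, ← pow_mul, ← pow_mul, mul_comm]

end PartitionSum

/-! ### The rank of the reduced state -/

section

variable {V Eb Ed : Type*} [Fintype V] [DecidableEq V] [Fintype Eb] [DecidableEq Eb]
  [Fintype Ed] [DecidableEq Ed]

/-- The state as a matrix between the two boundary regions. -/
noncomputable def OpenGraph.stateMatrix (G : OpenGraph V Eb Ed) (A : Finset Ed) (D : ℕ)
    (g : G.Tensors D) : Matrix ({e // e ∈ A} → Fin D) ({e // e ∉ A} → Fin D) ℂ :=
  fun a b => G.state D g (glue A a b)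

theorem reducedState_eq (G : OpenGraph V Eb Ed) (A : Finset Ed) (D : ℕ) (g : G.Tensors D) :
    G.reducedState A D g = G.stateMatrix A D g * (G.stateMatrix A D g).conjTranspose := by
  ext a a'
  rw [Matrix.mul_apply]
  rfl

open scoped ComplexOrder in
theorem rank_reducedState (G : OpenGraph V Eb Ed) (A : Finset Ed) (D : ℕ) (g : G.Tensors D) :
    (G.reducedState A D g).rank = (G.stateMatrix A D g).rank := by
  rw [reducedState_eq, Matrix.rank_self_mul_conjTranspose]

/-- The edge to which a leg belongs. -/
def legEdge : (Eb × Bool) ⊕ Ed → Eb ⊕ Ed := Sum.map Prod.fst id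

/-- The labels of the legs at `x` given by a labelling of the edges. -/
def OpenGraph.edgeLabel (G : OpenGraph V Eb Ed) {D : ℕ} (w : Eb ⊕ Ed → Fin D) (x : V) :
    G.Leg x → Fin D :=
  fun l => w (legEdge l.1)

theorem legLabel_eq_edgeLabel (G : OpenGraph V Eb Ed) {D : ℕ} (k : Eb → Fin D) (i : Ed → Fin D)
    (x : V) : G.legLabel k i x = G.edgeLabel (Sum.elim k i) x := by
  ext ⟨l, hl⟩
  rcases l with ⟨e, c⟩ | e <;> rfl

theorem exists_ends_eq_of_leg (G : OpenGraph V Eb Ed) (A : Finset Ed) {x : V} (l : G.Leg x) :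
    ∃ b, G.ends A (legEdge l.1) b = .bulk x := by
  obtain ⟨l, hl⟩ := l
  rcases l with ⟨e, c⟩ | e
  · exact ⟨c, congrArg NetVertex.bulk hl⟩
  · have hl' : G.bdryEnd e = x := hl
    by_cases h : e ∈ A
    · exact ⟨false, by simp [legEdge, OpenGraph.ends, h, hl']⟩
    · exact ⟨true, by simp [legEdge, OpenGraph.ends, h, hl']⟩

theorem state_eq_sum_edgeLabel (G : OpenGraph V Eb Ed) (D : ℕ) (g : G.Tensors D)
    (i : Ed → Fin D) :
    G.state D g i = ((1 / Real.sqrt D : ℝ) : ℂ) ^ Fintype.card Eb *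
      ∑ w : Eb ⊕ Ed → Fin D, (if ∀ e, w (Sum.inr e) = i e then 1 else 0) *
        ∏ x, g x (G.edgeLabel w x) := by
  rw [state_eq]
  congr 1
  refine Fintype.sum_of_injective (fun k => Sum.elim k i)
    (fun k k' h => funext fun e => congrFun h (Sum.inl e)) _ _ (fun w hw => ?_) (fun k => ?_)
  · rw [if_neg, zero_mul]
    intro h
    refine hw ⟨fun e => w (Sum.inl e), ?_⟩
    ext (e | e)
    · rfl
    · exact congrArg Fin.val (h e).symm
  · simp [legLabel_eq_edgeLabel]

/-- With the labels on the cut edges fixed, the contractions on the two sides are independent. So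
the state matrix factors through the space of cut labellings. -/
theorem rank_stateMatrix_le_of_cut (G : OpenGraph V Eb Ed) (A : Finset Ed) (D : ℕ) [NeZero D]
    (g : G.Tensors D) (S : NetVertex V → Bool) (hs : S .source = true) (ht : S .sink = false) :
    (G.stateMatrix A D g).rank ≤
      D ^ (Finset.univ.filter fun e => S (G.ends A e false) ≠ S (G.ends A e true)).card := by
  classical
  let C : Eb ⊕ Ed → Prop := fun e => S (G.ends A e false) ≠ S (G.ends A e true)
  let I : {e // ¬C e} → Prop := fun e => S (G.ends A e.1 false) = true
  -- `join` assembles a labelling from its values `s` on cut edges, `t₁` on the source side and `t₀`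
  -- on the sink side.
  obtain ⟨join, hsum, hj₁, hj₀⟩ : ∃ join : ({e // C e} → Fin D) ×
      (({e // I e} → Fin D) × ({e // ¬I e} → Fin D)) → Eb ⊕ Ed → Fin D,
      (∀ f : (Eb ⊕ Ed → Fin D) → ℂ, ∑ w, f w = ∑ s, ∑ t₁, ∑ t₀, f (join (s, t₁, t₀))) ∧
      (∀ s t₁ t₀ t₀' e, (S (G.ends A e false) = true ∨ S (G.ends A e true) = true) →
        join (s, t₁, t₀) e = join (s, t₁, t₀') e) ∧
      (∀ s t₁ t₁' t₀ e, (S (G.ends A e false) = false ∨ S (G.ends A e true) = false) →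
        join (s, t₁, t₀) e = join (s, t₁', t₀) e) := by
    refine ⟨fun p => (Equiv.piEquivPiSubtypeProd C fun _ => Fin D).symm
      (p.1, (Equiv.piEquivPiSubtypeProd I fun _ => Fin D).symm p.2), ?_, ?_, ?_⟩
    · intro f
      rw [← (Equiv.piEquivPiSubtypeProd C fun _ => Fin D).symm.sum_comp, Fintype.sum_prod_type]
      refine Finset.sum_congr rfl fun s _ => ?_
      rw [← (Equiv.piEquivPiSubtypeProd I fun _ => Fin D).symm.sum_comp, Fintype.sum_prod_type]
    · intro s t₁ t₀ t₀' e he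
      by_cases hC : C e
      · simp [Equiv.piEquivPiSubtypeProd, hC]
      · have hI : I ⟨e, hC⟩ := by
          simp only [C, not_not] at hC
          simp only [I]
          rcases he with he | he
          · exact he
          · rw [hC, he]
        simp [Equiv.piEquivPiSubtypeProd, hC, hI]
    · intro s t₁ t₁' t₀ e he
      by_cases hC : C e
      · simp [Equiv.piEquivPiSubtypeProd, hC]
      · have hI : ¬I ⟨e, hC⟩ := by
          simp only [C, not_not] at hC
          simp only [I]
          rcases he with he | he
          · simp [he]
          · rw [hC, he]; simp
        simp [Equiv.piEquivPiSubtypeProd, hC, hI]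
  have hends : ∀ (c : Bool) (x : V), S (.bulk x) = c → ∀ l : G.Leg x,
      S (G.ends A (legEdge l.1) false) = c ∨ S (G.ends A (legEdge l.1) true) = c := by
    intro c x hx l
    obtain ⟨b, hb⟩ := exists_ends_eq_of_leg G A l
    cases b
    · exact Or.inl (by rw [hb, hx])
    · exact Or.inr (by rw [hb, hx])
  let Q₀ : (Eb ⊕ Ed → Fin D) → ({e // e ∈ A} → Fin D) → ℂ := fun w a =>
    (if ∀ e : {e // e ∈ A}, w (Sum.inr e.1) = a e then 1 else 0) *
      ∏ x with ¬S (.bulk x) = true, g x (G.edgeLabel w x)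
  let Q₁ : (Eb ⊕ Ed → Fin D) → ({e // e ∉ A} → Fin D) → ℂ := fun w b =>
    (if ∀ e : {e // e ∉ A}, w (Sum.inr e.1) = b e then 1 else 0) *
      ∏ x with S (.bulk x) = true, g x (G.edgeLabel w x)
  have hQ₀ : ∀ s t₁ t₁' t₀ a, Q₀ (join (s, t₁, t₀)) a = Q₀ (join (s, t₁', t₀)) a := by
    intro s t₁ t₁' t₀ a
    simp only [Q₀]
    congr 1
    · refine if_congr (forall_congr' fun e => ?_) rfl rfl
      rw [hj₀ s t₁ t₁' t₀ _ (Or.inr (by simp [OpenGraph.ends, e.2, ht]))]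
    · refine Finset.prod_congr rfl fun x hx => congrArg _ (funext fun l => ?_)
      have hx' : S (.bulk x) = false := by simpa using hx
      exact hj₀ s t₁ t₁' t₀ _ (hends false x hx' l)
  have hQ₁ : ∀ s t₁ t₀ t₀' b, Q₁ (join (s, t₁, t₀)) b = Q₁ (join (s, t₁, t₀')) b := by
    intro s t₁ t₀ t₀' b
    simp only [Q₁]
    congr 1
    · refine if_congr (forall_congr' fun e => ?_) rfl rfl
      rw [hj₁ s t₁ t₀ t₀' _ (Or.inl (by simp [OpenGraph.ends, e.2, hs]))]
    · refine Finset.prod_congr rfl fun x hx => congrArg _ (funext fun l => ?_)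
      have hx' : S (.bulk x) = true := by simpa using hx
      exact hj₁ s t₁ t₀ t₀' _ (hends true x hx' l)
  let L : Matrix ({e // e ∈ A} → Fin D) ({e // C e} → Fin D) ℂ := fun a s =>
    ((1 / Real.sqrt D : ℝ) : ℂ) ^ Fintype.card Eb * ∑ t₀, Q₀ (join (s, 0, t₀)) a
  let R : Matrix ({e // C e} → Fin D) ({e // e ∉ A} → Fin D) ℂ := fun s b =>
    ∑ t₁, Q₁ (join (s, t₁, 0)) b
  have hLR : G.stateMatrix A D g = L * R := by
    ext a b
    rw [OpenGraph.stateMatrix, state_eq_sum_edgeLabel, hsum, Matrix.mul_apply, Finset.mul_sum]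
    refine Finset.sum_congr rfl fun s _ => ?_
    simp only [L, R]
    rw [mul_assoc, mul_comm (∑ t₀, _), Finset.sum_mul_sum]
    refine congrArg (_ * ·) (Finset.sum_congr rfl fun t₁ _ => Finset.sum_congr rfl fun t₀ _ => ?_)
    rw [hQ₀ s 0 t₁ t₀ a, hQ₁ s t₁ 0 t₀ b]
    simp only [Q₀, Q₁]
    rw [mul_mul_mul_comm, ite_zero_mul_ite_zero, one_mul,
      Finset.prod_filter_mul_prod_filter_not]
    congr 1
    refine if_congr ?_ rfl rfl
    constructor
    · intro h
      exact ⟨fun e => by rw [h e.1]; simp [glue, e.2], fun e => by rw [h e.1]; simp [glue, e.2]⟩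
    · rintro ⟨h1, h2⟩ e
      by_cases he : e ∈ A
      · rw [h2 ⟨e, he⟩]; simp [glue, he]
      · rw [h1 ⟨e, he⟩]; simp [glue, he]
  rw [hLR]
  refine (Matrix.rank_mul_le_left _ _).trans ((Matrix.rank_le_card_width _).trans_eq ?_)
  rw [Fintype.card_fun, Fintype.card_fin, Fintype.card_subtype]

/-- The rank of the reduced state is at most `D ^ F`. -/
theorem rank_reducedState_le [Nonempty Ed] (G : OpenGraph V Eb Ed) (A : Finset Ed) (D : ℕ)
    (g : G.Tensors D) : (G.reducedState A D g).rank ≤ D ^ G.maxflow A := by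
  -- For `D = 0` a half-edge has no labels, so either there are no entries or each entry is an empty
  -- sum.
  rcases Nat.eq_zero_or_pos D with rfl | hD
  · obtain ⟨e⟩ := ‹Nonempty Ed›
    have : G.reducedState A 0 g = 0 := by
      ext a a'
      by_cases he : e ∈ A
      · exact (a ⟨e, he⟩).elim0
      · exact Finset.sum_eq_zero fun b _ => (b ⟨e, he⟩).elim0
    rw [this, Matrix.rank_zero]
    exact Nat.zero_le _
  · have : NeZero D := ⟨hD.ne'⟩
    obtain ⟨S, hs, ht, hc⟩ := G.exists_minCut A
    rw [rank_reducedState, ← hc]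
    exact rank_stateMatrix_le_of_cut G A D g S hs ht

end

/-! ### Functions that vanish almost nowhere -/

section Generic

variable {ι : Type*} [Fintype ι] [DecidableEq ι] {X : ι → Type*} [∀ i, MeasurableSpace (X i)]

/-- Resampling one coordinate independently preserves the product law, which permits null-set
arguments one coordinate at a time. -/
theorem measurePreserving_update (μ : ∀ i, Measure (X i)) [∀ i, IsProbabilityMeasure (μ i)]
    (i : ι) : MeasurePreserving (fun p : (∀ j, X j) × X i => Function.update p.1 i p.2)
      ((Measure.pi μ).prod (μ i)) (Measure.pi μ) := by
  have hm : Measurable (fun p : (∀ j, X j) × X i => Function.update p.1 i p.2) := by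
    rw [measurable_pi_iff]
    intro j
    by_cases hj : j = i
    · subst hj; simpa using measurable_snd
    · simp only [Function.update_of_ne hj]
      exact (measurable_pi_apply j).comp measurable_fst
  refine ⟨hm, (Measure.pi_eq fun s hs => ?_).symm⟩
  rw [Measure.map_apply hm (MeasurableSet.univ_pi hs)]
  have h : (fun p : (∀ j, X j) × X i => Function.update p.1 i p.2) ⁻¹' Set.univ.pi s =
      (Set.univ.pi (Function.update s i Set.univ)) ×ˢ s i := by
    ext ⟨g, t⟩
    simp only [Set.mem_preimage, Set.mem_univ_pi, Set.mem_prod]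
    constructor
    · intro hp
      refine ⟨fun j => ?_, by simpa using hp i⟩
      by_cases hj : j = i
      · subst hj; simp
      · simpa [hj] using hp j
    · rintro ⟨h1, h2⟩ j
      by_cases hj : j = i
      · subst hj; simpa using h2
      · simpa [hj] using h1 j
  rw [h, Measure.prod_prod, Measure.pi_pi, ← Finset.prod_erase_mul _ _ (Finset.mem_univ i),
    ← Finset.prod_erase_mul Finset.univ (fun j => μ j (s j)) (Finset.mem_univ i)]
  simp only [Function.update_self, measure_univ, mul_one]
  congr 1
  refine Finset.prod_congr rfl fun j hj => ?_
  rw [Function.update_of_ne (Finset.ne_of_mem_erase hj)]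

/-- A function on a product space that is nonzero somewhere is nonzero almost everywhere, provided
that this holds in every coordinate direction. -/
theorem ae_ne_zero_pi (μ : ∀ i, Measure (X i)) [∀ i, IsProbabilityMeasure (μ i)]
    {f : (∀ i, X i) → ℂ} (hf : Measurable f)
    (h : ∀ g i, f g ≠ 0 → ∀ᵐ t ∂μ i, f (Function.update g i t) ≠ 0)
    {g₀ : ∀ i, X i} (h₀ : f g₀ ≠ 0) : ∀ᵐ g ∂Measure.pi μ, f g ≠ 0 := by
  -- The coordinates of the good point `g₀` are replaced by random ones, one at a time.
  have key : ∀ s : Finset ι, ∀ᵐ g ∂Measure.pi μ, f (s.piecewise g g₀) ≠ 0 := by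
    intro s
    induction s using Finset.induction_on with
    | empty => exact Filter.Eventually.of_forall fun g => by rwa [Finset.piecewise_empty]
    | insert i s hi ih =>
      have hmeas : Measurable fun g : ∀ i, X i => f ((insert i s).piecewise g g₀) := by
        refine hf.comp (measurable_pi_iff.2 fun j => ?_)
        by_cases hj : j ∈ insert i s
        · simpa [Finset.piecewise, hj] using measurable_pi_apply j
        · simp [Finset.piecewise, hj]
      have hset : MeasurableSet {g : ∀ i, X i | f ((insert i s).piecewise g g₀) ≠ 0} :=
        hmeas (measurableSet_singleton (0 : ℂ)).compl
      have hp := measurePreserving_update μ i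
      rw [← hp.map_eq, ae_map_iff hp.measurable.aemeasurable hset]
      have hset' := hp.measurable hset
      refine (Measure.ae_prod_iff_ae_ae hset').2 ?_
      filter_upwards [ih] with g hg
      filter_upwards [h _ i hg] with t ht
      convert ht using 2
      ext j
      by_cases hj : j = i
      · subst hj; simp
      · by_cases hs : j ∈ s <;> simp [Finset.piecewise, hj, hs]
  simpa using key Finset.univ

end Generic

theorem ae_eval_ne_zero {q : Polynomial ℂ} (hq : q ≠ 0) :
    ∀ᵐ t ∂stdComplexGaussian, q.eval t ≠ 0 := by
  have h : {t | q.eval t = 0}.Finite := by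
    refine q.roots.toFinset.finite_toSet.subset fun t ht => ?_
    simpa [hq] using ht
  rw [ae_iff]
  simpa using h.measure_zero _

section

variable {V Eb Ed : Type*} [Fintype V] [DecidableEq V] [Fintype Eb] [DecidableEq Eb]
  [Fintype Ed] [DecidableEq Ed]

/-- A minor of the state matrix as a function of the coordinates in a commutative ring. -/
noncomputable def OpenGraph.minor (G : OpenGraph V Eb Ed) {A : Finset Ed} {D : ℕ} {K S : Type*}
    [Fintype K] [DecidableEq K] [CommRing S] (c : S) (ra : K → {e // e ∈ A} → Fin D)
    (rb : K → {e // e ∉ A} → Fin D) (g : (x : V) → (G.Leg x → Fin D) → S) : S :=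
  Matrix.det (Matrix.of fun s s' : K => c * ∑ k : Eb → Fin D, ∏ x,
    g x (G.legLabel k (glue A (ra s) (rb s')) x))

/-- Minors are taken over any commutative ring so that one entry can be made the variable of a
polynomial ring and evaluated afterwards. -/
theorem map_minor (G : OpenGraph V Eb Ed) {A : Finset Ed} {D : ℕ} {K S T : Type*} [Fintype K]
    [DecidableEq K] [CommRing S] [CommRing T] (φ : S →+* T) (c : S)
    (ra : K → {e // e ∈ A} → Fin D) (rb : K → {e // e ∉ A} → Fin D)
    (g : (x : V) → (G.Leg x → Fin D) → S) :
    φ (G.minor c ra rb g) = G.minor (φ c) ra rb fun x l => φ (g x l) := by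
  rw [OpenGraph.minor, OpenGraph.minor, RingHom.map_det]
  congr 1
  ext s s'
  simp [map_sum, map_prod]

theorem minor_eq_det (G : OpenGraph V Eb Ed) {A : Finset Ed} {D : ℕ} {K : Type*} [Fintype K]
    [DecidableEq K] (ra : K → {e // e ∈ A} → Fin D) (rb : K → {e // e ∉ A} → Fin D)
    (g : G.Tensors D) :
    G.minor (((1 / Real.sqrt D : ℝ) : ℂ) ^ Fintype.card Eb) ra rb g =
      ((G.stateMatrix A D g).submatrix ra rb).det := by
  rw [OpenGraph.minor]
  congr 1
  ext s s'
  rw [Matrix.of_apply, Matrix.submatrix_apply, OpenGraph.stateMatrix, state_eq]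

/-- A minor that is nonzero for some tensors is nonzero almost surely. -/
theorem ae_minor_ne_zero (G : OpenGraph V Eb Ed) {A : Finset Ed} {D : ℕ} {K : Type*} [Fintype K]
    [DecidableEq K] (c : ℂ) (ra : K → {e // e ∈ A} → Fin D) (rb : K → {e // e ∉ A} → Fin D)
    {g₀ : G.Tensors D} (h₀ : G.minor c ra rb g₀ ≠ 0) :
    ∀ᵐ g ∂(G.tensorLaw D), G.minor c ra rb g ≠ 0 := by
  classical
  have hcont : Continuous fun g : G.Tensors D => G.minor c ra rb g := by
    unfold OpenGraph.minor
    refine Continuous.matrix_det (continuous_matrix fun s s' => ?_)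
    fun_prop
  have hmeas : Measurable fun g : G.Tensors D => G.minor c ra rb g := hcont.measurable
  refine ae_ne_zero_pi _ hmeas (fun g x hg => ?_) h₀
  refine ae_ne_zero_pi (f := fun t => G.minor c ra rb (Function.update g x t))
    (g₀ := g x) _ ?_ (fun t l ht => ?_) (by simpa using hg)
  · exact hmeas.comp (measurable_update g)
  · let g' : (y : V) → (G.Leg y → Fin D) → Polynomial ℂ := fun y l' =>
      if h : y = x then (if h ▸ l' = l then Polynomial.X else Polynomial.C (t (h ▸ l')))
      else Polynomial.C (g y l')
    let q : Polynomial ℂ := G.minor (Polynomial.C c) ra rb g'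
    have hq : ∀ z, q.eval z = G.minor c ra rb
        (Function.update g x (Function.update t l z)) := by
      intro z
      have := map_minor G (Polynomial.evalRingHom z) (Polynomial.C c) ra rb g'
      rw [Polynomial.coe_evalRingHom] at this
      refine this.trans ?_
      rw [Polynomial.eval_C]
      congr 1
      funext y l'
      by_cases hy : y = x
      · subst hy
        by_cases hl : l' = l
        · subst hl; simp [g']
        · simp [g', hl]
      · simp [g', hy]
    have hq0 : q ≠ 0 := by
      intro h0
      have := hq (t l)
      rw [h0, Polynomial.eval_zero, Function.update_eq_self] at this
      exact ht this.symm
    filter_upwards [ae_eval_ne_zero hq0] with z hz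
    rwa [← hq z]

/-! ### Tensors that route edge-disjoint paths -/

variable {G : OpenGraph V Eb Ed} {A : Finset Ed}

theorem OpenGraph.NetWalk.exists_edge_end {u v : NetVertex V} (p : G.NetWalk A u v) (h : u ≠ v) :
    (∃ e ∈ p.edges, u ∈ G.netEnds A e) ∧ ∃ e ∈ p.edges, v ∈ G.netEnds A e := by
  induction p with
  | nil u => exact absurd rfl h
  | @cons u w v e he p ih =>
    refine ⟨⟨e, by simp [OpenGraph.NetWalk.edges], by rw [he]; exact Sym2.mem_mk_left _ _⟩, ?_⟩
    by_cases hw : w = v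
    · exact ⟨e, by simp [OpenGraph.NetWalk.edges], by rw [he, hw]; exact Sym2.mem_mk_right _ _⟩
    · obtain ⟨-, e', he', hv⟩ := ih hw
      exact ⟨e', by simp [OpenGraph.NetWalk.edges, he'], hv⟩

/-- A function of the edges that agrees at common vertices of the graph is constant on a path. -/
theorem OpenGraph.NetWalk.constant_on_edges {Y : Type*} {w : Eb ⊕ Ed → Y} {u v : NetVertex V}
    (p : G.NetWalk A u v) (hv : v = .sink) (hn : p.support.Nodup)
    (hs : NetVertex.source ∉ p.support.tail)
    (hw : ∀ x : V, ∀ e ∈ p.edges, ∀ e' ∈ p.edges, NetVertex.bulk x ∈ G.netEnds A e →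
      NetVertex.bulk x ∈ G.netEnds A e' → w e = w e') :
    ∀ e ∈ p.edges, ∀ e' ∈ p.edges, w e = w e' := by
  induction p with
  | nil u => intro e he; simp [OpenGraph.NetWalk.edges] at he
  | @cons u v' v e h p ih =>
    cases p with
    | nil v =>
      intro e₁ h₁ e₂ h₂
      simp only [OpenGraph.NetWalk.edges, List.mem_singleton] at h₁ h₂
      rw [h₁, h₂]
    | @cons _ v'' _ e₂ h₂ p₂ =>
      have hn' : (OpenGraph.NetWalk.cons e₂ h₂ p₂).support.Nodup := (List.nodup_cons.1 hn).2
      simp only [OpenGraph.NetWalk.support, List.nodup_cons] at hn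
      have hs' : NetVertex.source ∉ (OpenGraph.NetWalk.cons e₂ h₂ p₂).support := hs
      have hall := ih hv hn' (fun hm => hs' (List.mem_of_mem_tail hm))
        (fun x a ha b hb => hw x a (by simp only [OpenGraph.NetWalk.edges] at ha ⊢
                                       exact List.mem_cons_of_mem _ ha)
          b (by simp only [OpenGraph.NetWalk.edges] at hb ⊢; exact List.mem_cons_of_mem _ hb))
      have hbulk : ∃ x, v' = .bulk x := by
        rcases v' with _ | _ | x
        · exact absurd (by simp [OpenGraph.NetWalk.support]) hs'
        · subst hv
          exact absurd p₂.end_mem_support hn.2.1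
        · exact ⟨x, rfl⟩
      obtain ⟨x, rfl⟩ := hbulk
      have hee : w e = w e₂ := hw x e (by simp [OpenGraph.NetWalk.edges]) e₂
        (by simp [OpenGraph.NetWalk.edges]) (by rw [h]; exact Sym2.mem_mk_right _ _)
        (by rw [h₂]; exact Sym2.mem_mk_left _ _)
      have hfix : ∀ a ∈ (OpenGraph.NetWalk.cons e h (OpenGraph.NetWalk.cons e₂ h₂ p₂)).edges,
          w a = w e₂ := by
        intro a ha
        rw [OpenGraph.NetWalk.edges, List.mem_cons] at ha
        rcases ha with rfl | ha
        · exact hee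
        · exact hall a ha e₂ (by simp [OpenGraph.NetWalk.edges])
      intro a ha b hb
      rw [hfix a ha, hfix b hb]

theorem exists_leg_of_mem_netEnds (G : OpenGraph V Eb Ed) (A : Finset Ed) {x : V} {e : Eb ⊕ Ed}
    (h : NetVertex.bulk x ∈ G.netEnds A e) : ∃ l : G.Leg x, legEdge l.1 = e := by
  rcases e with e | e
  · simp only [OpenGraph.netEnds, Sym2.mem_iff, NetVertex.bulk.injEq] at h
    rcases h with h | h
    · exact ⟨⟨Sum.inl (e, false), h.symm⟩, rfl⟩
    · exact ⟨⟨Sum.inl (e, true), h.symm⟩, rfl⟩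
  · have hx : x = G.bdryEnd e := by
      by_cases he : e ∈ A <;> simpa [OpenGraph.netEnds, he] using h
    exact ⟨⟨Sum.inr e, hx.symm⟩, rfl⟩

/-- Some tensors give a state matrix with a nonzero minor of size `D ^ F`. -/
theorem exists_minor_ne_zero (G : OpenGraph V Eb Ed) (A : Finset Ed) (D : ℕ) [NeZero D] :
    ∃ (ra : (Fin (G.maxflow A) → Fin D) → {e // e ∈ A} → Fin D)
      (rb : (Fin (G.maxflow A) → Fin D) → {e // e ∉ A} → Fin D) (g : G.Tensors D),
      G.minor (((1 / Real.sqrt D : ℝ) : ℂ) ^ Fintype.card Eb) ra rb g ≠ 0 := by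
  classical
  obtain ⟨p, hp1, hp2⟩ := (G.isGreatest_maxflow A).1
  -- Edge-disjointness makes it well defined to colour an edge by the path through it.
  have hcol : ∃ col : Eb ⊕ Ed → Option (Fin (G.maxflow A)),
      ∀ e i, col e = some i ↔ e ∈ (p i).edges := by
    refine ⟨fun e => if h : ∃ i, e ∈ (p i).edges then some h.choose else none, fun e i => ?_⟩
    beta_reduce
    by_cases h : ∃ i, e ∈ (p i).edges
    · rw [dif_pos h, Option.some_inj]
      constructor
      · rintro rfl; exact h.choose_spec
      · intro hi
        by_contra hne
        exact hp2 hne h.choose_spec hi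
    · rw [dif_neg h]
      exact ⟨fun h' => absurd h' (by simp), fun h' => absurd ⟨i, h'⟩ h⟩
  obtain ⟨col, hcol⟩ := hcol
  let lab : (Fin (G.maxflow A) → Fin D) → Eb ⊕ Ed → Fin D := fun s e => (col e).elim 0 s
  let Good : (x : V) → (G.Leg x → Fin D) → Prop := fun x t =>
    (∀ l l' : G.Leg x, ∀ i, col (legEdge l.1) = some i → col (legEdge l'.1) = some i →
      t l = t l') ∧ ∀ l : G.Leg x, col (legEdge l.1) = none → t l = 0
  have hgood : ∀ w : Eb ⊕ Ed → Fin D, (∀ x, Good x (G.edgeLabel w x)) ↔ ∃ s, w = lab s := by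
    intro w
    constructor
    · intro h
      have hconst : ∀ i, ∀ e ∈ (p i).edges, ∀ e' ∈ (p i).edges, w e = w e' := by
        intro i
        refine (p i).constant_on_edges rfl (hp1 i) ?_ ?_
        · have := hp1 i
          generalize p i = q at this
          cases q with
          | cons e h q =>
            simp only [OpenGraph.NetWalk.support, List.nodup_cons] at this
            exact this.1
        · intro x e he e' he' hx hx'
          obtain ⟨l, rfl⟩ := exists_leg_of_mem_netEnds G A hx
          obtain ⟨l', rfl⟩ := exists_leg_of_mem_netEnds G A hx'
          exact (h x).1 l l' i ((hcol _ _).2 he) ((hcol _ _).2 he')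
      have hne : ∀ i, ∃ e, e ∈ (p i).edges := fun i => by
        obtain ⟨⟨e, he, -⟩, -⟩ := (p i).exists_edge_end (by simp)
        exact ⟨e, he⟩
      choose f hf using hne
      refine ⟨fun i => w (f i), funext fun e => ?_⟩
      rcases hc : col e with _ | i
      · have hx : ∃ x, NetVertex.bulk x ∈ G.netEnds A e := by
          rcases e with e | e
          · exact ⟨_, Sym2.mem_mk_left _ _⟩
          · exact ⟨G.bdryEnd e, by by_cases he : e ∈ A <;> simp [OpenGraph.netEnds, he]⟩
        obtain ⟨x, hx⟩ := hx
        obtain ⟨l, rfl⟩ := exists_leg_of_mem_netEnds G A hx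
        have := (h x).2 l hc
        simp only [lab, hc]
        exact this
      · simp only [lab, hc]
        exact hconst i e ((hcol e i).1 hc) _ (hf i)
    · rintro ⟨s, rfl⟩ x
      refine ⟨fun l l' i hl hl' => ?_, fun l hl => ?_⟩
      · simp only [OpenGraph.edgeLabel, lab, hl, hl']
      · simp only [OpenGraph.edgeLabel, lab, hl, Option.elim]
  have hA : ∀ i, ∃ e : {e // e ∈ A}, col (Sum.inr e.1) = some i := by
    intro i
    obtain ⟨-, e, he, hx⟩ := (p i).exists_edge_end (by simp)
    rcases e with e | e
    · simp [OpenGraph.netEnds] at hx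
    · by_cases h : e ∈ A
      · exact ⟨⟨e, h⟩, (hcol _ _).2 he⟩
      · simp [OpenGraph.netEnds, h] at hx
  have hB : ∀ i, ∃ e : {e // e ∉ A}, col (Sum.inr e.1) = some i := by
    intro i
    obtain ⟨⟨e, he, hx⟩, -⟩ := (p i).exists_edge_end (by simp)
    rcases e with e | e
    · simp [OpenGraph.netEnds] at hx
    · by_cases h : e ∈ A
      · simp [OpenGraph.netEnds, h] at hx
      · exact ⟨⟨e, h⟩, (hcol _ _).2 he⟩
  -- Each tensor is the indicator that legs of the same path agree and unused legs carry `0`. A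
  -- label is thus transmitted unchanged along each path, and the selected submatrix is a nonzero
  -- multiple of the identity.
  refine ⟨fun s e => lab s (Sum.inr e.1), fun s e => lab s (Sum.inr e.1),
    fun x t => if Good x t then 1 else 0, ?_⟩
  set c : ℂ := ((1 / Real.sqrt D : ℝ) : ℂ) ^ Fintype.card Eb with hc
  have hc0 : c ≠ 0 := by
    have : (0 : ℝ) < D := by exact_mod_cast Nat.pos_of_ne_zero (NeZero.ne D)
    exact pow_ne_zero _ (Complex.ofReal_ne_zero.2 (by positivity))
  have hprod : ∀ w : Eb ⊕ Ed → Fin D, (∏ x, if Good x (G.edgeLabel w x) then (1 : ℂ) else 0) =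
      if ∃ s, w = lab s then 1 else 0 := by
    intro w
    by_cases h : ∀ x, Good x (G.edgeLabel w x)
    · rw [if_pos ((hgood w).1 h)]
      exact Finset.prod_eq_one fun x _ => if_pos (h x)
    · rw [if_neg fun h' => h ((hgood w).2 h')]
      push Not at h
      obtain ⟨x, hx⟩ := h
      exact Finset.prod_eq_zero (Finset.mem_univ x) (if_neg hx)
  have hmat : Matrix.of (fun s s' : Fin (G.maxflow A) → Fin D => c * ∑ k : Eb → Fin D, ∏ x,
      if Good x (G.legLabel k (glue A (fun e => lab s (Sum.inr e.1))
        (fun e => lab s' (Sum.inr e.1))) x) then (1 : ℂ) else 0) = Matrix.diagonal fun _ => c := by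
    ext s s'
    rw [Matrix.of_apply]
    simp_rw [legLabel_eq_edgeLabel, hprod]
    have hiff : ∀ k : Eb → Fin D, (∃ s'', Sum.elim k (glue A (fun e => lab s (Sum.inr e.1))
        (fun e => lab s' (Sum.inr e.1))) = lab s'') ↔ s = s' ∧ k = fun e => lab s (Sum.inl e) := by
      intro k
      constructor
      · rintro ⟨s'', h⟩
        have h1 : s = s'' := by
          funext i
          obtain ⟨e, he⟩ := hA i
          have := congrFun h (Sum.inr e.1)
          simpa [glue, e.2, lab, he] using this
        have h2 : s' = s'' := by
          funext i
          obtain ⟨e, he⟩ := hB i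
          have := congrFun h (Sum.inr e.1)
          simpa [glue, e.2, lab, he] using this
        subst h1
        exact ⟨h2.symm, funext fun e => congrFun h (Sum.inl e)⟩
      · rintro ⟨rfl, rfl⟩
        refine ⟨s, funext fun e => ?_⟩
        rcases e with e | e
        · rfl
        · by_cases he : e ∈ A <;> simp [glue, he]
    simp_rw [hiff]
    by_cases hss : s = s'
    · subst hss
      simp
    · simp [hss]
  rw [OpenGraph.minor]
  have hdet := congrArg Matrix.det hmat
  rw [Matrix.det_diagonal] at hdet
  refine ne_of_eq_of_ne hdet ?_
  exact Finset.prod_ne_zero_iff.2 fun _ _ => hc0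

/-- The rank of the reduced state is almost surely `D ^ F`. -/
theorem ae_rank_reducedState [Nonempty Ed] (G : OpenGraph V Eb Ed) (A : Finset Ed) {D : ℕ}
    (hD : D ≠ 0) :
    ∀ᵐ g ∂(G.tensorLaw D), (G.reducedState A D g).rank = D ^ G.maxflow A := by
  have : NeZero D := ⟨hD⟩
  obtain ⟨ra, rb, g₀, h₀⟩ := exists_minor_ne_zero G A D
  filter_upwards [ae_minor_ne_zero G _ ra rb h₀] with g hg
  refine le_antisymm (rank_reducedState_le G A D g) ?_
  rw [minor_eq_det] at hg
  have h1 := Matrix.rank_of_isUnit _ ((Matrix.isUnit_iff_isUnit_det _).2 (isUnit_iff_ne_zero.2 hg))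
  rw [Fintype.card_fun, Fintype.card_fin, Fintype.card_fin] at h1
  rw [rank_reducedState, ← h1]
  exact Matrix.rank_submatrix_le _ _ _

end

/-! ### Moments of measures with compact support -/

section Moments

theorem integrable_of_measure_compl_Icc_eq_zero {ν : Measure ℝ} [IsFiniteMeasure ν] {R : ℝ}
    (hν : ν (Set.Icc 0 R)ᶜ = 0) {f : ℝ → ℝ} (hf : Continuous f) : Integrable f ν := by
  have h : ν.restrict (Set.Icc 0 R) = ν := Measure.restrict_eq_self_of_ae_mem (by
    rw [ae_iff]; exact hν)
  rw [← h]
  exact hf.continuousOn.integrableOn_compact isCompact_Icc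

theorem abs_integral_sub_integral_le {ν : Measure ℝ} [IsProbabilityMeasure ν] {R δ : ℝ}
    (hν : ν (Set.Icc 0 R)ᶜ = 0) {f g : ℝ → ℝ} (hf : Continuous f) (hg : Continuous g)
    (h : ∀ x ∈ Set.Icc 0 R, |g x - f x| ≤ δ) : |∫ t, g t ∂ν - ∫ t, f t ∂ν| ≤ δ := by
  rw [← integral_sub (integrable_of_measure_compl_Icc_eq_zero hν hg)
    (integrable_of_measure_compl_Icc_eq_zero hν hf)]
  have hae : ∀ᵐ t ∂ν, ‖g t - f t‖ ≤ δ := by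
    have hmem : ∀ᵐ t ∂ν, t ∈ Set.Icc 0 R := by rw [ae_iff]; exact hν
    filter_upwards [hmem] with t ht using h t ht
  simpa using norm_integral_le_of_norm_le_const hae

/-- Measures on `[0, R]` whose first moments are close have close integrals of `f`, uniformly. -/
theorem exists_moments_close (R : ℝ) {f : ℝ → ℝ} (hf : Continuous f) {ε : ℝ} (hε : 0 < ε) :
    ∃ (N : ℕ) (η : ℝ), 0 < η ∧ ∀ (μ ν : Measure ℝ), IsProbabilityMeasure μ →
      IsProbabilityMeasure ν → μ (Set.Icc 0 R)ᶜ = 0 → ν (Set.Icc 0 R)ᶜ = 0 →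
      (∀ n, 1 ≤ n → n ≤ N → |∫ t, t ^ n ∂ν - ∫ t, t ^ n ∂μ| ≤ η) →
      |∫ t, f t ∂ν - ∫ t, f t ∂μ| ≤ ε := by
  obtain ⟨p, hp⟩ := exists_polynomial_near_of_continuousOn 0 R f hf.continuousOn (ε / 3)
    (by positivity)
  set S : ℝ := ∑ j ∈ Finset.range (p.natDegree + 1), |p.coeff j| with hS
  have hS0 : 0 ≤ S := Finset.sum_nonneg fun _ _ => abs_nonneg _
  -- The error splits into three: two for approximating `f` by `p`, one for the moments of `p`. `S +
  -- 1` replaces `S` because `S` may vanish.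
  refine ⟨p.natDegree, ε / 3 / (S + 1), by positivity, fun μ ν hμ1 hν1 hμ hν hmom => ?_⟩
  have e1 := abs_integral_sub_integral_le hμ hf p.continuous fun x hx => (hp x hx).le
  have e2 := abs_integral_sub_integral_le hν hf p.continuous fun x hx => (hp x hx).le
  have hexp : ∀ (κ : Measure ℝ) [IsProbabilityMeasure κ], κ (Set.Icc 0 R)ᶜ = 0 →
      ∫ t, p.eval t ∂κ = ∑ j ∈ Finset.range (p.natDegree + 1), p.coeff j * ∫ t, t ^ j ∂κ := by
    intro κ _ hκ
    simp_rw [Polynomial.eval_eq_sum_range]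
    rw [integral_finsetSum _ fun j _ => (integrable_of_measure_compl_Icc_eq_zero hκ
      (continuous_pow j)).const_mul _]
    simp_rw [integral_const_mul]
  have e3 : |∫ t, p.eval t ∂ν - ∫ t, p.eval t ∂μ| ≤ ε / 3 := by
    rw [hexp ν hν, hexp μ hμ, ← Finset.sum_sub_distrib]
    calc _ ≤ ∑ j ∈ Finset.range (p.natDegree + 1), |p.coeff j| * (ε / 3 / (S + 1)) := by
          refine (Finset.abs_sum_le_sum_abs _ _).trans (Finset.sum_le_sum fun j hj => ?_)
          rw [← mul_sub, abs_mul]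
          refine mul_le_mul_of_nonneg_left ?_ (abs_nonneg _)
          rcases Nat.eq_zero_or_pos j with rfl | h1
          · simp
            positivity
          · exact hmom j h1 (Nat.lt_succ_iff.1 (Finset.mem_range.1 hj))
      _ = S * (ε / 3 / (S + 1)) := by rw [Finset.sum_mul]
      _ ≤ (S + 1) * (ε / 3 / (S + 1)) := by gcongr; linarith
      _ = ε / 3 := by field_simp
  rw [abs_le] at *
  constructor <;> linarith [e1.1, e1.2, e2.1, e2.2, e3.1, e3.2]

/-- A probability measure on `[0, R]` is determined by its moments. -/
theorem eq_of_moments_eq {R : ℝ} {μ ν : Measure ℝ} [IsProbabilityMeasure μ]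
    [IsProbabilityMeasure ν] (hμ : μ (Set.Icc 0 R)ᶜ = 0) (hν : ν (Set.Icc 0 R)ᶜ = 0)
    (h : ∀ n, 1 ≤ n → ∫ t, t ^ n ∂ν = ∫ t, t ^ n ∂μ) : ν = μ := by
  refine ext_of_forall_integral_eq_of_IsFiniteMeasure fun f => ?_
  refine eq_of_abs_sub_le_all fun ε hε => ?_
  obtain ⟨N, η, hη, hcl⟩ := exists_moments_close R f.continuous hε
  refine hcl μ ν inferInstance inferInstance hμ hν fun n hn _ => ?_
  rw [h n hn, sub_self, abs_zero]
  exact hη.le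

/-- A sequence that is approximated by moments of probability measures on `[0, R]` is the moment
sequence of such a measure. -/
theorem exists_measure_of_approx_moments {R : ℝ} {m : ℕ → ℝ}
    (h : ∀ N : ℕ, ∃ ν : Measure ℝ, IsProbabilityMeasure ν ∧ ν (Set.Icc 0 R)ᶜ = 0 ∧
      ∀ n, 1 ≤ n → n ≤ N → |∫ t, t ^ n ∂ν - m n| ≤ 1 / ((N : ℝ) + 1)) :
    ∃ μ : Measure ℝ, IsProbabilityMeasure μ ∧ μ (Set.Icc 0 R)ᶜ = 0 ∧
      ∀ n, 1 ≤ n → ∫ t, t ^ n ∂μ = m n := by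
  choose ν hν1 hν hmom using h
  have hmeas : MeasurableSet (Set.Icc (0 : ℝ) R) := measurableSet_Icc
  have hemb := MeasurableEmbedding.subtype_coe hmeas
  let κ : ℕ → Measure (Set.Icc (0 : ℝ) R) := fun N => Measure.comap Subtype.val (ν N)
  have hmap : ∀ N, (κ N).map Subtype.val = ν N := by
    intro N
    rw [map_comap_subtype_coe hmeas]
    exact Measure.restrict_eq_self_of_ae_mem (by rw [ae_iff]; exact hν N)
  have hκ1 : ∀ N, IsProbabilityMeasure (κ N) := fun N => by
    have := hν1 N
    rw [← hmap N] at this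
    exact Measure.isProbabilityMeasure_of_map (Subtype.val : Set.Icc (0 : ℝ) R → ℝ)
  let P : ℕ → ProbabilityMeasure (Set.Icc (0 : ℝ) R) := fun N => ⟨κ N, hκ1 N⟩
  -- Probability measures on the compact interval form a compact space; a limit along a nonprincipal
  -- ultrafilter replaces a convergent subsequence.
  obtain ⟨Q, hQ⟩ : ∃ Q, Tendsto P (hyperfilter ℕ) (𝓝 Q) := by
    obtain ⟨Q, -, hQ⟩ := isCompact_univ.ultrafilter_le_nhds ((hyperfilter ℕ).map P) (by simp)
    exact ⟨Q, hQ⟩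
  have hQint : ∀ (f : ℝ → ℝ), Continuous f →
      ∫ t, f t ∂((Q : Measure (Set.Icc (0 : ℝ) R)).map Subtype.val) =
        ∫ t : Set.Icc (0 : ℝ) R, f t ∂(Q : Measure (Set.Icc (0 : ℝ) R)) :=
    fun f hf => hemb.integral_map _
  have hQp : IsProbabilityMeasure ((Q : Measure (Set.Icc (0 : ℝ) R)).map Subtype.val) :=
    Measure.isProbabilityMeasure_map measurable_subtype_coe.aemeasurable
  refine ⟨(Q : Measure (Set.Icc (0 : ℝ) R)).map Subtype.val, hQp, ?_, fun n hn => ?_⟩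
  · rw [Measure.map_apply measurable_subtype_coe hmeas.compl]
    convert measure_empty (μ := (Q : Measure (Set.Icc (0 : ℝ) R)))
    ext x
    simp
  · rw [hQint _ (continuous_pow n)]
    let φ : BoundedContinuousFunction (Set.Icc (0 : ℝ) R) ℝ :=
      BoundedContinuousFunction.mkOfCompact ⟨fun t => (t : ℝ) ^ n, by fun_prop⟩
    have h1 := (ProbabilityMeasure.tendsto_iff_forall_integral_tendsto.1 hQ) φ
    have h2 : Tendsto (fun N => ∫ t, t ^ n ∂(ν N)) (hyperfilter ℕ) (𝓝 (m n)) := by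
      refine Tendsto.mono_left ?_ Nat.hyperfilter_le_atTop
      rw [tendsto_iff_norm_sub_tendsto_zero]
      refine tendsto_of_tendsto_of_tendsto_of_le_of_le' tendsto_const_nhds
        tendsto_one_div_add_atTop_nhds_zero_nat (Eventually.of_forall fun _ => norm_nonneg _) ?_
      filter_upwards [eventually_ge_atTop n] with N hN using hmom N n hn hN
    refine tendsto_nhds_unique h1 (h2.congr fun N => ?_)
    rw [← hmap N, hemb.integral_map]
    rfl

end Moments

/-! ### The spectrum of the rescaled state -/

section Spectrum

variable {V Eb Ed : Type*} [Fintype V] [DecidableEq V] [Fintype Eb] [DecidableEq Eb]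
  [Fintype Ed] [DecidableEq Ed] (G : OpenGraph V Eb Ed) (A : Finset Ed)

open scoped ComplexOrder in
theorem eigenvalues_rescaledState_nonneg (D : ℕ) (g : G.Tensors D) (k) :
    0 ≤ (G.isHermitian_rescaledState A D g).eigenvalues k := by
  have h : (G.rescaledState A D g).PosSemidef := by
    rw [OpenGraph.rescaledState, reducedState_eq]
    exact (Matrix.posSemidef_self_mul_conjTranspose _).smul (by positivity)
  exact h.eigenvalues_nonneg k

theorem card_eigenvalues_ne_zero {D : ℕ} (hD : D ≠ 0) (g : G.Tensors D) :
    (Finset.univ.filter fun k =>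
      (G.isHermitian_rescaledState A D g).eigenvalues k ≠ 0).card =
      (G.reducedState A D g).rank := by
  have hc : ((((D : ℝ) ^ G.maxflow A * ((D : ℝ) ^ Fintype.card Ed)⁻¹ : ℝ)) : ℂ) ≠ 0 := by
    have : (D : ℝ) ≠ 0 := Nat.cast_ne_zero.2 hD
    rw [Complex.ofReal_ne_zero]
    positivity
  have h : (G.rescaledState A D g).rank = (G.reducedState A D g).rank := by
    have e : G.rescaledState A D g =
        ((((D : ℝ) ^ G.maxflow A * ((D : ℝ) ^ Fintype.card Ed)⁻¹ : ℝ)) : ℂ) •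
          G.reducedState A D g := by
      ext a a'
      simp [OpenGraph.rescaledState]
    rw [e, Matrix.rank_smul_of_mem_nonZeroDivisors _ (mem_nonZeroDivisors_of_ne_zero hc)]
  rw [← h, (G.isHermitian_rescaledState A D g).rank_eq_card_non_zero_eigs, Fintype.card_subtype]

theorem integral_empiricalMeasure (D : ℕ) (g : G.Tensors D) (f : ℝ → ℝ) :
    ∫ t, f t ∂(G.empiricalMeasure A D g) = ((D : ℝ) ^ G.maxflow A)⁻¹ *
      ∑ k with (G.isHermitian_rescaledState A D g).eigenvalues k ≠ 0,
        f ((G.isHermitian_rescaledState A D g).eigenvalues k) := by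
  rw [OpenGraph.empiricalMeasure, integral_smul_measure, integral_finsetSum_measure
    fun k _ => integrable_dirac (by simp)]
  simp

/-- For positive order the omitted zero eigenvalues contribute nothing. -/
theorem integral_pow_empiricalMeasure (D : ℕ) (g : G.Tensors D) {n : ℕ} (hn : n ≠ 0) :
    ∫ t, t ^ n ∂(G.empiricalMeasure A D g) = G.powerSum A D n g := by
  rw [integral_empiricalMeasure, OpenGraph.powerSum, Finset.sum_filter]
  congr 1
  refine Finset.sum_congr rfl fun k _ => ?_
  split_ifs with h
  · rfl
  · rw [not_not.1 h, zero_pow hn]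

theorem isProbabilityMeasure_empiricalMeasure {D : ℕ} (hD : D ≠ 0) {g : G.Tensors D}
    (h : (G.reducedState A D g).rank = D ^ G.maxflow A) :
    IsProbabilityMeasure (G.empiricalMeasure A D g) := by
  refine ⟨?_⟩
  rw [OpenGraph.empiricalMeasure, Measure.smul_apply, Measure.finsetSum_apply]
  simp only [measure_univ, Finset.sum_const, card_eigenvalues_ne_zero G A hD, h, nsmul_eq_mul,
    mul_one, smul_eq_mul, Nat.cast_pow]
  exact ENNReal.inv_mul_cancel (pow_ne_zero _ (Nat.cast_ne_zero.2 hD))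
    (ENNReal.pow_ne_top (ENNReal.natCast_ne_top D))

theorem empiricalMeasure_compl_Icc {D : ℕ} {g : G.Tensors D} {R : ℝ}
    (h : ∀ k, (G.isHermitian_rescaledState A D g).eigenvalues k ≤ R) :
    G.empiricalMeasure A D g (Set.Icc 0 R)ᶜ = 0 := by
  rw [OpenGraph.empiricalMeasure, Measure.smul_apply, Measure.finsetSum_apply,
    Finset.sum_eq_zero, smul_zero]
  intro k _
  rw [Measure.dirac_apply' _ measurableSet_Icc.compl]
  simp [h k, eigenvalues_rescaledState_nonneg G A D g k]

theorem pow_le_powerSum {D d : ℕ} {g : G.Tensors D} {R : ℝ} (hR : 0 ≤ R)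
    (h : ∃ k, R < (G.isHermitian_rescaledState A D g).eigenvalues k) :
    ((D : ℝ) ^ G.maxflow A)⁻¹ * R ^ d ≤ G.powerSum A D d g := by
  obtain ⟨k, hk⟩ := h
  refine mul_le_mul_of_nonneg_left ?_ (by positivity)
  calc R ^ d ≤ (G.isHermitian_rescaledState A D g).eigenvalues k ^ d := by gcongr
    _ ≤ _ := Finset.single_le_sum
      (f := fun k => (G.isHermitian_rescaledState A D g).eigenvalues k ^ d)
      (fun k _ => pow_nonneg (eigenvalues_rescaledState_nonneg G A D g k) d) (Finset.mem_univ k)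

theorem powerSum_nonneg (D d : ℕ) (g : G.Tensors D) : 0 ≤ G.powerSum A D d g :=
  mul_nonneg (by positivity) (Finset.sum_nonneg fun k _ =>
    pow_nonneg (eigenvalues_rescaledState_nonneg G A D g k) d)

/-- Integer roots: a sequence of exponents that grows like a root of `D`. -/
theorem exists_root_seq (K : ℕ) : ∃ r : ℕ → ℕ, Tendsto r atTop atTop ∧
    ∀ D, 1 ≤ D → 1 ≤ r D ∧ r D ^ K ≤ D ∧ D < (r D + 1) ^ (K + 1) := by
  -- The exponent `K + 1` is positive even for `K = 0`, which is needed to bound `D` by a power of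
  -- `r D + 1`.
  refine ⟨fun D => Nat.findGreatest (fun d => d ^ (K + 1) ≤ D) D, ?_, fun D hD => ?_⟩
  · refine tendsto_atTop.2 fun B => ?_
    filter_upwards [eventually_ge_atTop (B ^ (K + 1) + B)] with D hD
    exact Nat.le_findGreatest (by omega) (by omega)
  · set d := Nat.findGreatest (fun d => d ^ (K + 1) ≤ D) D with hd
    have h1 : 1 ≤ d := Nat.le_findGreatest hD (by simpa using hD)
    have h2 : d ^ (K + 1) ≤ D :=
      Nat.findGreatest_spec (P := fun d => d ^ (K + 1) ≤ D) hD (by simpa using hD)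
    refine ⟨h1, (Nat.pow_le_pow_right h1 (Nat.le_succ K)).trans h2, ?_⟩
    rcases Nat.lt_or_ge D (d + 1) with h | h
    · exact h.trans_le (Nat.le_self_pow (Nat.succ_ne_zero K) _)
    · exact not_le.1 (Nat.findGreatest_is_greatest (P := fun d => d ^ (K + 1) ≤ D)
        (Nat.lt_succ_self d) h)

/-- With high probability, the rescaled state is bounded uniformly in the bond dimension. -/
theorem exists_tendsto_eigenvalue_gt [Nonempty Ed] (hG : G.BulkConnected) :
    ∃ R : ℝ, Tendsto (fun D : ℕ => (G.tensorLaw D).real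
      {g | ∃ k, R < (G.isHermitian_rescaledState A D g).eigenvalues k}) atTop (𝓝 0) := by
  obtain ⟨K, hK⟩ := exists_partitionSum_le G hG A
  obtain ⟨r, hr, hrD⟩ := exists_root_seq K
  set C : ℝ := 200 ^ Fintype.card V with hC
  have hC0 : 0 < C := by positivity
  set F := G.maxflow A with hF
  -- An eigenvalue above `2 * C` forces the `d`-th power sum to be at least `D ^ (-F) * (2 * C) ^
  -- d`, while its mean is at most `C ^ d`. Markov leaves `D ^ F / 2 ^ d`, where `D ^ F` is at most
  -- polynomial in `d`.
  refine ⟨2 * C, ?_⟩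
  have hlim : Tendsto (fun D : ℕ =>
      2 * (((r D + 1 : ℕ) : ℝ) ^ ((K + 1) * F) / 2 ^ (r D + 1))) atTop (𝓝 0) := by
    have h := (tendsto_pow_const_div_const_pow_of_one_lt ((K + 1) * F)
      (one_lt_two (α := ℝ))).comp ((tendsto_add_atTop_nat 1).comp hr)
    simpa using h.const_mul 2
  refine tendsto_of_tendsto_of_tendsto_of_le_of_le' tendsto_const_nhds hlim
    (Eventually.of_forall fun _ => measureReal_nonneg) ?_
  filter_upwards [eventually_ge_atTop 1] with D hD
  obtain ⟨h1, h2, h3⟩ := hrD D hD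
  set d := r D
  have hD0 : (0 : ℝ) < D := by exact_mod_cast hD
  have hint := integral_powerSum G A hG (D := D) (n := d) (by omega) (by omega)
  have hmarkov := mul_meas_ge_le_integral_of_nonneg
    (Eventually.of_forall fun g => powerSum_nonneg G A D d g)
    (integrable_powerSum G A D (n := d) (by omega)) (((D : ℝ) ^ F)⁻¹ * (2 * C) ^ d)
  rw [hint] at hmarkov
  have hsub : (G.tensorLaw D).real
      {g | ∃ k, 2 * C < (G.isHermitian_rescaledState A D g).eigenvalues k} ≤
      (G.tensorLaw D).real {g | ((D : ℝ) ^ F)⁻¹ * (2 * C) ^ d ≤ G.powerSum A D d g} :=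
    measureReal_mono fun g hg => pow_le_powerSum G A (by positivity) hg
  have hle := hmarkov.trans (hK d D (by omega) h2)
  rw [mul_comm, ← le_div_iff₀ (by positivity)] at hle
  refine hsub.trans (hle.trans ?_)
  have e1 : C ^ d / (((D : ℝ) ^ F)⁻¹ * (2 * C) ^ d) = (D : ℝ) ^ F / 2 ^ d := by
    rw [mul_pow]
    field_simp
  have e2 : (D : ℝ) ^ F ≤ ((d + 1 : ℕ) : ℝ) ^ ((K + 1) * F) := by
    rw [pow_mul]
    refine pow_le_pow_left₀ hD0.le ?_ _
    exact_mod_cast h3.le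
  calc _ = (D : ℝ) ^ F / 2 ^ d := e1
    _ ≤ ((d + 1 : ℕ) : ℝ) ^ ((K + 1) * F) / 2 ^ d := by gcongr
    _ = _ := by
      rw [pow_succ]
      field_simp

/-- The tensors for which the spectrum of the rescaled state behaves as expected. -/
def OpenGraph.typicalSet (D N : ℕ) (η R : ℝ) : Set (G.Tensors D) :=
  {g | (G.reducedState A D g).rank = D ^ G.maxflow A ∧
    (∀ k, (G.isHermitian_rescaledState A D g).eigenvalues k ≤ R) ∧
    ∀ n, 1 ≤ n → n ≤ N → |G.powerSum A D n g - G.numMinimizers A n| < η}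

/-- A union bound over the three defining conditions. `R` is chosen before `N` and `η`, so that one
interval carries all approximating measures. -/
theorem tendsto_compl_typicalSet [Nonempty Ed] (hG : G.BulkConnected) :
    ∃ R : ℝ, ∀ (N : ℕ) (η : ℝ), 0 < η →
      Tendsto (fun D : ℕ => (G.tensorLaw D).real (G.typicalSet A D N η R)ᶜ) atTop (𝓝 0) := by
  obtain ⟨R, hR⟩ := exists_tendsto_eigenvalue_gt G A hG
  refine ⟨R, fun N η hη => ?_⟩
  have hsum : Tendsto (fun D : ℕ => (G.tensorLaw D).real
      {g | ∃ k, R < (G.isHermitian_rescaledState A D g).eigenvalues k} +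
      ∑ n ∈ Finset.Icc 1 N, (G.tensorLaw D).real
        {g | η ≤ |G.powerSum A D n g - G.numMinimizers A n|}) atTop (𝓝 0) := by
    have := hR.add (tendsto_finsetSum (Finset.Icc 1 N) fun n hn =>
      tendsto_powerSum G hG A (n := n) (by have := (Finset.mem_Icc.1 hn).1; omega) hη)
    simpa using this
  refine tendsto_of_tendsto_of_tendsto_of_le_of_le' tendsto_const_nhds hsum
    (Eventually.of_forall fun _ => measureReal_nonneg) ?_
  filter_upwards [eventually_ge_atTop 1] with D hD
  have hrank : (G.tensorLaw D).real {g | (G.reducedState A D g).rank ≠ D ^ G.maxflow A} = 0 := by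
    rw [measureReal_def, show G.tensorLaw D {g | (G.reducedState A D g).rank ≠ D ^ G.maxflow A} = 0
      from ae_iff.1 (ae_rank_reducedState G A (by omega)), ENNReal.toReal_zero]
  have hsub : (G.typicalSet A D N η R)ᶜ ⊆
      {g | (G.reducedState A D g).rank ≠ D ^ G.maxflow A} ∪
      ({g | ∃ k, R < (G.isHermitian_rescaledState A D g).eigenvalues k} ∪
        ⋃ n ∈ Finset.Icc 1 N, {g | η ≤ |G.powerSum A D n g - G.numMinimizers A n|}) := by
    intro g hg
    by_contra hcon
    simp only [Set.mem_union, Set.mem_ofPred_eq, Set.mem_iUnion, Finset.mem_Icc, not_or,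
      not_exists, not_not, not_lt, not_le] at hcon
    exact hg ⟨hcon.1, hcon.2.1, fun n h1 h2 => hcon.2.2 n ⟨h1, h2⟩⟩
  refine (measureReal_mono hsub).trans ((measureReal_union_le _ _).trans ?_)
  rw [hrank, zero_add]
  exact (measureReal_union_le _ _).trans
    (add_le_add_right (measureReal_biUnion_finset_le _ _) _)

/-- An event that contains typical sets has probability tending to one. -/
theorem tendsto_one_of_subset {D₀ N : ℕ} {η R : ℝ} {S : (D : ℕ) → Set (G.Tensors D)}
    (h : Tendsto (fun D : ℕ => (G.tensorLaw D).real (G.typicalSet A D N η R)ᶜ) atTop (𝓝 0))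
    (hS : ∀ D, D₀ ≤ D → G.typicalSet A D N η R ⊆ S D) :
    Tendsto (fun D : ℕ => G.tensorLaw D (S D)) atTop (𝓝 1) := by
  have h1 : Tendsto (fun D : ℕ => 1 - G.tensorLaw D (G.typicalSet A D N η R)ᶜ) atTop (𝓝 1) := by
    have h2 : Tendsto (fun D : ℕ => G.tensorLaw D (G.typicalSet A D N η R)ᶜ) atTop (𝓝 0) := by
      have := ENNReal.tendsto_ofReal h
      simpa using this
    simpa using ENNReal.Tendsto.sub tendsto_const_nhds h2 (Or.inl ENNReal.one_ne_top)
  refine tendsto_of_tendsto_of_tendsto_of_le_of_le' h1 tendsto_const_nhds ?_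
    (Eventually.of_forall fun D => prob_le_one)
  filter_upwards [eventually_ge_atTop D₀] with D hD
  -- Subadditivity suffices here, so measurability of `S D` and of the typical set is not needed.
  rw [tsub_le_iff_right]
  calc 1 = G.tensorLaw D Set.univ := measure_univ.symm
    _ ≤ G.tensorLaw D (S D) + G.tensorLaw D (S D)ᶜ := measure_univ_le_add_compl _
    _ ≤ _ := by
      gcongr
      exact hS D hD

/-- An event of positive probability is nonempty: a single realization supplies a deterministic
measure with nearly the right moments. -/
theorem exists_mem_typicalSet {N : ℕ} {η R : ℝ}
    (h : Tendsto (fun D : ℕ => (G.tensorLaw D).real (G.typicalSet A D N η R)ᶜ) atTop (𝓝 0)) :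
    ∃ D : ℕ, D ≠ 0 ∧ (G.typicalSet A D N η R).Nonempty := by
  obtain ⟨D, hD, h1⟩ := ((eventually_ge_atTop 1).and (h.eventually (gt_mem_nhds one_pos))).exists
  refine ⟨D, by omega, ?_⟩
  by_contra hne
  rw [Set.not_nonempty_iff_eq_empty.1 hne, Set.compl_empty, probReal_univ] at h1
  exact lt_irrefl _ h1

end Spectrum

/-! ### The limit measure -/

section Limit

variable {V Eb Ed : Type*} [Fintype V] [DecidableEq V] [Fintype Eb] [DecidableEq Eb]
  [Fintype Ed] [DecidableEq Ed] (G : OpenGraph V Eb Ed) (A : Finset Ed)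

theorem eq_of_isNetworkMeasure {μ ν : Measure ℝ} (hμ : G.IsNetworkMeasure A μ)
    (hν : G.IsNetworkMeasure A ν) : ν = μ := by
  obtain ⟨R, hR⟩ := hμ.compactSupport
  obtain ⟨R', hR'⟩ := hν.compactSupport
  have := hμ.isProbability
  have := hν.isProbability
  refine eq_of_moments_eq (R := max R R') (measure_mono_null ?_ hR) (measure_mono_null ?_ hR')
    fun n hn => (hν.moments n hn).trans (hμ.moments n hn).symm
  · exact Set.compl_subset_compl.2 (Set.Icc_subset_Icc_right (le_max_left _ _))
  · exact Set.compl_subset_compl.2 (Set.Icc_subset_Icc_right (le_max_right _ _))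

/-- The limit measure is itself extracted from typical empirical measures, so the positivity of the
moment problem for `m_n` never has to be checked. On typical sets, closeness of finitely many
moments then controls `f`. -/
theorem exists_isNetworkMeasure_tendsto [Nonempty Ed] (hG : G.BulkConnected) :
    ∃ μ : Measure ℝ, G.IsNetworkMeasure A μ ∧
      ∀ f : ℝ → ℝ, Continuous f → ∀ ε : ℝ, 0 < ε →
        Tendsto (fun D : ℕ => G.tensorLaw D
            {g | |∫ t, f t ∂(G.empiricalMeasure A D g) - ∫ t, f t ∂μ| ≤ ε})
          atTop (𝓝 1) := by
  obtain ⟨R, hR⟩ := tendsto_compl_typicalSet G A hG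
  obtain ⟨μ, hμ1, hμ, hmom⟩ := exists_measure_of_approx_moments (R := R)
    (m := fun n => (G.numMinimizers A n : ℝ)) fun N => by
      obtain ⟨D, hD, g, hg⟩ := exists_mem_typicalSet G A (hR N (1 / ((N : ℝ) + 1)) (by positivity))
      refine ⟨G.empiricalMeasure A D g, isProbabilityMeasure_empiricalMeasure G A hD hg.1,
        empiricalMeasure_compl_Icc G A hg.2.1, fun n h1 h2 => ?_⟩
      rw [integral_pow_empiricalMeasure G A D g (by omega)]
      exact (hg.2.2 n h1 h2).le
  refine ⟨μ, ⟨hμ1, ⟨R, hμ⟩, hmom⟩, fun f hf ε hε => ?_⟩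
  obtain ⟨N, η, hη, hcl⟩ := exists_moments_close R hf hε
  refine tendsto_one_of_subset G A (D₀ := 1) (hR N η hη) fun D hD g hg => ?_
  refine hcl μ _ hμ1 (isProbabilityMeasure_empiricalMeasure G A (by omega) hg.1) hμ
    (empiricalMeasure_compl_Icc G A hg.2.1) fun n h1 h2 => ?_
  rw [integral_pow_empiricalMeasure G A D g (by omega), hmom n h1]
  exact (hg.2.2 n h1 h2).le

end Limit

end RTN

theorem theorem8p4 {V Eb Ed : Type*} [Fintype V] [DecidableEq V] [Fintype Eb] [DecidableEq Eb]
    [Fintype Ed] [DecidableEq Ed] [Nonempty Ed] (G : RTN.OpenGraph V Eb Ed)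
    (hG : G.BulkConnected) (A : Finset Ed) :
    (∀ (D : ℕ) (g : G.Tensors D), (G.reducedState A D g).rank ≤ D ^ G.maxflow A) ∧
    ∃ μ : Measure ℝ, G.IsNetworkMeasure A μ ∧ (∀ ν, G.IsNetworkMeasure A ν → ν = μ) ∧
      ∀ f : ℝ → ℝ, Continuous f → ∀ ε : ℝ, 0 < ε →
        Tendsto (fun D : ℕ => G.tensorLaw D
            {g | |∫ t, f t ∂(G.empiricalMeasure A D g) - ∫ t, f t ∂μ| ≤ ε})
          atTop (𝓝 1) := by
  obtain ⟨μ, hμ, hlim⟩ := RTN.exists_isNetworkMeasure_tendsto G A hG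
  exact ⟨fun D g => RTN.rank_reducedState_le G A D g, μ, hμ,
    fun ν hν => RTN.eq_of_isNetworkMeasure G A hμ hν, hlim⟩
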